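/- **Proposition 2.17 (Lipschitzness of discrete holomorphic functions).** *Setting.* Let $\Gamma\subset\mathbb C$ be an isoradial graph of mesh $\delta>0$: every face of $\Gamma$ is inscribed in a circle of radius $\delta$ whose centre lies inside the face. Let $\Gamma^*$ be the set of these centres and $\Lambda=\Gamma\cup\Gamma^*$. Equivalently, we are given a locally finite edge-to-edge tiling of the plane by rhombi with side $\delta$, whose vertices are coloured black ($\Gamma$) and white ($\Gamma^*$) so that each rhombus has vertices $v_1,v_2,v_3,v_4$ (counterclockwise) with $v_1,v_3\in\Gamma$ and $v_2,v_4\in\Gamma^*$; the edges of $\Gamma$ are the black diagonals of the rhombi. A rhombus is denoted by its centre $z$, and $\diamondsuit$ is the set of the centres; $z\sim v$ means that $v$ is a vertex of the rhombus $z$, and $u\sim u'$ means that $u,u'\in\Gamma$ are joined by an edge. Let $\theta(z)$ be the half-angle of the rhombus $z$ at its black vertices. Assume that all angles of the rhombi belong to $[\eta,\pi-\eta]$, where $\eta>0$ is fixed. For $z\in\diamondsuit$ and $v\in\Lambda$ put $\mu_\diamondsuit(z)=\delta^2\sin 2\theta(z)$, $\mu_\Lambda(v)=\frac14\sum_{z\sim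 v}\mu_\diamondsuit(z)$. For $F$ defined on (part of) $\diamondsuit$ put $$[\bar\partial^\delta F](v)=\frac1{4\mu_\Lambda(v)}\sum_{z\sim v} i(v^+_z-v^-_z)F(z),\qquad [m^\delta F](v)=\frac1{4\mu_\Lambda(v)}\sum_{z\sim v}\mu_\diamondsuit(z)F(z),$$ where $v^+_z$ and $v^-_z$ are the vertices of the rhombus $z$ that follow and precede $v$ in counterclockwise order, and $[\mathcal B F](z)=\Pr[F(z);\overline{v_1-v_3}]$, where $v_1,v_3$ are the black vertices of $z$ and $\Pr[\,\cdot\,;\xi]$ is the orthogonal projection onto the line $\xi\mathbb R$. For $u_0\in\Gamma$ and $R>0$ let $\mathrm{Int}\,B^\delta_\Gamma(u_0,R)$ be the connected component containing $u_0$ of the part of $\Gamma$ lying inside the open disc $B(u_0,R)$; let $B^\delta_\Gamma(u_0,R)$ consist of these vertices and all their neighbours in $\Gamma$; let $B^\delta_\diamondsuit(u_0,R)$ be the set of $z\in\diamondsuit$ lying in the closed union of the faces of $\Gamma$ incident to vertices of $\mathrm{Int}\,B^\delta_\Gamma(u_0,R)$. A function $F:B^\delta_\diamondsuit(u_0,R)\to\mathbb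 C$ is discrete holomorphic if $[\bar\partial^\delta F](v)=0$ for every $v\in \mathrm{Int}\,B^\delta_\Gamma(u_0,R)$ and for every $v\in\Gamma^*$ that is the centre of a face incident to such a vertex. *Claim.* There is a constant $C>0$, depending only on $\eta$ (not on $\delta$, the graph, $u_0$, $R$, $r$ or $F$), such that the following holds. Let $u_0\in\Gamma$, $R>0$, let $F$ be discrete holomorphic in $B^\delta_\diamondsuit(u_0,R)$ with $F=\mathcal BF$, and let $|F|\le M$ on $B^\delta_\diamondsuit(u_0,R)$. Then: 1. for each neighbour $u_s\sim u_0$ in $\Gamma$ and $z_s=\frac12(u_s+u_0)$, $$\Bigl|F(z_s)-\Pr\bigl[\,2[m^\delta F](u_0);\ \overline{u_s-u_0}\,\bigr]\Bigr|\le C\cdot\frac{M\delta}{R};$$ 2. if $0<r<R$, $B^\delta_\Gamma(u_0,r)\subset \mathrm{Int}\,B^\delta_\Gamma(u_0,R)$ and $u_1,u_2\in B^\delta_\Gamma(u_0,r)$, then $$\bigl|[m^\delta F](u_2)-[m^\delta F](u_1)\bigr|\le C\cdot\frac{M\,|u_2-u_1|}{R-r}.$$ -/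

import Mathlib

open scoped ComplexConjugate

noncomputable section

/-- A rhombic lattice of mesh `δ`: a locally finite edge-to-edge tiling of the plane by rhombi with
side length `δ`, whose vertices are properly two-coloured (black / white) so that opposite vertices
of a rhombus have the same colour.  The black vertices with the black diagonals of the rhombi as
edges form an isoradial graph `Γ` (each face is inscribed in a circle of radius `δ` whose centre lies
inside the face); the white vertices are the centres of these circles, that is, the vertices of the
dual graph `Γ*`.

A rhombus is named by its centre `z ∈ diamond`; its vertices in counterclockwise order are
`u₁ z, w₁ z, u₂ z, w₂ z`, with `u₁ z, u₂ z` black and `w₁ z, w₂ z` white. The values of the four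
vertex maps outside of `diamond` play no role. -/
structure RhombicLattice (δ : ℝ) where
  /-- the set `◇` of the centres of the rhombi -/
  diamond : Set ℂ
  u₁ : ℂ → ℂ
  w₁ : ℂ → ℂ
  u₂ : ℂ → ℂ
  w₂ : ℂ → ℂ
  side₁ : ∀ z ∈ diamond, ‖w₁ z - u₁ z‖ = δ
  side₂ : ∀ z ∈ diamond, ‖u₂ z - w₁ z‖ = δ
  side₃ : ∀ z ∈ diamond, ‖w₂ z - u₂ z‖ = δ
  side₄ : ∀ z ∈ diamond, ‖u₁ z - w₂ z‖ = δ
  /-- the two white vertices are distinct -/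
  white_ne : ∀ z ∈ diamond, w₁ z ≠ w₂ z
  /-- the rhombus is non-degenerate and its vertices are listed counterclockwise -/
  ccw : ∀ z ∈ diamond, 0 < (conj (w₁ z - u₁ z) * (u₂ z - u₁ z)).im
  center : ∀ z ∈ diamond, (u₁ z + u₂ z) / 2 = z
  /-- a black vertex of one rhombus is never a white vertex of another one -/
  black_ne_white : ∀ z ∈ diamond, ∀ z' ∈ diamond,
    Disjoint ({u₁ z, u₂ z} : Set ℂ) {w₁ z', w₂ z'}
  /-- the closed rhombi cover the plane -/
  cover : ∀ p : ℂ, ∃ z ∈ diamond, p ∈ convexHull ℝ ({u₁ z, w₁ z, u₂ z, w₂ z} : Set ℂ)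
  /-- edge-to-edge: two different closed rhombi meet exactly in the hull of their common vertices,
  i.e. (because of the colouring) in nothing, in a common vertex or in a common side -/
  edge_to_edge : ∀ z ∈ diamond, ∀ z' ∈ diamond, z ≠ z' →
    convexHull ℝ ({u₁ z, w₁ z, u₂ z, w₂ z} : Set ℂ) ∩
        convexHull ℝ ({u₁ z', w₁ z', u₂ z', w₂ z'} : Set ℂ) =
      convexHull ℝ (({u₁ z, w₁ z, u₂ z, w₂ z} : Set ℂ) ∩ {u₁ z', w₁ z', u₂ z', w₂ z'})
  /-- every vertex belongs to finitely many rhombi -/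
  locally_finite : ∀ v : ℂ,
    {z ∈ diamond | v ∈ ({u₁ z, w₁ z, u₂ z, w₂ z} : Set ℂ)}.Finite

namespace RhombicLattice

variable {δ : ℝ} (L : RhombicLattice δ)

/-- The vertex set of the isoradial graph `Γ`. -/
def black : Set ℂ := {v | ∃ z ∈ L.diamond, v = L.u₁ z ∨ v = L.u₂ z}

/-- `u ∼ v` in `Γ`: `u` and `v` are the two black vertices of one rhombus. -/
def Adj (u v : ℂ) : Prop :=
  ∃ z ∈ L.diamond, (u = L.u₁ z ∧ v = L.u₂ z) ∨ (u = L.u₂ z ∧ v = L.u₁ z)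

/-- The rhombi `z ∼ v` around a vertex `v ∈ Λ = Γ ∪ Γ*` (given by their centres). -/
def star (v : ℂ) : Set ℂ :=
  {z ∈ L.diamond | v ∈ ({L.u₁ z, L.w₁ z, L.u₂ z, L.w₂ z} : Set ℂ)}

/-- The half-angle of the rhombus `z` at its black vertices. -/
def θ (z : ℂ) : ℝ := InnerProductGeometry.angle (L.w₁ z - L.u₁ z) (L.w₂ z - L.u₁ z) / 2

/-- All angles of all rhombi (they are `2 θ` and `π - 2 θ`) belong to `[η, π - η]`. -/
def AnglesBounded (η : ℝ) : Prop := ∀ z ∈ L.diamond, 2 * L.θ z ∈ Set.Icc η (Real.pi - η)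

/-- The weight `μ_◇(z) = δ² sin 2θ(z)`, the area of the rhombus. -/
def weightDiamond (z : ℂ) : ℝ := δ ^ 2 * Real.sin (2 * L.θ z)

/-- The weight `μ_Λ(v)`, a quarter of the total area of the rhombi around `v`. -/
def weightVertex (v : ℂ) : ℝ := (1 / 4) * ∑ᶠ z ∈ L.star v, L.weightDiamond z

open Classical in
/-- The weight `i (v_{j+1} - v_{j-1})` of the edge from the vertex `v = v_j` of the rhombus `z` with
vertices `v₁, v₂, v₃, v₄` (listed counterclockwise) to the centre `z`. -/
def weightEdge (v z : ℂ) : ℂ :=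
  if v = L.u₁ z then Complex.I * (L.w₁ z - L.w₂ z)
  else if v = L.w₁ z then Complex.I * (L.u₂ z - L.u₁ z)
  else if v = L.u₂ z then Complex.I * (L.w₂ z - L.w₁ z)
  else if v = L.w₂ z then Complex.I * (L.u₁ z - L.u₂ z)
  else 0

/-- The discrete derivative `∂̄ F` at a vertex `v ∈ Λ` of a function `F` on `◇`. -/
def dbar (F : ℂ → ℂ) (v : ℂ) : ℂ :=
  (1 / (4 * (L.weightVertex v : ℂ))) * ∑ᶠ z ∈ L.star v, L.weightEdge v z * F z

/-- The averaging operator `m F`, at a vertex `v ∈ Λ`, of a function `F` on `◇`. -/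
def average (F : ℂ → ℂ) (v : ℂ) : ℂ :=
  (1 / (4 * (L.weightVertex v : ℂ))) * ∑ᶠ z ∈ L.star v, (L.weightDiamond z : ℂ) * F z

/-- `Pr[x; ξ]`, the orthogonal projection of `x` onto the real line `ξ ℝ`. -/
def proj (x ξ : ℂ) : ℂ := (Submodule.span ℝ {ξ}).starProjection x

/-- The operator `𝓑 F (z) = Pr[F z; conj (u₁ z - u₂ z)]`. -/
def blackPart (F : ℂ → ℂ) (z : ℂ) : ℂ := proj (F z) (conj (L.u₁ z - L.u₂ z))

/-- The interior vertices of the discretization of the disc `B(u₀, R)`: the connected component, in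
the part of `Γ` lying inside the disc, of its centre `u₀ ∈ Γ`. (An edge lies inside the disc iff both
its ends do.) -/
def discInt (u₀ : ℂ) (R : ℝ) : Set ℂ :=
  {v | Relation.ReflTransGen
    (fun a b => L.Adj a b ∧ a ∈ Metric.ball u₀ R ∧ b ∈ Metric.ball u₀ R) u₀ v}

/-- The boundary vertices of the discretization: ends, not being interior vertices, of edges that
start at interior vertices. -/
def discBoundary (u₀ : ℂ) (R : ℝ) : Set ℂ :=
  {a | a ∉ L.discInt u₀ R ∧ ∃ v ∈ L.discInt u₀ R, L.Adj v a}

/-- The discrete disc `B_Γ(u₀, R) ⊆ Γ`: all interior and boundary vertices. -/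
def disc (u₀ : ℂ) (R : ℝ) : Set ℂ := L.discInt u₀ R ∪ L.discBoundary u₀ R

/-- The faces of the discrete disc, that is, the faces of `Γ` incident to an interior vertex. A face
is given by its centre, a white vertex `w`; it is incident to the black vertex `v` iff `v` and `w`
belong to a common rhombus. -/
def discFaces (u₀ : ℂ) (R : ℝ) : Set ℂ :=
  {w | ∃ z ∈ L.diamond, (w = L.w₁ z ∨ w = L.w₂ z) ∧
    (L.u₁ z ∈ L.discInt u₀ R ∨ L.u₂ z ∈ L.discInt u₀ R)}

/-- `B_◇(u₀, R)`, the set of all `z ∈ ◇` in the closed union of the faces of the discrete disc: the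
point `z` is the midpoint of an edge of `Γ`, and the two faces adjacent to this edge are the ones
centred at `w₁ z` and `w₂ z`. -/
def discDiamond (u₀ : ℂ) (R : ℝ) : Set ℂ :=
  {z ∈ L.diamond | L.w₁ z ∈ L.discFaces u₀ R ∨ L.w₂ z ∈ L.discFaces u₀ R}

/-- `F`, a function on `B_◇(u₀, R)`, is discrete holomorphic there: `∂̄ F = 0` at all vertices of
`Λ = Γ ∪ Γ*` in the (open) discrete disc, i.e. at its interior black vertices and at the centres of
its faces. -/
def HolomorphicInDisc (F : ℂ → ℂ) (u₀ : ℂ) (R : ℝ) : Prop :=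
  ∀ v ∈ L.discInt u₀ R ∪ L.discFaces u₀ R, L.dbar F v = 0

end RhombicLattice

end

open scoped ComplexConjugate

/-! Since `F` equals its black part, the product of `F z` with the black diagonal `u₂ - u₁` is real.
Vanishing of `dbar` at white vertices says that these products form a closed 1-form on the edges of
`Γ`, hence the differential of a potential `H` on a slightly smaller disc (`exists_potential`).
Vanishing at black vertices says that `H` is discrete harmonic for the conductances `tan θ`
(`lap_eq_zero_of_dbar_eq_zero`). The core is then `exists_affine_approx`: a harmonic `H` whose edge
increments are at most `2 δ M` agrees near the centre of a disc of radius `R` with an affine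
function, up to `O(M δ² / R)` on each edge. Dividing by the edge length, `F` is within `O(M δ / R)`
of the projections of one constant `b`.

By `two_mul_average_proj` the doubled average of these projections is exactly `b`, so `2 m F (u₀)`
is close to `b`, which is the first claim. Neighbouring black vertices can share the same `b`, so `m
F` changes by `O(M δ / (R - r))` along an edge. The vertices `u₁`, `u₂` are joined by a path of
`O(|u₂ - u₁| / δ + 1)` edges near the segment between them, and distinct black vertices are at
distance at least `κ δ`; this gives the second claim. When `R` or `R - r` is comparable to `δ`, the
bound `|F| ≤ M` suffices.

The affine approximation is a Campanato iteration. Its local input is special to rhombic lattices: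
around a black vertex, the edge vectors `ξ` satisfy `∑ cond ξ = 0`, `∑ cond ξ² = 0` and `∑ cond |ξ|²
= 2 mass`, so the Laplacian is correct to second order on smooth functions. One step
(`exists_quad_approx`) compares `H` with its mollification at a small scale (Caccioppoli), moves the
mollification up through dyadic scales (the scale derivative of the kernel is a Laplacian, which
harmonicity nearly annihilates), and Taylor expands the kernel at the large scale. The expansion is
a harmonic quadratic polynomial plus a trace term, small again by harmonicity. Such polynomials are
themselves discrete harmonic, so the step can be repeated on the remainder
(`exists_quad_approx_center`). Quadratic rather than affine comparison makes the decay rate strictly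
better than needed, which absorbs the constant lost in each step. -/

namespace RhombicLattice

/-! ### Side vectors and coordinates of a single rhombus. -/

/-- The oriented area of the parallelogram spanned by `a` and `b`. -/
def cross (a b : ℂ) : ℝ := a.re * b.im - a.im * b.re

theorem cross_add_left (a b c : ℂ) : cross (a + b) c = cross a c + cross b c := by
  simp only [cross, Complex.add_re, Complex.add_im]; ring

theorem cross_add_right (a b c : ℂ) : cross a (b + c) = cross a b + cross a c := by
  simp only [cross, Complex.add_re, Complex.add_im]; ring

theorem cross_ofReal_mul_left (r : ℝ) (a b : ℂ) : cross (r * a) b = r * cross a b := by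
  simp [cross]; ring

theorem cross_ofReal_mul_right (r : ℝ) (a b : ℂ) : cross a (r * b) = r * cross a b := by
  simp [cross]; ring

@[simp] theorem cross_self (a : ℂ) : cross a a = 0 := by simp [cross]; ring

theorem cross_comm (a b : ℂ) : cross a b = - cross b a := by simp [cross]; ring

theorem abs_cross_le (a b : ℂ) : |cross a b| ≤ ‖a‖ * ‖b‖ := by
  have h : cross a b = (conj a * b).im := by simp [cross]; ring
  rw [h]
  calc _ ≤ ‖conj a * b‖ := Complex.abs_im_le_norm _
    _ = _ := by rw [norm_mul, Complex.norm_conj]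

variable {δ : ℝ} (L : RhombicLattice δ)

/-- The closed rhombus with centre `z`. -/
def rhombus (z : ℂ) : Set ℂ := convexHull ℝ ({L.u₁ z, L.w₁ z, L.u₂ z, L.w₂ z} : Set ℂ)

/-- The area of the rhombus with centre `z`. -/
def area (z : ℂ) : ℝ := cross (L.w₁ z - L.u₁ z) (L.w₂ z - L.u₁ z)

/-- `u` is a black vertex of the rhombus with centre `z`. -/
def IsBlackVertex (u z : ℂ) : Prop := z ∈ L.diamond ∧ (u = L.u₁ z ∨ u = L.u₂ z)

/-- `w` is a white vertex of the rhombus with centre `z`. -/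
def IsWhiteVertex (w z : ℂ) : Prop := z ∈ L.diamond ∧ (w = L.w₁ z ∨ w = L.w₂ z)

/-- The rhombi have positive side and area at least `κ δ²`. -/
def Fat (κ : ℝ) : Prop := 0 < δ ∧ 0 < κ ∧ ∀ z ∈ L.diamond, κ * δ ^ 2 ≤ L.area z

open Classical in
/-- The white vertex of `z` that follows the black vertex `u`. -/
noncomputable def next (u z : ℂ) : ℂ := if u = L.u₁ z then L.w₁ z else L.w₂ z

open Classical in
/-- The white vertex of `z` that precedes the black vertex `u`. -/
noncomputable def prev (u z : ℂ) : ℂ := if u = L.u₁ z then L.w₂ z else L.w₁ z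

/-- The black vertex of `z` other than `u`. -/
def opp (u z : ℂ) : ℂ := 2 * z - u

variable {L} {z z' u u' w p x y : ℂ} {κ : ℝ}

/-- Both white vertices have equal distances to the two ends of the black diagonal, so they lie on
its perpendicular bisector, at the same distance from its midpoint. Being distinct, they are mirror
images in that midpoint. -/
theorem white_add_white (hz : z ∈ L.diamond) : L.w₁ z + L.w₂ z = L.u₁ z + L.u₂ z := by
  have h1 := L.side₁ z hz
  have h2 := L.side₂ z hz
  have h3 := L.side₃ z hz
  have h4 := L.side₄ z hz
  have hne := L.white_ne z hz
  have hc := L.ccw z hz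
  have hs : L.u₂ z - L.u₁ z ≠ 0 := by
    intro h; rw [h] at hc; simp at hc
  generalize L.u₁ z = u at *
  generalize L.u₂ z = v at *
  generalize L.w₁ z = a at *
  generalize L.w₂ z = b at *
  -- In the coordinate `k` with origin at the midpoint and unit `v - u`, equal distances force `k`
  -- to be purely imaginary, and the side length then determines its square.
  have key : ∀ x : ℂ, ‖x - u‖ = δ → ‖v - x‖ = δ →
      ((x - (u + v) / 2) / (v - u)).re = 0 ∧
        4 * ((x - (u + v) / 2) / (v - u)).im ^ 2 * ‖v - u‖ ^ 2 = 4 * δ ^ 2 - ‖v - u‖ ^ 2 := by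
    intro x hx1 hx2
    set k := (x - (u + v) / 2) / (v - u) with hk
    have e1 : x - u = (k + 1 / 2) * (v - u) := by
      rw [hk]; field_simp; ring
    have e2 : v - x = (1 / 2 - k) * (v - u) := by
      rw [hk]; field_simp; ring
    rw [e1, norm_mul] at hx1
    rw [e2, norm_mul] at hx2
    have hN : 0 < ‖v - u‖ := norm_pos_iff.2 hs
    have q1 : ‖k + 1 / 2‖ ^ 2 = (k.re + 1 / 2) ^ 2 + k.im ^ 2 := by
      rw [← Complex.normSq_eq_norm_sq, Complex.normSq_apply]; simp; ring
    have q2 : ‖1 / 2 - k‖ ^ 2 = (1 / 2 - k.re) ^ 2 + k.im ^ 2 := by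
      rw [← Complex.normSq_eq_norm_sq, Complex.normSq_apply]; simp; ring
    have hre : k.re = 0 := by
      have : ‖k + 1 / 2‖ = ‖1 / 2 - k‖ := by
        have := hx1.trans hx2.symm
        exact mul_right_cancel₀ hN.ne' this
      rw [this] at q1
      nlinarith
    refine ⟨hre, ?_⟩
    have : δ ^ 2 = ‖k + 1 / 2‖ ^ 2 * ‖v - u‖ ^ 2 := by rw [← hx1]; ring
    rw [this, q1, hre]; ring
  have ka := key a h1 h2
  have kb := key b (by rw [norm_sub_rev]; exact h4) (by rw [norm_sub_rev]; exact h3)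
  set k := (a - (u + v) / 2) / (v - u) with hk
  set l := (b - (u + v) / 2) / (v - u) with hl
  have ea : a = (u + v) / 2 + k * (v - u) := by rw [hk]; field_simp; ring
  have eb : b = (u + v) / 2 + l * (v - u) := by rw [hl]; field_simp; ring
  have hN : 0 < ‖v - u‖ ^ 2 := pow_pos (norm_pos_iff.2 hs) 2
  have hsq : k.im ^ 2 = l.im ^ 2 := by
    have := ka.2.trans kb.2.symm
    have h := mul_right_cancel₀ hN.ne' this
    linarith
  have hkl : k = -l := by
    rcases sq_eq_sq_iff_eq_or_eq_neg.1 hsq with h | h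
    · exact absurd (by rw [ea, eb, Complex.ext (ka.1.trans kb.1.symm) h]) hne
    · apply Complex.ext
      · rw [ka.1, Complex.neg_re, kb.1, neg_zero]
      · rw [h, Complex.neg_im]
  rw [ea, eb, hkl]; ring

theorem u₂_eq (hz : z ∈ L.diamond) :
    L.u₂ z = L.u₁ z + (L.w₁ z - L.u₁ z) + (L.w₂ z - L.u₁ z) := by
  linear_combination - white_add_white hz

theorem black_add_black (hz : z ∈ L.diamond) : L.u₁ z + L.u₂ z = 2 * z := by
  linear_combination 2 * L.center z hz

theorem area_pos (hz : z ∈ L.diamond) : 0 < L.area z := by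
  have h := L.ccw z hz
  rw [u₂_eq hz] at h
  have : (conj (L.w₁ z - L.u₁ z) * (L.u₁ z + (L.w₁ z - L.u₁ z) + (L.w₂ z - L.u₁ z) - L.u₁ z)).im
      = L.area z := by
    simp [area, cross]; ring
  linarith

theorem Fat.delta_pos {κ : ℝ} (h : L.Fat κ) : 0 < δ := h.1
theorem Fat.kappa_pos {κ : ℝ} (h : L.Fat κ) : 0 < κ := h.2.1
theorem Fat.le_area {κ : ℝ} (h : L.Fat κ) (hz : z ∈ L.diamond) : κ * δ ^ 2 ≤ L.area z := h.2.2 z hz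

theorem norm_w₁_sub (hz : z ∈ L.diamond) : ‖L.w₁ z - L.u₁ z‖ = δ := L.side₁ z hz
theorem norm_w₂_sub (hz : z ∈ L.diamond) : ‖L.w₂ z - L.u₁ z‖ = δ := by
  rw [norm_sub_rev]; exact L.side₄ z hz

theorem area_le (hz : z ∈ L.diamond) : L.area z ≤ δ ^ 2 := by
  refine (le_abs_self _).trans ((abs_cross_le _ _).trans_eq ?_)
  rw [norm_w₁_sub hz, norm_w₂_sub hz, sq]

theorem diamond_nonempty (L : RhombicLattice δ) : ∃ z, z ∈ L.diamond :=
  let ⟨z, hz, _⟩ := L.cover 0; ⟨z, hz⟩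

theorem Fat.kappa_le_one {κ : ℝ} (h : L.Fat κ) : κ ≤ 1 := by
  obtain ⟨z, hz⟩ := L.diamond_nonempty
  have h1 := (h.le_area hz).trans (area_le hz)
  have h2 : 0 < δ ^ 2 := pow_pos h.delta_pos 2
  nlinarith

theorem u₁_ne_u₂ (hz : z ∈ L.diamond) : L.u₁ z ≠ L.u₂ z := by
  intro h
  have hc := L.ccw z hz
  rw [← h] at hc; simp at hc

theorem black_ne_white' (hz : z ∈ L.diamond) (hz' : z' ∈ L.diamond) {u w : ℂ}
    (hu : u = L.u₁ z ∨ u = L.u₂ z) (hw : w = L.w₁ z' ∨ w = L.w₂ z') : u ≠ w := by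
  intro h
  exact Set.disjoint_left.1 (L.black_ne_white z hz z' hz') (by simpa using hu)
    (by rw [h]; simpa using hw)

theorem IsBlackVertex.ne (hu : L.IsBlackVertex u z) (hw : L.IsWhiteVertex w z') : u ≠ w :=
  black_ne_white' hu.1 hw.1 hu.2 hw.2

theorem isBlackVertex_u₁ (hz : z ∈ L.diamond) : L.IsBlackVertex (L.u₁ z) z := ⟨hz, .inl rfl⟩
theorem isBlackVertex_u₂ (hz : z ∈ L.diamond) : L.IsBlackVertex (L.u₂ z) z := ⟨hz, .inr rfl⟩
theorem isWhiteVertex_w₁ (hz : z ∈ L.diamond) : L.IsWhiteVertex (L.w₁ z) z := ⟨hz, .inl rfl⟩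
theorem isWhiteVertex_w₂ (hz : z ∈ L.diamond) : L.IsWhiteVertex (L.w₂ z) z := ⟨hz, .inr rfl⟩

theorem mem_black_iff : u ∈ L.black ↔ ∃ z, L.IsBlackVertex u z := Iff.rfl

theorem IsBlackVertex.mem_black (h : L.IsBlackVertex u z) : u ∈ L.black := ⟨z, h⟩

theorem next_u₁ : L.next (L.u₁ z) z = L.w₁ z := by simp [next]
theorem prev_u₁ : L.prev (L.u₁ z) z = L.w₂ z := by simp [prev]
theorem next_u₂ (hz : z ∈ L.diamond) : L.next (L.u₂ z) z = L.w₂ z := by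
  simp [next, (u₁_ne_u₂ hz).symm]
theorem prev_u₂ (hz : z ∈ L.diamond) : L.prev (L.u₂ z) z = L.w₁ z := by
  simp [prev, (u₁_ne_u₂ hz).symm]
theorem opp_u₁ (hz : z ∈ L.diamond) : opp (L.u₁ z) z = L.u₂ z := by
  simp only [opp]; linear_combination - black_add_black hz
theorem opp_u₂ (hz : z ∈ L.diamond) : opp (L.u₂ z) z = L.u₁ z := by
  simp only [opp]; linear_combination - black_add_black hz

theorem IsBlackVertex.opp (h : L.IsBlackVertex u z) : L.IsBlackVertex (opp u z) z := by
  obtain ⟨hz, rfl | rfl⟩ := h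
  · rw [opp_u₁ hz]; exact isBlackVertex_u₂ hz
  · rw [opp_u₂ hz]; exact isBlackVertex_u₁ hz

theorem IsBlackVertex.white_eq (h : L.IsBlackVertex u z) (hw : L.IsWhiteVertex w z) :
    w = L.next u z ∨ w = L.prev u z := by
  obtain ⟨hz, rfl | rfl⟩ := h
  · rw [next_u₁, prev_u₁]; exact hw.2
  · rw [next_u₂ hz, prev_u₂ hz]; exact hw.2.symm

theorem IsBlackVertex.black_eq (h : L.IsBlackVertex u z) (h' : L.IsBlackVertex u' z) :
    u' = u ∨ u' = RhombicLattice.opp u z := by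
  obtain ⟨hz, rfl | rfl⟩ := h
  · rw [opp_u₁ hz]; exact h'.2
  · rw [opp_u₂ hz]; exact h'.2.symm

theorem IsBlackVertex.opp_eq (h : L.IsBlackVertex u z) :
    RhombicLattice.opp u z = u + (L.next u z - u) + (L.prev u z - u) := by
  obtain ⟨hz, rfl | rfl⟩ := h
  · rw [opp_u₁ hz, next_u₁, prev_u₁]; exact u₂_eq hz
  · rw [opp_u₂ hz, next_u₂ hz, prev_u₂ hz]; linear_combination - white_add_white hz

theorem IsBlackVertex.cross_eq (h : L.IsBlackVertex u z) :
    cross (L.next u z - u) (L.prev u z - u) = L.area z := by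
  obtain ⟨hz, rfl | rfl⟩ := h
  · rw [next_u₁, prev_u₁]; rfl
  · rw [next_u₂ hz, prev_u₂ hz, u₂_eq hz]
    simp [area, cross]; ring

theorem IsBlackVertex.norm_next (h : L.IsBlackVertex u z) : ‖L.next u z - u‖ = δ := by
  obtain ⟨hz, rfl | rfl⟩ := h
  · rw [next_u₁]; exact norm_w₁_sub hz
  · rw [next_u₂ hz]; exact L.side₃ z hz

theorem IsBlackVertex.norm_prev (h : L.IsBlackVertex u z) : ‖L.prev u z - u‖ = δ := by
  obtain ⟨hz, rfl | rfl⟩ := h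
  · rw [prev_u₁]; exact norm_w₂_sub hz
  · rw [prev_u₂ hz, norm_sub_rev]; exact L.side₂ z hz

theorem delta_nonneg (L : RhombicLattice δ) : 0 ≤ δ := by
  obtain ⟨z, hz⟩ := L.diamond_nonempty
  rw [← norm_w₁_sub hz]; exact norm_nonneg _

theorem IsBlackVertex.vertices_eq (h : L.IsBlackVertex u z) :
    ({L.u₁ z, L.w₁ z, L.u₂ z, L.w₂ z} : Set ℂ) =
      {u, L.next u z, RhombicLattice.opp u z, L.prev u z} := by
  obtain ⟨hz, rfl | rfl⟩ := h
  · rw [next_u₁, prev_u₁, opp_u₁ hz]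
  · rw [next_u₂ hz, prev_u₂ hz, opp_u₂ hz]
    ext x; simp only [Set.mem_insert_iff, Set.mem_singleton_iff]; tauto

/-- The side vectors at any black vertex serve as a coordinate frame in which the closed rhombus is
the unit square. All later incidence arguments are computations in these coordinates. -/
theorem IsBlackVertex.mem_rhombus (h : L.IsBlackVertex u z) : p ∈ L.rhombus z ↔
    ∃ a b : ℝ, (0 ≤ a ∧ a ≤ 1) ∧ (0 ≤ b ∧ b ≤ 1) ∧
      p = u + a * (L.next u z - u) + b * (L.prev u z - u) := by
  have ho := h.opp_eq
  rw [rhombus, h.vertices_eq]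
  generalize L.next u z = x at *
  generalize L.prev u z = y at *
  constructor
  · intro hp
    have hconv : Convex ℝ {p : ℂ | ∃ a b : ℝ, (0 ≤ a ∧ a ≤ 1) ∧ (0 ≤ b ∧ b ≤ 1) ∧
      p = u + a * (x - u) + b * (y - u)} := by
      rintro p ⟨a, b, ⟨ha, ha'⟩, ⟨hb, hb'⟩, rfl⟩ q ⟨c, d, ⟨hc, hc'⟩, ⟨hd, hd'⟩, rfl⟩ s t hs ht hst
      refine ⟨s * a + t * c, s * b + t * d, ⟨by positivity, ?_⟩, ⟨by positivity, ?_⟩, ?_⟩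
      · nlinarith
      · nlinarith
      · have : (s : ℂ) + t = 1 := by exact_mod_cast hst
        simp only [Complex.real_smul]
        push_cast
        linear_combination u * this
    refine convexHull_min ?_ hconv hp
    intro q hq
    simp only [Set.mem_insert_iff, Set.mem_singleton_iff] at hq
    rcases hq with rfl | rfl | rfl | rfl
    · exact ⟨0, 0, by simp, by simp, by simp⟩
    · exact ⟨1, 0, by simp, by simp, by simp⟩
    · exact ⟨1, 1, by simp, by simp, by rw [ho]; push_cast; ring⟩
    · exact ⟨0, 1, by simp, by simp, by simp⟩
  · rintro ⟨a, b, ⟨ha, ha'⟩, ⟨hb, hb'⟩, rfl⟩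
    have hc := convex_convexHull ℝ ({u, x, RhombicLattice.opp u z, y} : Set ℂ)
    have hs : ∀ q ∈ ({u, x, RhombicLattice.opp u z, y} : Set ℂ), q ∈ convexHull ℝ _ :=
      fun q hq => subset_convexHull ℝ _ hq
    have m1 := hc (hs u (by simp)) (hs x (by simp)) (sub_nonneg.2 ha') ha (by ring)
    have m2 := hc (hs y (by simp)) (hs (RhombicLattice.opp u z) (by simp))
      (sub_nonneg.2 ha') ha (by ring)
    have m3 := hc m1 m2 (sub_nonneg.2 hb') hb (by ring)
    convert m3 using 1
    simp only [Complex.real_smul, ho]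
    push_cast
    ring

theorem IsBlackVertex.mem (h : L.IsBlackVertex u z) : u ∈ L.rhombus z := by
  obtain ⟨hz, rfl | rfl⟩ := h <;> exact subset_convexHull ℝ _ (by simp)

theorem IsWhiteVertex.mem (h : L.IsWhiteVertex w z) : w ∈ L.rhombus z := by
  obtain ⟨hz, rfl | rfl⟩ := h <;> exact subset_convexHull ℝ _ (by simp)

theorem isClosed_rhombus (L : RhombicLattice δ) (z : ℂ) : IsClosed (L.rhombus z) :=
  (Set.Finite.isCompact_convexHull (𝕜 := ℝ) (by simp)).isClosed

theorem dist_center_le (hz : z ∈ L.diamond) (hp : p ∈ L.rhombus z) : ‖p - z‖ ≤ δ := by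
  have hδ := L.delta_nonneg
  have hc : Convex ℝ (Metric.closedBall z δ) := convex_closedBall _ _
  have hb : ∀ u, L.IsBlackVertex u z → ‖u - z‖ ≤ δ := by
    intro u hu
    have : u - z = (1 / 2 : ℝ) * ((u - L.next u z) + (u - L.prev u z)) := by
      have h := hu.opp_eq
      simp only [RhombicLattice.opp] at h
      push_cast
      linear_combination (- h) / 2
    rw [this, norm_mul]
    have h1 := norm_add_le (u - L.next u z) (u - L.prev u z)
    rw [norm_sub_rev u, norm_sub_rev u, hu.norm_next, hu.norm_prev] at h1
    rw [Complex.norm_real]; norm_num; linarith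
  have hw : ∀ w, L.IsWhiteVertex w z → ‖w - z‖ ≤ δ := by
    have h0 : L.w₁ z - z = (1 / 2 : ℝ) * ((L.w₁ z - L.u₁ z) + (L.w₁ z - L.u₂ z)) := by
      push_cast; linear_combination (black_add_black hz) / 2
    have h1 : ‖L.w₁ z - z‖ ≤ δ := by
      rw [h0, norm_mul]
      have h1 := norm_add_le (L.w₁ z - L.u₁ z) (L.w₁ z - L.u₂ z)
      rw [norm_w₁_sub hz, norm_sub_rev (L.w₁ z) (L.u₂ z), L.side₂ z hz] at h1
      rw [Complex.norm_real]; norm_num; linarith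
    rintro w ⟨_, rfl | rfl⟩
    · exact h1
    · have : L.w₂ z - z = -(L.w₁ z - z) := by
        linear_combination white_add_white hz + black_add_black hz
      rw [this, norm_neg]; exact h1
  have : p ∈ Metric.closedBall z δ := by
    refine convexHull_min ?_ hc hp
    intro q hq
    simp only [Set.mem_insert_iff, Set.mem_singleton_iff] at hq
    rw [Metric.mem_closedBall, dist_eq_norm]
    rcases hq with rfl | rfl | rfl | rfl
    · exact hb _ (isBlackVertex_u₁ hz)
    · exact hw _ (isWhiteVertex_w₁ hz)
    · exact hb _ (isBlackVertex_u₂ hz)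
    · exact hw _ (isWhiteVertex_w₂ hz)
  rwa [Metric.mem_closedBall, dist_eq_norm] at this

/-! ### How two rhombi can meet. -/

/-- Two different rhombi meet in common vertices and sides only. -/
theorem exists_common_side (hz : z ∈ L.diamond) (hz' : z' ∈ L.diamond) (hne : z ≠ z')
    (hp : p ∈ L.rhombus z) (hp' : p ∈ L.rhombus z') :
    ∃ u w : ℂ, ∃ t : ℝ, L.IsBlackVertex u z ∧ L.IsWhiteVertex w z ∧ 0 ≤ t ∧ t ≤ 1 ∧
      p = (1 - t) * u + t * w ∧ (t < 1 → L.IsBlackVertex u z') ∧ (0 < t → L.IsWhiteVertex w z') := by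
  have hmem : p ∈ L.rhombus z ∩ L.rhombus z' := ⟨hp, hp'⟩
  rw [rhombus, rhombus, L.edge_to_edge z hz z' hz' hne] at hmem
  set S := (({L.u₁ z, L.w₁ z, L.u₂ z, L.w₂ z} : Set ℂ) ∩ {L.u₁ z', L.w₁ z', L.u₂ z', L.w₂ z'}) with hS
  have hSv : ∀ x ∈ S, (L.IsBlackVertex x z ∧ L.IsBlackVertex x z') ∨
      (L.IsWhiteVertex x z ∧ L.IsWhiteVertex x z') := by
    rintro x ⟨h1, h2⟩
    simp only [Set.mem_insert_iff, Set.mem_singleton_iff] at h1 h2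
    have c1 : L.IsBlackVertex x z ∨ L.IsWhiteVertex x z := by
      unfold IsBlackVertex IsWhiteVertex; tauto
    have c2 : L.IsBlackVertex x z' ∨ L.IsWhiteVertex x z' := by
      unfold IsBlackVertex IsWhiteVertex; tauto
    rcases c1 with c1 | c1 <;> rcases c2 with c2 | c2
    · exact .inl ⟨c1, c2⟩
    · exact absurd rfl (c1.ne c2)
    · exact absurd rfl (c2.ne c1)
    · exact .inr ⟨c1, c2⟩
  -- Two common black vertices would give both rhombi the same centre, and rhombi are named by their
  -- centres. The same holds for white vertices, so the common vertices are at most one of each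
  -- colour.
  have hb : ∀ x y, L.IsBlackVertex x z → L.IsBlackVertex x z' → L.IsBlackVertex y z →
      L.IsBlackVertex y z' → x = y := by
    rintro x y ⟨_, h1⟩ ⟨_, h2⟩ ⟨_, h3⟩ ⟨_, h4⟩
    by_contra hxy
    apply hne
    have a := black_add_black hz
    have b := black_add_black hz'
    rcases h1 with h1 | h1 <;> rcases h2 with h2 | h2 <;> rcases h3 with h3 | h3 <;>
      rcases h4 with h4 | h4 <;>
      first
        | exact absurd (h1.trans h3.symm) hxy
        | exact absurd (h2.trans h4.symm) hxy
        | (rw [← h1, ← h3] at a; rw [← h2, ← h4] at b; linear_combination (b - a) / 2)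
  have hw : ∀ x y, L.IsWhiteVertex x z → L.IsWhiteVertex x z' → L.IsWhiteVertex y z →
      L.IsWhiteVertex y z' → x = y := by
    rintro x y ⟨_, h1⟩ ⟨_, h2⟩ ⟨_, h3⟩ ⟨_, h4⟩
    by_contra hxy
    apply hne
    have a := (white_add_white hz).trans (black_add_black hz)
    have b := (white_add_white hz').trans (black_add_black hz')
    rcases h1 with h1 | h1 <;> rcases h2 with h2 | h2 <;> rcases h3 with h3 | h3 <;>
      rcases h4 with h4 | h4 <;>
      first
        | exact absurd (h1.trans h3.symm) hxy
        | exact absurd (h2.trans h4.symm) hxy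
        | (rw [← h1, ← h3] at a; rw [← h2, ← h4] at b; linear_combination (b - a) / 2)
  by_cases h1 : ∃ u ∈ S, L.IsBlackVertex u z
  · obtain ⟨u, huS, hu⟩ := h1
    have hu' : L.IsBlackVertex u z' := by
      rcases hSv u huS with h | h
      · exact h.2
      · exact absurd rfl (hu.ne h.1)
    by_cases h2 : ∃ w ∈ S, L.IsWhiteVertex w z
    · obtain ⟨w, hwS, hw0⟩ := h2
      have hw' : L.IsWhiteVertex w z' := by
        rcases hSv w hwS with h | h
        · exact absurd rfl (h.1.ne hw0)
        · exact h.2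
      have hsub : S ⊆ {u, w} := by
        intro x hx
        rcases hSv x hx with h | h
        · exact .inl (hb _ _ h.1 h.2 hu hu')
        · exact .inr (hw _ _ h.1 h.2 hw0 hw')
      have hpc := convexHull_mono hsub hmem
      rw [convexHull_pair, segment_eq_image] at hpc
      obtain ⟨t, ⟨ht0, ht1⟩, rfl⟩ := hpc
      refine ⟨u, w, t, hu, hw0, ht0, ht1, ?_, fun _ => hu', fun _ => hw'⟩
      simp only [Complex.real_smul]; push_cast; ring
    · have hsub : S ⊆ {u} := by
        intro x hx
        rcases hSv x hx with h | h
        · exact (hb _ _ h.1 h.2 hu hu')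
        · exact absurd ⟨x, hx, h.1⟩ h2
      have hpc := convexHull_mono hsub hmem
      rw [convexHull_singleton] at hpc
      refine ⟨u, L.w₁ z, 0, hu, isWhiteVertex_w₁ hz, le_rfl, zero_le_one, ?_, fun _ => hu',
        fun h => absurd h (lt_irrefl _)⟩
      rw [Set.mem_singleton_iff.1 hpc]; simp
  · have hall : ∀ x ∈ S, L.IsWhiteVertex x z ∧ L.IsWhiteVertex x z' := by
      intro x hx
      rcases hSv x hx with h | h
      · exact absurd ⟨x, hx, h.1⟩ h1
      · exact h
    have hSne : S.Nonempty := by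
      rw [← convexHull_nonempty_iff (𝕜 := ℝ)]; exact ⟨p, hmem⟩
    obtain ⟨w, hwS⟩ := hSne
    have hw0 := hall w hwS
    have hsub : S ⊆ {w} := fun x hx => hw _ _ (hall x hx).1 (hall x hx).2 hw0.1 hw0.2
    have hpc := convexHull_mono hsub hmem
    rw [convexHull_singleton] at hpc
    refine ⟨L.u₁ z, w, 1, isBlackVertex_u₁ hz, hw0.1, zero_le_one, le_rfl, ?_,
      fun h => absurd h (lt_irrefl _), fun _ => hw0.2⟩
    rw [Set.mem_singleton_iff.1 hpc]; simp

/-! ### Separation and counting of rhombi and vertices. -/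

theorem cramer (x y p : ℂ) : (cross x y : ℂ) * p = (cross p y : ℂ) * x + (cross x p : ℂ) * y := by
  apply Complex.ext <;> simp [cross] <;> ring

open MeasureTheory in
-- Area comparison: the discs of radius `c / 2` around the points are disjoint and lie in the disc
-- of radius `r + c / 2`.
theorem card_le_of_separated {c r : ℝ} (hc : 0 < c) (hr : 0 ≤ r) (x : ℂ) (t : Finset ℂ)
    (hsep : ∀ y ∈ t, ∀ y' ∈ t, y ≠ y' → c ≤ ‖y - y'‖) (hsub : ∀ y ∈ t, ‖y - x‖ < r) :
    (t.card : ℝ) ≤ (2 * r / c + 1) ^ 2 := by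
  have hdisj : (↑t : Set ℂ).PairwiseDisjoint (fun y => Metric.ball y (c / 2)) := by
    intro y hy y' hy' hne
    refine Metric.ball_disjoint_ball ?_
    rw [dist_eq_norm]
    linarith [hsep y hy y' hy' hne]
  have h1 : volume (⋃ y ∈ t, Metric.ball y (c / 2)) ≤ volume (Metric.ball x (r + c / 2)) := by
    refine measure_mono (Set.iUnion₂_subset fun y hy => ?_)
    refine Metric.ball_subset_ball' ?_
    rw [dist_eq_norm]
    linarith [hsub y hy]
  rw [measure_biUnion_finset hdisj (fun _ _ => measurableSet_ball)] at h1
  simp only [Complex.volume_ball, Finset.sum_const, nsmul_eq_mul] at h1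
  have h2 := ENNReal.toReal_mono (by finiteness) h1
  simp only [ENNReal.toReal_mul, ENNReal.toReal_pow, ENNReal.toReal_natCast, ENNReal.coe_toReal,
    NNReal.coe_real_pi] at h2
  rw [ENNReal.toReal_ofReal (by positivity), ENNReal.toReal_ofReal (by positivity)] at h2
  have h3 : (t.card : ℝ) * (c / 2) ^ 2 ≤ (r + c / 2) ^ 2 := by
    have := Real.pi_pos
    rw [← mul_assoc] at h2
    exact le_of_mul_le_mul_right h2 this
  have h4 : (2 * r / c + 1) ^ 2 = (r + c / 2) ^ 2 / (c / 2) ^ 2 := by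
    field_simp
  rw [h4, le_div_iff₀ (by positivity)]
  exact h3

open MeasureTheory in
theorem le_card_of_cover {c r : ℝ} (hc : 0 < c) (hr : 0 ≤ r) (x : ℂ) (t : Finset ℂ)
    (hcov : ∀ p, ‖p - x‖ < r → ∃ y ∈ t, ‖p - y‖ < c) :
    r ^ 2 / c ^ 2 ≤ t.card := by
  have h1 : volume (Metric.ball x r) ≤ ∑ y ∈ t, volume (Metric.ball y c) := by
    refine (measure_mono ?_).trans (measure_biUnion_finset_le t _)
    intro p hp
    rw [Metric.mem_ball, dist_eq_norm] at hp
    obtain ⟨y, hy, hpy⟩ := hcov p hp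
    simp only [Set.mem_iUnion, Metric.mem_ball, dist_eq_norm]
    exact ⟨y, hy, hpy⟩
  simp only [Complex.volume_ball, Finset.sum_const, nsmul_eq_mul] at h1
  have h2 := ENNReal.toReal_mono (by finiteness) h1
  simp only [ENNReal.toReal_mul, ENNReal.toReal_pow, ENNReal.toReal_natCast, ENNReal.coe_toReal,
    NNReal.coe_real_pi] at h2
  rw [ENNReal.toReal_ofReal (by positivity), ENNReal.toReal_ofReal (by positivity)] at h2
  rw [div_le_iff₀ (by positivity)]
  have := Real.pi_pos
  rw [← mul_assoc] at h2
  exact le_of_mul_le_mul_right h2 this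

/-- The two side vectors are linearly independent because the area is nonzero, so coordinates are
unique. Points on a side therefore have a coordinate equal to `0` or `1`, which is how interior
points are later excluded from other rhombi. -/
theorem IsBlackVertex.side_not_interior (h : L.IsBlackVertex u z) {u' w : ℂ}
    (hu' : L.IsBlackVertex u' z) (hw : L.IsWhiteVertex w z) {t a b : ℝ}
    (hp : (1 - t) * u' + t * w = u + a * (L.next u z - u) + b * (L.prev u z - u)) :
    (b = 0 ∧ a = t ∧ u' = u ∧ w = L.next u z) ∨ (a = 0 ∧ b = t ∧ u' = u ∧ w = L.prev u z) ∨
      (a = 1 ∧ b = 1 - t ∧ u' = RhombicLattice.opp u z ∧ w = L.next u z) ∨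
      (b = 1 ∧ a = 1 - t ∧ u' = RhombicLattice.opp u z ∧ w = L.prev u z) := by
  have hA := area_pos h.1
  rw [← h.cross_eq] at hA
  have ho := h.opp_eq
  have key : ∀ c d : ℝ, (c : ℂ) * (L.next u z - u) + d * (L.prev u z - u) = 0 → c = 0 ∧ d = 0 := by
    intro c d hcd
    have h1 : cross (c * (L.next u z - u) + d * (L.prev u z - u)) (L.prev u z - u) = 0 := by
      rw [hcd]; simp [cross]
    have h2 : cross (L.next u z - u) (c * (L.next u z - u) + d * (L.prev u z - u)) = 0 := by
      rw [hcd]; simp [cross]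
    rw [cross_add_left, cross_ofReal_mul_left, cross_ofReal_mul_left, cross_self] at h1
    rw [cross_add_right, cross_ofReal_mul_right, cross_ofReal_mul_right, cross_self] at h2
    simp only [mul_zero, add_zero, zero_add] at h1 h2
    exact ⟨(mul_eq_zero.1 h1).resolve_right hA.ne', (mul_eq_zero.1 h2).resolve_right hA.ne'⟩
  rcases h.black_eq hu' with rfl | rfl <;> rcases h.white_eq hw with rfl | rfl
  · have := key (a - t) b (by push_cast; linear_combination - hp)
    exact .inl ⟨this.2, by linarith [this.1], rfl, rfl⟩
  · have := key a (b - t) (by push_cast; linear_combination - hp)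
    exact .inr (.inl ⟨this.1, by linarith [this.2], rfl, rfl⟩)
  · rw [ho] at hp
    have := key (a - 1) (b - (1 - t)) (by push_cast; linear_combination - hp)
    exact .inr (.inr (.inl ⟨by linarith [this.1], by linarith [this.2], rfl, rfl⟩))
  · rw [ho] at hp
    have := key (a - (1 - t)) (b - 1) (by push_cast; linear_combination - hp)
    exact .inr (.inr (.inr ⟨by linarith [this.2], by linarith [this.1], rfl, rfl⟩))

/-- A black vertex that belongs to a closed rhombus is a vertex of this rhombus. -/
theorem IsBlackVertex.of_mem (hu : L.IsBlackVertex u z) (hz' : z' ∈ L.diamond)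
    (hm : u ∈ L.rhombus z') : L.IsBlackVertex u z' := by
  by_cases hne : z = z'
  · rwa [← hne]
  obtain ⟨u', w, t, hu', hw, ht0, ht1, hp, hb, -⟩ := exists_common_side hu.1 hz' hne hu.mem hm
  have hp' : (1 - t) * u' + t * w =
      u + (0 : ℝ) * (L.next u z - u) + (0 : ℝ) * (L.prev u z - u) := by
    rw [← hp]; push_cast; ring
  rcases hu.side_not_interior hu' hw hp' with h | h | h | h
  · rw [← h.2.2.1]; exact hb (by linarith [h.2.1])
  · rw [← h.2.2.1]; exact hb (by linarith [h.2.1])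
  · linarith [h.1]
  · linarith [h.1]

/-- Interior points of one rhombus belong to no other one. -/
theorem IsBlackVertex.interior_not_mem (hu : L.IsBlackVertex u z) (hz' : z' ∈ L.diamond)
    (hne : z ≠ z') {a b : ℝ} (ha : 0 < a) (ha' : a < 1) (hb : 0 < b) (hb' : b < 1) :
    u + a * (L.next u z - u) + b * (L.prev u z - u) ∉ L.rhombus z' := by
  intro hm
  have hin : u + a * (L.next u z - u) + b * (L.prev u z - u) ∈ L.rhombus z :=
    hu.mem_rhombus.2 ⟨a, b, ⟨ha.le, ha'.le⟩, ⟨hb.le, hb'.le⟩, rfl⟩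
  obtain ⟨u', w, t, hu', hw, ht0, ht1, hp, -, -⟩ := exists_common_side hu.1 hz' hne hin hm
  rcases hu.side_not_interior hu' hw hp.symm with h | h | h | h <;> linarith [h.1]

theorem center_eq (hu : L.IsBlackVertex u z) :
    z = u + (1 / 2 : ℝ) * (L.next u z - u) + (1 / 2 : ℝ) * (L.prev u z - u) := by
  have := hu.opp_eq
  simp only [opp] at this
  push_cast
  linear_combination this / 2

/-- By Cramer's rule each coordinate of `p - z` is at most `‖p - z‖ δ / area`, hence at most `1 /
2`, the distance from the centre of the unit square to its boundary. -/
theorem mem_rhombus_of_near (hL : L.Fat κ) (hz : z ∈ L.diamond) (hp : ‖p - z‖ ≤ κ * δ / 2) :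
    p ∈ L.rhombus z := by
  have hu := isBlackVertex_u₁ hz
  have hδ := hL.delta_pos
  have hA := area_pos hz
  have hle := hL.le_area hz
  set E := L.next (L.u₁ z) z - L.u₁ z with hE
  set G := L.prev (L.u₁ z) z - L.u₁ z with hG
  have hc : cross E G = L.area z := hu.cross_eq
  have hn : ‖E‖ = δ := hu.norm_next
  have hq : ‖G‖ = δ := hu.norm_prev
  have b1 := abs_le.1 (abs_cross_le (p - z) G)
  have b2 := abs_le.1 (abs_cross_le E (p - z))
  rw [hq] at b1
  rw [hn] at b2
  have b3 : ‖p - z‖ * δ ≤ κ * δ / 2 * δ := mul_le_mul_of_nonneg_right hp hδ.le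
  have c1 : |cross (p - z) G / L.area z| ≤ 1 / 2 := by
    rw [abs_div, abs_of_pos hA, div_le_iff₀ hA, abs_le]
    constructor <;> nlinarith
  have c2 : |cross E (p - z) / L.area z| ≤ 1 / 2 := by
    rw [abs_div, abs_of_pos hA, div_le_iff₀ hA, abs_le]
    constructor <;> nlinarith
  rw [abs_le] at c1 c2
  rw [hu.mem_rhombus]
  refine ⟨1 / 2 + cross (p - z) G / L.area z, 1 / 2 + cross E (p - z) / L.area z,
    ⟨by linarith, by linarith⟩, ⟨by linarith, by linarith⟩, ?_⟩
  have hcr := cramer E G (p - z)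
  rw [hc] at hcr
  have hA' : (L.area z : ℂ) ≠ 0 := by exact_mod_cast hA.ne'
  have hcen := center_eq hu
  rw [← hE, ← hG] at hcen ⊢
  have : p - z = (cross (p - z) G / L.area z : ℂ) * E + (cross E (p - z) / L.area z : ℂ) * G := by
    field_simp
    linear_combination hcr
  push_cast at hcen ⊢
  linear_combination this + hcen

theorem center_separated (hL : L.Fat κ) (hz : z ∈ L.diamond) (hz' : z' ∈ L.diamond) (hne : z ≠ z') :
    κ * δ / 2 ≤ ‖z - z'‖ := by
  by_contra h
  have hm := mem_rhombus_of_near hL hz' (p := z) (not_le.1 h).le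
  rw [center_eq (isBlackVertex_u₁ hz)] at hm
  exact (isBlackVertex_u₁ hz).interior_not_mem hz' hne (by norm_num) (by norm_num) (by norm_num)
    (by norm_num) hm

theorem finite_rhombi (hL : L.Fat κ) (x : ℂ) (r : ℝ) : {z ∈ L.diamond | ‖z - x‖ < r}.Finite := by
  have hκ := hL.kappa_pos
  have hδ := hL.delta_pos
  rcases lt_or_ge r 0 with hr | hr
  · convert Set.finite_empty
    ext z
    simp only [Set.mem_ofPred_eq, Set.mem_empty_iff_false, iff_false, not_and, not_lt]
    exact fun _ => hr.le.trans (norm_nonneg _)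
  by_contra hinf
  obtain ⟨t, hts, htc⟩ := Set.Infinite.exists_subset_card_eq hinf
    (⌈(2 * r / (κ * δ / 2) + 1) ^ 2⌉₊ + 1)
  have := card_le_of_separated (c := κ * δ / 2) (by positivity) hr x t
    (fun y hy y' hy' hne => center_separated hL (hts hy).1 (hts hy').1 hne) (fun y hy => (hts hy).2)
  rw [htc] at this
  push_cast at this
  linarith [Nat.le_ceil ((2 * r / (κ * δ / 2) + 1) ^ 2)]

open Classical in
variable (L) in
/-- The rhombi with centres in the open disc `B(x, r)`. -/
noncomputable def rhombi (x : ℂ) (r : ℝ) : Finset ℂ :=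
  if h : {z ∈ L.diamond | ‖z - x‖ < r}.Finite then h.toFinset else ∅

theorem mem_rhombi (hL : L.Fat κ) {x : ℂ} {r : ℝ} :
    z ∈ L.rhombi x r ↔ z ∈ L.diamond ∧ ‖z - x‖ < r := by
  rw [rhombi, dif_pos (finite_rhombi hL x r)]; simp

theorem norm_sub_center_le (hu : L.IsBlackVertex u z) : ‖u - z‖ ≤ δ := dist_center_le hu.1 hu.mem

theorem finite_blacks (hL : L.Fat κ) (x : ℂ) (r : ℝ) : {u ∈ L.black | ‖u - x‖ < r}.Finite := by
  refine (((L.rhombi x (r + 2 * δ)).image L.u₁ ∪ (L.rhombi x (r + 2 * δ)).image L.u₂).finite_toSet).subset ?_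
  rintro u ⟨⟨z, hz⟩, hr⟩
  have h1 := norm_sub_center_le hz
  have hm : z ∈ L.rhombi x (r + 2 * δ) := by
    rw [mem_rhombi hL]
    refine ⟨hz.1, ?_⟩
    have := norm_add_le (z - u) (u - x)
    rw [sub_add_sub_cancel, norm_sub_rev z u] at this
    linarith [hL.delta_pos]
  simp only [Finset.coe_union, Finset.coe_image, Set.mem_union, Set.mem_image, Finset.mem_coe]
  rcases hz.2 with h | h
  · exact .inl ⟨z, hm, h.symm⟩
  · exact .inr ⟨z, hm, h.symm⟩

open Classical in
variable (L) in
/-- The black vertices in the open disc `B(x, r)`. -/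
noncomputable def blacks (x : ℂ) (r : ℝ) : Finset ℂ :=
  if h : {u ∈ L.black | ‖u - x‖ < r}.Finite then h.toFinset else ∅

theorem mem_blacks (hL : L.Fat κ) {x : ℂ} {r : ℝ} :
    u ∈ L.blacks x r ↔ u ∈ L.black ∧ ‖u - x‖ < r := by
  rw [blacks, dif_pos (finite_blacks hL x r)]; simp

theorem card_rhombi_le (hL : L.Fat κ) (x : ℂ) {r : ℝ} (hr : δ ≤ r) :
    ((L.rhombi x r).card : ℝ) ≤ 25 / κ ^ 2 * (r / δ) ^ 2 := by
  have hκ := hL.kappa_pos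
  have hδ := hL.delta_pos
  have h1 := hL.kappa_le_one
  have h := card_le_of_separated (c := κ * δ / 2) (by positivity) (hδ.le.trans hr) x (L.rhombi x r)
    (fun y hy y' hy' hne => center_separated hL ((mem_rhombi hL).1 hy).1
      ((mem_rhombi hL).1 hy').1 hne) (fun y hy => ((mem_rhombi hL).1 hy).2)
  refine h.trans ?_
  have h2 : 25 / κ ^ 2 * (r / δ) ^ 2 = (5 * r / (κ * δ)) ^ 2 := by field_simp; ring
  rw [h2]
  have h3 : 1 ≤ r / (κ * δ) := by
    rw [le_div_iff₀ (by positivity)]; nlinarith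
  have h4 : 2 * r / (κ * δ / 2) + 1 ≤ 5 * r / (κ * δ) := by
    have e1 : 2 * r / (κ * δ / 2) = 4 * (r / (κ * δ)) := by field_simp; ring
    have e2 : 5 * r / (κ * δ) = 5 * (r / (κ * δ)) := by field_simp
    rw [e1, e2]; linarith
  have : 0 ≤ r := hδ.le.trans hr
  exact pow_le_pow_left₀ (by positivity) h4 2

theorem card_blacks_le (hL : L.Fat κ) (x : ℂ) {r : ℝ} (hr : δ ≤ r) :
    ((L.blacks x r).card : ℝ) ≤ 450 / κ ^ 2 * (r / δ) ^ 2 := by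
  have hκ := hL.kappa_pos
  have hδ := hL.delta_pos
  have hsub : L.blacks x r ⊆
      (L.rhombi x (r + 2 * δ)).image L.u₁ ∪ (L.rhombi x (r + 2 * δ)).image L.u₂ := by
    intro u hu
    obtain ⟨⟨z, hz⟩, hr⟩ := (mem_blacks hL).1 hu
    have hz : L.IsBlackVertex u z := hz
    have h1 := norm_sub_center_le hz
    have hm : z ∈ L.rhombi x (r + 2 * δ) := by
      rw [mem_rhombi hL]
      refine ⟨hz.1, ?_⟩
      have := norm_add_le (z - u) (u - x)
      rw [sub_add_sub_cancel, norm_sub_rev z u] at this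
      linarith
    simp only [Finset.mem_union, Finset.mem_image]
    rcases hz.2 with h | h
    · exact .inl ⟨z, hm, h.symm⟩
    · exact .inr ⟨z, hm, h.symm⟩
  have h1 : ((L.blacks x r).card : ℝ) ≤ 2 * (L.rhombi x (r + 2 * δ)).card := by
    have := (Finset.card_le_card hsub).trans ((Finset.card_union_le _ _).trans
      (add_le_add Finset.card_image_le Finset.card_image_le))
    exact_mod_cast this.trans_eq (two_mul _).symm
  have h2 := card_rhombi_le hL x (r := r + 2 * δ) (by linarith)
  have h3 : (r + 2 * δ) / δ ≤ 3 * (r / δ) := by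
    rw [div_le_iff₀ hδ]; field_simp; linarith
  have h4 : ((r + 2 * δ) / δ) ^ 2 ≤ (3 * (r / δ)) ^ 2 :=
    pow_le_pow_left₀ (div_nonneg (by linarith) hδ.le) h3 2
  calc _ ≤ 2 * (25 / κ ^ 2 * ((r + 2 * δ) / δ) ^ 2) := h1.trans (by linarith)
    _ ≤ 2 * (25 / κ ^ 2 * (3 * (r / δ)) ^ 2) := by gcongr
    _ = _ := by ring

theorem le_card_blacks (hL : L.Fat κ) (x : ℂ) {r : ℝ} (hr : 6 * δ ≤ r) :
    (r / δ) ^ 2 / 36 ≤ (L.blacks x r).card := by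
  have hδ := hL.delta_pos
  have h := le_card_of_cover (c := 3 * δ) (r := r - 3 * δ) (by positivity) (by linarith) x
    (L.blacks x r) (by
      intro p hp
      obtain ⟨z, hz, hpz⟩ := L.cover p
      have h1 : ‖p - z‖ ≤ δ := dist_center_le hz hpz
      have h2 := norm_sub_center_le (isBlackVertex_u₁ hz)
      have h3 : ‖p - L.u₁ z‖ ≤ 2 * δ := by
        have := norm_sub_le (p - z) (L.u₁ z - z)
        rw [sub_sub_sub_cancel_right] at this
        linarith
      refine ⟨L.u₁ z, (mem_blacks hL).2 ⟨(isBlackVertex_u₁ hz).mem_black, ?_⟩, by linarith⟩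
      have := norm_sub_le (p - x) (p - L.u₁ z)
      rw [sub_sub_sub_cancel_left] at this
      linarith)
  refine le_trans ?_ h
  have : (r / δ) ^ 2 / 36 = (r / (6 * δ)) ^ 2 := by field_simp; ring
  rw [this, ← div_pow]
  have hr0 : 0 ≤ r := by linarith
  refine pow_le_pow_left₀ (by positivity) ?_ 2
  rw [div_le_div_iff₀ (by positivity) (by positivity)]
  nlinarith

/-! ### The arrangement of the rhombi around a black vertex. -/

/-- Every germ of a ray starting at `p` is (frequently) in a rhombus containing `p`. -/
theorem exists_rhombus_ray (hL : L.Fat κ) (p v : ℂ) : ∃ z ∈ L.diamond, p ∈ L.rhombus z ∧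
    ∃ᶠ t : ℝ in nhdsWithin (0 : ℝ) (Set.Ioi 0), p + t * v ∈ L.rhombus z := by
  have hcont : Filter.Tendsto (fun t : ℝ => p + t * v) (nhdsWithin (0 : ℝ) (Set.Ioi 0)) (nhds p) := by
    have : Continuous (fun t : ℝ => p + t * v) := by fun_prop
    have h := this.tendsto 0
    simp only [Complex.ofReal_zero, zero_mul, add_zero] at h
    exact h.mono_left nhdsWithin_le_nhds
  have hδ := hL.delta_pos
  have hex : ∃ z ∈ L.rhombi p (2 * δ),
      ∃ᶠ t : ℝ in nhdsWithin (0 : ℝ) (Set.Ioi 0), p + t * v ∈ L.rhombus z := by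
    by_contra hcon
    push Not at hcon
    -- Only finitely many rhombi come near `p`. If each of them missed the ray for all small `t`,
    -- points of the ray close to `p` would be uncovered.
    have h1 := (Filter.eventually_all_finset (L.rhombi p (2 * δ))).2 hcon
    have h2 : ∀ᶠ t : ℝ in nhdsWithin (0 : ℝ) (Set.Ioi 0), p + t * v ∈ Metric.ball p δ :=
      hcont (Metric.ball_mem_nhds p hδ)
    obtain ⟨t, ht1, ht2⟩ := (h1.and h2).exists
    obtain ⟨z, hz, hpz⟩ := L.cover (p + t * v)
    refine ht1 z ?_ hpz
    rw [mem_rhombi hL]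
    refine ⟨hz, ?_⟩
    have a := dist_center_le hz hpz
    rw [Metric.mem_ball, dist_eq_norm] at ht2
    have := norm_sub_le (p + t * v - p) (p + t * v - z)
    rw [sub_sub_sub_cancel_left] at this
    linarith
  obtain ⟨z, hz, hf⟩ := hex
  refine ⟨z, ((mem_rhombi hL).1 hz).1, ?_, hf⟩
  have := L.isClosed_rhombus z
  exact this.mem_of_frequently_of_tendsto hf hcont

theorem IsBlackVertex.le_norm_opp_sub (hL : L.Fat κ) (hu : L.IsBlackVertex u z) :
    κ * δ ≤ ‖RhombicLattice.opp u z - u‖ := by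
  have hδ := hL.delta_pos
  have h1 := hL.le_area hu.1
  have h2 : L.area z = cross (L.next u z - u) (RhombicLattice.opp u z - u) := by
    rw [hu.opp_eq, ← hu.cross_eq]
    have : u + (L.next u z - u) + (L.prev u z - u) - u = (L.next u z - u) + (L.prev u z - u) := by
      ring
    rw [this, cross_add_right, cross_self, zero_add]
  have h3 := (le_abs_self _).trans (abs_cross_le (L.next u z - u) (RhombicLattice.opp u z - u))
  rw [hu.norm_next, ← h2] at h3
  nlinarith

theorem IsBlackVertex.norm_opp_sub_le (hu : L.IsBlackVertex u z) :
    ‖RhombicLattice.opp u z - u‖ ≤ 2 * δ := by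
  rw [hu.opp_eq]
  have h : u + (L.next u z - u) + (L.prev u z - u) - u = (L.next u z - u) + (L.prev u z - u) := by
    ring
  have := norm_add_le (L.next u z - u) (L.prev u z - u)
  rw [h]
  rw [hu.norm_next, hu.norm_prev] at this
  linarith

/-- Different black vertices are at distance at least `κ δ`. -/
theorem black_separated (hL : L.Fat κ) (hu : u ∈ L.black) (hu' : u' ∈ L.black) (hne : u' ≠ u) :
    κ * δ ≤ ‖u' - u‖ := by
  by_contra hlt
  rw [not_le] at hlt
  have hδ := hL.delta_pos
  obtain ⟨z₀, hz₀⟩ := mem_black_iff.1 hu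
  obtain ⟨z₁, hz₁⟩ := mem_black_iff.1 hu'
  -- Take the rhombus at `u` into which the segment towards `u'` starts: it makes the coordinates of
  -- `u'` nonnegative. Closeness of `u'` makes them at most `1`, so `u'` lies in this rhombus and
  -- must be its opposite black vertex, which is too far away.
  obtain ⟨z, hz, hm, hf⟩ := exists_rhombus_ray hL u (u' - u)
  have huz := hz₀.of_mem hz hm
  have hpos : ∀ᶠ t in nhdsWithin (0 : ℝ) (Set.Ioi 0), 0 < t := self_mem_nhdsWithin
  obtain ⟨t, htm, ht⟩ := (hf.and_eventually hpos).exists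
  obtain ⟨a, b, ⟨ha, -⟩, ⟨hb, -⟩, hab⟩ := huz.mem_rhombus.1 htm
  have hA := area_pos hz
  have hle := hL.le_area hz
  set E := L.next u z - u with hE
  set G := L.prev u z - u with hG
  have hc : cross E G = L.area z := huz.cross_eq
  have hn : ‖E‖ = δ := huz.norm_next
  have hq : ‖G‖ = δ := huz.norm_prev
  have hv : (t : ℂ) * (u' - u) = a * E + b * G := by linear_combination hab
  have ea : t * cross (u' - u) G = a * L.area z := by
    rw [← cross_ofReal_mul_left, hv, cross_add_left, cross_ofReal_mul_left, cross_ofReal_mul_left,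
      cross_self, hc]; ring
  have eb : t * cross E (u' - u) = b * L.area z := by
    rw [← cross_ofReal_mul_right, hv, cross_add_right, cross_ofReal_mul_right,
      cross_ofReal_mul_right, cross_self, hc]; ring
  have b1 := (le_abs_self _).trans (abs_cross_le (u' - u) G)
  have b2 := (le_abs_self _).trans (abs_cross_le E (u' - u))
  rw [hq] at b1
  rw [hn] at b2
  have n1 : 0 ≤ cross (u' - u) G := by
    by_contra hneg
    nlinarith [mul_nonneg ha hA.le]
  have n2 : 0 ≤ cross E (u' - u) := by
    by_contra hneg
    nlinarith [mul_nonneg hb hA.le]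
  have hmem : u' ∈ L.rhombus z := by
    rw [huz.mem_rhombus]
    refine ⟨cross (u' - u) G / L.area z, cross E (u' - u) / L.area z, ⟨by positivity, ?_⟩,
      ⟨by positivity, ?_⟩, ?_⟩
    · rw [div_le_one hA]; nlinarith
    · rw [div_le_one hA]; nlinarith
    · have hcr := cramer E G (u' - u)
      rw [hc] at hcr
      have hA' : (L.area z : ℂ) ≠ 0 := by exact_mod_cast hA.ne'
      have : u' - u = (cross (u' - u) G / L.area z : ℂ) * E +
          (cross E (u' - u) / L.area z : ℂ) * G := by
        field_simp
        linear_combination hcr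
      push_cast
      linear_combination this
  have hu'z := hz₁.of_mem hz hmem
  rcases huz.black_eq hu'z with h | h
  · exact hne h
  · have := huz.le_norm_opp_sub hL
    rw [← h] at this
    linarith

/-- Two parallelograms on the same side of the common edge `y` overlap: a point just off the
midpoint of `y`, inside the second, is interior to the first. The bound on `s` keeps both
coordinates strictly between `0` and `1`. -/
theorem overlap_aux {x x' y : ℂ} (h : 0 < cross x y * cross x' y) :
    ∃ s a b : ℝ, 0 < s ∧ s < 1 ∧ 0 < a ∧ a < 1 ∧ 0 < b ∧ b < 1 ∧
      (s : ℂ) * x' + (1 / 2 : ℝ) * y = a * x + b * y := by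
  have hA : cross x y ≠ 0 := by rintro h0; rw [h0] at h; simp at h
  have hα : 0 < cross x' y / cross x y := by
    have : cross x' y / cross x y = cross x y * cross x' y / (cross x y) ^ 2 := by field_simp
    rw [this]; positivity
  set α := cross x' y / cross x y with hα'
  set β := cross x x' / cross x y with hβ'
  have hx' : x' = α * x + β * y := by
    have hcr := cramer x y x'
    have hA' : (cross x y : ℂ) ≠ 0 := by exact_mod_cast hA
    rw [hα', hβ']
    push_cast
    field_simp
    linear_combination hcr
  have hD : 0 < 4 * (1 + α + |β|) := by positivity
  refine ⟨1 / (4 * (1 + α + |β|)), 1 / (4 * (1 + α + |β|)) * α,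
    1 / 2 + 1 / (4 * (1 + α + |β|)) * β, by positivity, ?_, by positivity, ?_, ?_, ?_, ?_⟩
  · rw [div_lt_one hD]; nlinarith [abs_nonneg β]
  · rw [div_mul_eq_mul_div, one_mul, div_lt_one hD]; nlinarith [abs_nonneg β]
  · have : -(1 / 2) < 1 / (4 * (1 + α + |β|)) * β := by
      rw [div_mul_eq_mul_div, one_mul, lt_div_iff₀ hD]; nlinarith [neg_abs_le β]
    linarith
  · have : 1 / (4 * (1 + α + |β|)) * β < 1 / 2 := by
      rw [div_mul_eq_mul_div, one_mul, div_lt_iff₀ hD]; nlinarith [le_abs_self β]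
    linarith
  · generalize 1 / (4 * (1 + α + |β|)) = s
    rw [hx']
    push_cast
    ring

theorem prev_injective (hu : L.IsBlackVertex u z) (hu' : L.IsBlackVertex u z')
    (h : L.prev u z = L.prev u z') : z = z' := by
  by_contra hne
  have h1 := hu.cross_eq
  have h2 := hu'.cross_eq
  rw [← h] at h2
  obtain ⟨s, a, b, hs, hs', ha, ha', hb, hb', heq⟩ :=
    overlap_aux (x := L.next u z - u) (x' := L.next u z' - u) (y := L.prev u z - u)
      (by rw [h1, h2]; exact mul_pos (area_pos hu.1) (area_pos hu'.1))
  refine hu.interior_not_mem hu'.1 hne ha ha' hb hb' (hu'.mem_rhombus.2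
    ⟨s, 1 / 2, ⟨hs.le, hs'.le⟩, by norm_num, ?_⟩)
  rw [← h]
  linear_combination - heq

theorem next_injective (hu : L.IsBlackVertex u z) (hu' : L.IsBlackVertex u z')
    (h : L.next u z = L.next u z') : z = z' := by
  by_contra hne
  have h1 := hu.cross_eq
  have h2 := hu'.cross_eq
  rw [← h] at h2
  obtain ⟨s, a, b, hs, hs', ha, ha', hb, hb', heq⟩ :=
    overlap_aux (x := L.prev u z - u) (x' := L.prev u z' - u) (y := L.next u z - u)
      (by rw [cross_comm, h1, cross_comm, h2, neg_mul_neg]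
          exact mul_pos (area_pos hu.1) (area_pos hu'.1))
  refine hu.interior_not_mem hu'.1 hne hb hb' ha ha' (hu'.mem_rhombus.2
    ⟨1 / 2, s, by norm_num, ⟨hs.le, hs'.le⟩, ?_⟩)
  rw [← h]
  linear_combination - heq

/-- The side of a rhombus is also a side of a rhombus on the other side of it. -/
theorem exists_prev_eq_next (hL : L.Fat κ) (hu : L.IsBlackVertex u z) :
    ∃ z', L.IsBlackVertex u z' ∧ L.prev u z' = L.next u z := by
  have hA := area_pos hu.1
  set E := L.next u z - u with hE
  set G := L.prev u z - u with hG
  have hc : cross E G = L.area z := hu.cross_eq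
  -- Leaving the midpoint of the side in the direction `-G` leads out of `z`. The rhombus entered
  -- shares this side, and its orientation decides that the shared white vertex precedes `u` there.
  obtain ⟨z', hz', hm, hf⟩ := exists_rhombus_ray hL (u + (1 / 2 : ℝ) * E) (-G)
  have hpos : ∀ᶠ t in nhdsWithin (0 : ℝ) (Set.Ioi 0), 0 < t := self_mem_nhdsWithin
  obtain ⟨t, htm, ht⟩ := (hf.and_eventually hpos).exists
  have hside : cross E (u + (1 / 2 : ℝ) * E + t * -G - u) < 0 := by
    have e : u + (1 / 2 : ℝ) * E + t * -G - u = (1 / 2 : ℝ) * E + (-t : ℝ) * G := by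
      push_cast; ring
    rw [e, cross_add_right, cross_ofReal_mul_right, cross_ofReal_mul_right, cross_self, hc]
    nlinarith
  have hne : z ≠ z' := by
    rintro rfl
    obtain ⟨a, b, -, ⟨hb, -⟩, hab⟩ := hu.mem_rhombus.1 htm
    rw [hab] at hside
    have e : u + a * E + b * G - u = a * E + b * G := by ring
    rw [← hE, ← hG, e, cross_add_right, cross_ofReal_mul_right, cross_ofReal_mul_right, cross_self,
      hc] at hside
    nlinarith
  have hmz : u + (1 / 2 : ℝ) * E ∈ L.rhombus z :=
    hu.mem_rhombus.2 ⟨1 / 2, 0, by norm_num, by norm_num, by push_cast; ring⟩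
  obtain ⟨u', w, s, hu', hw, hs0, hs1, hp, hb, hw'⟩ := exists_common_side hu.1 hz' hne hmz hm
  have hp' : (1 - s) * u' + s * w = u + (1 / 2 : ℝ) * (L.next u z - u) +
      (0 : ℝ) * (L.prev u z - u) := by
    rw [← hp]; push_cast; ring
  obtain ⟨hs, rfl, rfl⟩ : s = 1 / 2 ∧ u' = u ∧ w = L.next u z := by
    rcases hu.side_not_interior hu' hw hp' with h | h | h | h
    · exact ⟨h.2.1.symm, h.2.2⟩
    · linarith [h.1]
    · linarith [h.1]
    · linarith [h.1]
  have hb := hb (by linarith)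
  have hw' := hw' (by linarith)
  refine ⟨z', hb, ?_⟩
  rcases hb.white_eq hw' with h | h
  · exfalso
    obtain ⟨a, b, -, ⟨hb0, -⟩, hab⟩ := hb.mem_rhombus.1 htm
    rw [hab] at hside
    have e : u' + a * (L.next u' z' - u') + b * (L.prev u' z' - u') - u' =
      a * E + b * (L.prev u' z' - u') := by rw [hE, h]; ring
    have hc' := hb.cross_eq
    rw [← h, ← hE] at hc'
    rw [e, cross_add_right, cross_ofReal_mul_right, cross_ofReal_mul_right, cross_self, hc'] at hside
    nlinarith [area_pos hz']
  · exact h.symm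

variable (L) in
/-- The rhombi around the vertex `u`. -/
noncomputable def starFinset (u : ℂ) : Finset ℂ := (L.locally_finite u).toFinset

theorem mem_starFinset (hu : u ∈ L.black) : z ∈ L.starFinset u ↔ L.IsBlackVertex u z := by
  obtain ⟨z₀, hz₀⟩ := mem_black_iff.1 hu
  simp only [starFinset, Set.Finite.mem_toFinset, Set.mem_ofPred_eq, IsBlackVertex]
  constructor
  · rintro ⟨hz, h⟩
    refine ⟨hz, ?_⟩
    simp only [Set.mem_insert_iff, Set.mem_singleton_iff] at h
    rcases h with h | h | h | h
    · exact .inl h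
    · exact absurd h (hz₀.ne ⟨hz, .inl rfl⟩)
    · exact .inr h
    · exact absurd h (hz₀.ne ⟨hz, .inr rfl⟩)
  · rintro ⟨hz, rfl | rfl⟩ <;> exact ⟨hz, by simp⟩

/-- The rhombi close up around `u`: every following white vertex is the preceding one of an adjacent
rhombus, and equal cardinalities upgrade this inclusion to an equality. Any sum of differences of
the form `g next - g prev` over the star therefore telescopes to zero. -/
theorem sum_next_eq_sum_prev (hL : L.Fat κ) (hu : u ∈ L.black) {M : Type*} [AddCommMonoid M]
    (g : ℂ → M) :
    ∑ z ∈ L.starFinset u, g (L.next u z) = ∑ z ∈ L.starFinset u, g (L.prev u z) := by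
  classical
  have hin : Set.InjOn (L.next u) (L.starFinset u) := fun z hz z' hz' h =>
    next_injective ((mem_starFinset hu).1 hz) ((mem_starFinset hu).1 hz') h
  have hip : Set.InjOn (L.prev u) (L.starFinset u) := fun z hz z' hz' h =>
    prev_injective ((mem_starFinset hu).1 hz) ((mem_starFinset hu).1 hz') h
  rw [← Finset.sum_image (f := g) hin, ← Finset.sum_image (f := g) hip]
  have : (L.starFinset u).image (L.next u) = (L.starFinset u).image (L.prev u) := by
    refine Finset.eq_of_subset_of_card_le ?_ ?_
    · intro x hx
      obtain ⟨z, hz, rfl⟩ := Finset.mem_image.1 hx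
      obtain ⟨z', hz', h⟩ := exists_prev_eq_next hL ((mem_starFinset hu).1 hz)
      exact Finset.mem_image.2 ⟨z', (mem_starFinset hu).2 hz', h⟩
    · rw [Finset.card_image_of_injOn hin, Finset.card_image_of_injOn hip]
  rw [this]

/-! ### The discrete Laplacian and its moments. -/

variable (L) in
/-- The conductance `tan θ` of the black diagonal of the rhombus `z`. -/
noncomputable def cond (z : ℂ) : ℝ := 2 * L.area z / ‖L.u₂ z - L.u₁ z‖ ^ 2

variable (L) in
/-- The total area of the rhombi around `u`. -/
noncomputable def mass (u : ℂ) : ℝ := ∑ z ∈ L.starFinset u, L.area z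

variable (L) in
/-- The (unnormalized) discrete Laplacian on the black vertices. -/
noncomputable def lap (H : ℂ → ℝ) (u : ℂ) : ℝ :=
  ∑ z ∈ L.starFinset u, L.cond z * (H (opp u z) - H u)

theorem IsBlackVertex.norm_diag (hu : L.IsBlackVertex u z) :
    ‖L.u₂ z - L.u₁ z‖ = ‖RhombicLattice.opp u z - u‖ := by
  obtain ⟨hz, rfl | rfl⟩ := hu
  · rw [opp_u₁ hz]
  · rw [opp_u₂ hz, norm_sub_rev]

theorem diag_pos (hz : z ∈ L.diamond) : 0 < ‖L.u₂ z - L.u₁ z‖ :=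
  norm_pos_iff.2 (sub_ne_zero.2 (u₁_ne_u₂ hz).symm)

theorem cond_pos (hz : z ∈ L.diamond) : 0 < L.cond z :=
  div_pos (mul_pos two_pos (area_pos hz)) (pow_pos (diag_pos hz) 2)

theorem IsBlackVertex.cond_mul_sq (hu : L.IsBlackVertex u z) :
    L.cond z * ‖RhombicLattice.opp u z - u‖ ^ 2 = 2 * L.area z := by
  rw [← hu.norm_diag, cond, div_mul_cancel₀ _ (pow_pos (diag_pos hu.1) 2).ne']

theorem le_diag (hL : L.Fat κ) (hz : z ∈ L.diamond) : κ * δ ≤ ‖L.u₂ z - L.u₁ z‖ := by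
  rw [(isBlackVertex_u₁ hz).norm_diag]; exact (isBlackVertex_u₁ hz).le_norm_opp_sub hL

theorem diag_le (hz : z ∈ L.diamond) : ‖L.u₂ z - L.u₁ z‖ ≤ 2 * δ := by
  rw [(isBlackVertex_u₁ hz).norm_diag]; exact (isBlackVertex_u₁ hz).norm_opp_sub_le

theorem cond_le (hL : L.Fat κ) (hz : z ∈ L.diamond) : L.cond z ≤ 2 / κ ^ 2 := by
  have hκ := hL.kappa_pos
  have hδ := hL.delta_pos
  have h1 : (κ * δ) ^ 2 ≤ ‖L.u₂ z - L.u₁ z‖ ^ 2 :=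
    pow_le_pow_left₀ (by positivity) (le_diag hL hz) 2
  rw [cond]
  calc _ ≤ 2 * δ ^ 2 / (κ * δ) ^ 2 := by
        have := area_le hz
        gcongr
    _ = _ := by field_simp

theorem le_cond (hL : L.Fat κ) (hz : z ∈ L.diamond) : κ / 2 ≤ L.cond z := by
  have hκ := hL.kappa_pos
  have hδ := hL.delta_pos
  have h1 : ‖L.u₂ z - L.u₁ z‖ ^ 2 ≤ (2 * δ) ^ 2 :=
    pow_le_pow_left₀ (norm_nonneg _) (diag_le hz) 2
  rw [cond, le_div_iff₀ (pow_pos (diag_pos hz) 2)]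
  have := hL.le_area hz
  nlinarith

/-- The diagonals of a rhombus are perpendicular and `cond` is the ratio of the white one to the
black one, so multiplication by `cond` and a quarter turn carries one diagonal to the other. -/
theorem IsBlackVertex.cond_mul (hu : L.IsBlackVertex u z) :
    (L.cond z : ℂ) * (RhombicLattice.opp u z - u) = Complex.I * (L.next u z - L.prev u z) := by
  have h1 := hu.norm_next
  have h2 := hu.norm_prev
  have hd : 0 < ‖RhombicLattice.opp u z - u‖ ^ 2 := by
    rw [← hu.norm_diag]; exact pow_pos (diag_pos hu.1) 2
  rw [cond, hu.norm_diag, ← hu.cross_eq]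
  have hv : RhombicLattice.opp u z - u = (L.next u z - u) + (L.prev u z - u) := by
    rw [hu.opp_eq]; ring
  have hsub : L.next u z - L.prev u z = (L.next u z - u) - (L.prev u z - u) := by ring
  rw [hv] at hd ⊢
  rw [hsub]
  generalize L.next u z - u = x at *
  generalize L.prev u z - u = y at *
  have n1 : x.re ^ 2 + x.im ^ 2 = y.re ^ 2 + y.im ^ 2 := by
    have a : ‖x‖ ^ 2 = ‖y‖ ^ 2 := by rw [h1, h2]
    rw [← Complex.normSq_eq_norm_sq, ← Complex.normSq_eq_norm_sq, Complex.normSq_apply,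
      Complex.normSq_apply] at a
    linarith
  have n2 : ‖x + y‖ ^ 2 = (x.re + y.re) ^ 2 + (x.im + y.im) ^ 2 := by
    rw [← Complex.normSq_eq_norm_sq, Complex.normSq_apply]; simp; ring
  rw [n2] at hd ⊢
  have hd' : (((x.re + y.re) ^ 2 + (x.im + y.im) ^ 2 : ℝ) : ℂ) ≠ 0 := by exact_mod_cast hd.ne'
  rw [Complex.ofReal_div, div_mul_eq_mul_div, div_eq_iff hd']
  apply Complex.ext
  · simp [cross, -Complex.ofReal_add, -Complex.ofReal_pow]
    ring_nf
    linear_combination (x.im + y.im) * n1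
  · simp [cross, -Complex.ofReal_add, -Complex.ofReal_pow]
    ring_nf
    linear_combination (-x.re - y.re) * n1

theorem sum_cond_mul (hL : L.Fat κ) (hu : u ∈ L.black) :
    ∑ z ∈ L.starFinset u, (L.cond z : ℂ) * (opp u z - u) = 0 := by
  have h : ∀ z ∈ L.starFinset u, (L.cond z : ℂ) * (opp u z - u) =
      Complex.I * L.next u z - Complex.I * L.prev u z := by
    intro z hz
    rw [((mem_starFinset hu).1 hz).cond_mul]; ring
  rw [Finset.sum_congr rfl h, Finset.sum_sub_distrib,
    sum_next_eq_sum_prev hL hu (fun x => Complex.I * x), sub_self]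

/-- The black diagonal is the sum, and the white one the difference, of the two side vectors at `u`;
their product is a difference of squares and telescopes. This cancellation makes `z²` discrete
harmonic and is what rhombic lattices have beyond general weighted graphs. -/
theorem sum_cond_mul_sq (hL : L.Fat κ) (hu : u ∈ L.black) :
    ∑ z ∈ L.starFinset u, (L.cond z : ℂ) * (opp u z - u) ^ 2 = 0 := by
  have h : ∀ z ∈ L.starFinset u, (L.cond z : ℂ) * (opp u z - u) ^ 2 =
      Complex.I * (L.next u z - u) ^ 2 - Complex.I * (L.prev u z - u) ^ 2 := by
    intro z hz
    have hb := (mem_starFinset hu).1 hz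
    have h1 := hb.cond_mul
    have h2 := hb.opp_eq
    linear_combination (opp u z - u) * h1 + Complex.I * (L.next u z - L.prev u z) * h2
  rw [Finset.sum_congr rfl h, Finset.sum_sub_distrib,
    sum_next_eq_sum_prev hL hu (fun x => Complex.I * (x - u) ^ 2), sub_self]

theorem sum_cond_mul_norm_sq (hu : u ∈ L.black) :
    ∑ z ∈ L.starFinset u, L.cond z * ‖opp u z - u‖ ^ 2 = 2 * L.mass u := by
  rw [mass, Finset.mul_sum]
  exact Finset.sum_congr rfl fun z hz => ((mem_starFinset hu).1 hz).cond_mul_sq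

theorem card_star_le (hL : L.Fat κ) (hu : u ∈ L.black) :
    ((L.starFinset u).card : ℝ) ≤ 100 / κ ^ 2 := by
  have hδ := hL.delta_pos
  have hsub : L.starFinset u ⊆ L.rhombi u (2 * δ) := by
    intro z hz
    have hb := (mem_starFinset hu).1 hz
    rw [mem_rhombi hL]
    refine ⟨hb.1, ?_⟩
    rw [norm_sub_rev]
    linarith [norm_sub_center_le hb]
  have h1 : ((L.starFinset u).card : ℝ) ≤ (L.rhombi u (2 * δ)).card := by
    exact_mod_cast Finset.card_le_card hsub
  refine h1.trans ((card_rhombi_le hL u (by linarith)).trans_eq ?_)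
  field_simp; norm_num

theorem mass_le (hL : L.Fat κ) (hu : u ∈ L.black) : L.mass u ≤ 100 / κ ^ 2 * δ ^ 2 := by
  have h : ∀ z ∈ L.starFinset u, L.area z ≤ δ ^ 2 := fun z hz =>
    area_le ((mem_starFinset hu).1 hz).1
  refine (Finset.sum_le_card_nsmul _ _ _ h).trans ?_
  rw [nsmul_eq_mul]
  exact mul_le_mul_of_nonneg_right (card_star_le hL hu) (sq_nonneg _)

theorem le_mass (hL : L.Fat κ) (hu : u ∈ L.black) : κ * δ ^ 2 ≤ L.mass u := by
  obtain ⟨z, hz⟩ := mem_black_iff.1 hu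
  refine (hL.le_area hz.1).trans ?_
  exact Finset.single_le_sum (f := L.area)
    (fun z hz => (area_pos ((mem_starFinset hu).1 hz).1).le) ((mem_starFinset hu).2 hz)

theorem mass_pos (hu : u ∈ L.black) : 0 < L.mass u := by
  obtain ⟨z, hz⟩ := mem_black_iff.1 hu
  exact (area_pos hz.1).trans_le (Finset.single_le_sum (f := L.area)
    (fun z hz => (area_pos ((mem_starFinset hu).1 hz).1).le) ((mem_starFinset hu).2 hz))

/-! ### Summation by parts and Caccioppoli's inequality. -/

/-- Pairs of a vertex and an incident rhombus are counted by rhombi instead of by vertices. The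
vanishing of `T` outside the disc disposes of rhombi with only one vertex inside. -/
theorem sum_blacks_star (hL : L.Fat κ) (x : ℂ) {r R : ℝ} (hrR : r + δ ≤ R) (T : ℂ → ℂ → ℝ)
    (hT : ∀ u z, L.IsBlackVertex u z → r ≤ ‖u - x‖ → T u z = 0) :
    ∑ u ∈ L.blacks x r, ∑ z ∈ L.starFinset u, T u z =
      ∑ z ∈ L.rhombi x R, (T (L.u₁ z) z + T (L.u₂ z) z) := by
  classical
  have hδ := hL.delta_pos
  rw [Finset.sum_comm' (t' := L.rhombi x R)
    (s' := fun z => ({L.u₁ z, L.u₂ z} : Finset ℂ).filter (fun u => ‖u - x‖ < r))]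
  · refine Finset.sum_congr rfl fun z hz => ?_
    have hz := ((mem_rhombi hL).1 hz).1
    rw [Finset.sum_filter, Finset.sum_pair (u₁_ne_u₂ hz)]
    congr 1
    · split_ifs with h
      · rfl
      · exact (hT _ _ (isBlackVertex_u₁ hz) (not_lt.1 h)).symm
    · split_ifs with h
      · rfl
      · exact (hT _ _ (isBlackVertex_u₂ hz) (not_lt.1 h)).symm
  · intro u z
    simp only [Finset.mem_filter, Finset.mem_insert, Finset.mem_singleton, mem_rhombi hL,
      mem_blacks hL]
    constructor
    · rintro ⟨⟨hu, hr⟩, hz⟩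
      have hb := (mem_starFinset hu).1 hz
      refine ⟨⟨hb.2, hr⟩, hb.1, ?_⟩
      have h1 := norm_sub_center_le hb
      have := norm_sub_le (u - x) (u - z)
      rw [sub_sub_sub_cancel_left] at this
      linarith
    · rintro ⟨⟨hu, hr⟩, hz, -⟩
      have hb : L.IsBlackVertex u z := ⟨hz, hu⟩
      exact ⟨⟨hb.mem_black, hr⟩, (mem_starFinset hb.mem_black).2 hb⟩

theorem IsBlackVertex.norm_sub_lt (hu : L.IsBlackVertex u z) {x : ℂ} {r : ℝ}
    (h : ‖RhombicLattice.opp u z - x‖ < r) : ‖u - x‖ < r + 2 * δ := by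
  have h1 := hu.norm_opp_sub_le
  have := norm_sub_le (RhombicLattice.opp u z - x) (RhombicLattice.opp u z - u)
  rw [sub_sub_sub_cancel_left] at this
  linarith

/-- Green's formula for a function `ψ` supported in a disc. -/
theorem sum_mul_lap (hL : L.Fat κ) (x : ℂ) {r : ℝ} (H ψ : ℂ → ℝ)
    (hψ : ∀ u ∈ L.black, r ≤ ‖u - x‖ → ψ u = 0) :
    ∑ u ∈ L.blacks x (r + 2 * δ), H u * L.lap ψ u =
      ∑ u ∈ L.blacks x (r + 2 * δ), ψ u * L.lap H u := by
  have hδ := hL.delta_pos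
  simp only [lap, Finset.mul_sum]
  rw [sum_blacks_star hL x (R := r + 3 * δ) (by linarith), sum_blacks_star hL x (R := r + 3 * δ)
    (by linarith)]
  · refine Finset.sum_congr rfl fun z hz => ?_
    have hz := ((mem_rhombi hL).1 hz).1
    rw [opp_u₁ hz, opp_u₂ hz]
    ring
  · intro u z hb hr
    rw [hψ u hb.mem_black (by linarith)]; ring
  · intro u z hb hr
    rw [hψ u hb.mem_black (by linarith), hψ _ hb.opp.mem_black]
    · ring
    · by_contra h
      linarith [hb.norm_sub_lt (not_le.1 h)]

theorem sum_mul_lap_eq_zero (hL : L.Fat κ) (x : ℂ) {r : ℝ} (H ψ : ℂ → ℝ)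
    (hψ : ∀ u ∈ L.black, r ≤ ‖u - x‖ → ψ u = 0)
    (hH : ∀ u ∈ L.black, ‖u - x‖ < r → L.lap H u = 0) :
    ∑ u ∈ L.blacks x (r + 2 * δ), H u * L.lap ψ u = 0 := by
  rw [sum_mul_lap hL x H ψ hψ]
  refine Finset.sum_eq_zero fun u hu => ?_
  have hb := ((mem_blacks hL).1 hu).1
  by_cases h : ‖u - x‖ < r
  · rw [hH u hb h, mul_zero]
  · rw [hψ u hb (not_lt.1 h), zero_mul]

/-- Caccioppoli's inequality. -/
theorem sum_sq_grad_le (hL : L.Fat κ) (x : ℂ) {r : ℝ} (hr : 16 * δ ≤ r) (H : ℂ → ℝ)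
    (hH : ∀ u ∈ L.black, ‖u - x‖ < r → L.lap H u = 0) :
    ∑ z ∈ L.rhombi x (r / 2), (H (L.u₁ z) - H (L.u₂ z)) ^ 2 ≤
      12800 / κ ^ 5 * (δ / r) ^ 2 * ∑ u ∈ L.blacks x r, H u ^ 2 := by
  have hδ := hL.delta_pos
  have hκ := hL.kappa_pos
  have hr0 : 0 < r := by linarith
  -- A cutoff that is `1` on all vertices of rhombi centred in the half disc, vanishes within two
  -- steps of the boundary, and has slope at most `4 / r`.
  set χ : ℂ → ℝ := fun u => min 1 (max 0 (4 * (r - 2 * δ - ‖u - x‖) / r)) with hχ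
  have χ0 : ∀ u, r - 2 * δ ≤ ‖u - x‖ → χ u = 0 := by
    intro u hu
    have : 4 * (r - 2 * δ - ‖u - x‖) / r ≤ 0 :=
      div_nonpos_of_nonpos_of_nonneg (by linarith) hr0.le
    simp only [hχ]
    rw [max_eq_left this]; norm_num
  have χ1 : ∀ u, ‖u - x‖ ≤ r / 2 + δ → χ u = 1 := by
    intro u hu
    have : 1 ≤ 4 * (r - 2 * δ - ‖u - x‖) / r := by
      rw [le_div_iff₀ hr0]; linarith
    simp only [hχ]
    rw [max_eq_right (by linarith), min_eq_left this]
  have χL : ∀ u v, |χ u - χ v| ≤ 4 / r * ‖u - v‖ := by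
    intro u v
    simp only [hχ]
    refine (abs_min_sub_min_le_max _ _ _ _).trans ?_
    rw [sub_self, abs_zero, max_eq_right (abs_nonneg _)]
    refine (abs_max_sub_max_le_max _ _ _ _).trans ?_
    rw [sub_self, abs_zero, max_eq_right (abs_nonneg _)]
    have : 4 * (r - 2 * δ - ‖u - x‖) / r - 4 * (r - 2 * δ - ‖v - x‖) / r =
      4 / r * (‖v - x‖ - ‖u - x‖) := by ring
    rw [this, abs_mul, abs_of_pos (by positivity : 0 < 4 / r)]
    refine mul_le_mul_of_nonneg_left ?_ (by positivity)
    have := abs_norm_sub_norm_le (v - x) (u - x)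
    rwa [sub_sub_sub_cancel_right, norm_sub_rev v u] at this
  have h0 : ∑ u ∈ L.blacks x r, ∑ z ∈ L.starFinset u,
      χ u ^ 2 * H u * (L.cond z * (H (opp u z) - H u)) = 0 := by
    refine Finset.sum_eq_zero fun u hu => ?_
    have hb := (mem_blacks hL).1 hu
    rw [← Finset.mul_sum]
    have := hH u hb.1 hb.2
    rw [lap] at this
    rw [this, mul_zero]
  rw [sum_blacks_star hL x (R := r + δ) le_rfl _ (by
    intro u z _ hru
    rw [χ0 u (by linarith)]; ring)] at h0
  -- Testing harmonicity against `χ² H` gives, on each edge, `(χ₁² H₁ - χ₂² H₂)(H₁ - H₂) = (χ₁ H₁ -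
  -- χ₂ H₂)² - H₁ H₂ (χ₁ - χ₂)²`.
  have h1 : ∑ z ∈ L.rhombi x (r + δ),
        L.cond z * (χ (L.u₁ z) * H (L.u₁ z) - χ (L.u₂ z) * H (L.u₂ z)) ^ 2 =
      ∑ z ∈ L.rhombi x (r + δ),
        L.cond z * (H (L.u₁ z) * H (L.u₂ z) * (χ (L.u₁ z) - χ (L.u₂ z)) ^ 2) := by
    rw [← sub_eq_zero, ← Finset.sum_sub_distrib, ← neg_eq_zero, ← Finset.sum_neg_distrib, ← h0]
    refine Finset.sum_congr rfl fun z hz => ?_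
    have hz := ((mem_rhombi hL).1 hz).1
    rw [opp_u₁ hz, opp_u₂ hz]
    ring
  have h2 : ∑ z ∈ L.rhombi x (r / 2), κ / 2 * (H (L.u₁ z) - H (L.u₂ z)) ^ 2 ≤
      ∑ z ∈ L.rhombi x (r + δ),
        L.cond z * (χ (L.u₁ z) * H (L.u₁ z) - χ (L.u₂ z) * H (L.u₂ z)) ^ 2 := by
    refine (Finset.sum_le_sum (g := fun z =>
        L.cond z * (χ (L.u₁ z) * H (L.u₁ z) - χ (L.u₂ z) * H (L.u₂ z)) ^ 2) ?_).trans
      (Finset.sum_le_sum_of_subset_of_nonneg ?_ ?_)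
    · intro z hz
      obtain ⟨hz, hzr⟩ := (mem_rhombi hL).1 hz
      have near : ∀ u, L.IsBlackVertex u z → ‖u - x‖ ≤ r / 2 + δ := by
        intro u hu
        have h1 := norm_sub_center_le hu
        have := norm_add_le (u - z) (z - x)
        rw [sub_add_sub_cancel] at this
        linarith
      rw [χ1 _ (near _ (isBlackVertex_u₁ hz)), χ1 _ (near _ (isBlackVertex_u₂ hz)), one_mul, one_mul]
      exact mul_le_mul_of_nonneg_right (le_cond hL hz) (sq_nonneg _)
    · intro z hz
      obtain ⟨hz, hzr⟩ := (mem_rhombi hL).1 hz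
      exact (mem_rhombi hL).2 ⟨hz, by linarith⟩
    · intro z hz _
      exact mul_nonneg (cond_pos ((mem_rhombi hL).1 hz).1).le (sq_nonneg _)
  classical
  -- Truncation to the disc lets the edge sum be turned back into a vertex sum over `blacks x r`
  -- only.
  set G : ℂ → ℝ := fun u => if ‖u - x‖ < r then H u ^ 2 else 0 with hG
  have h3 : ∀ z ∈ L.rhombi x (r + δ),
        L.cond z * (H (L.u₁ z) * H (L.u₂ z) * (χ (L.u₁ z) - χ (L.u₂ z)) ^ 2) ≤
      64 / κ ^ 2 * (δ / r) ^ 2 * (G (L.u₁ z) + G (L.u₂ z)) := by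
    intro z hz
    obtain ⟨hz, hzr⟩ := (mem_rhombi hL).1 hz
    have hG0 : ∀ u, 0 ≤ G u := by intro u; simp only [hG]; split_ifs <;> positivity
    by_cases hout : r - 2 * δ ≤ ‖L.u₁ z - x‖ ∧ r - 2 * δ ≤ ‖L.u₂ z - x‖
    · rw [χ0 _ hout.1, χ0 _ hout.2]
      have := hG0 (L.u₁ z)
      have := hG0 (L.u₂ z)
      simp only [sub_self, ne_eq, OfNat.ofNat_ne_zero, not_false_eq_true, zero_pow, mul_zero]
      positivity
    · have hin : ‖L.u₁ z - x‖ < r ∧ ‖L.u₂ z - x‖ < r := by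
        rw [not_and_or, not_le, not_le] at hout
        rcases hout with h | h
        · have := (isBlackVertex_u₂ hz).norm_sub_lt (by rw [opp_u₂ hz]; exact h)
          exact ⟨by linarith, by linarith⟩
        · have := (isBlackVertex_u₁ hz).norm_sub_lt (by rw [opp_u₁ hz]; exact h)
          exact ⟨by linarith, by linarith⟩
      have e1 : G (L.u₁ z) = H (L.u₁ z) ^ 2 := by simp only [hG]; rw [if_pos hin.1]
      have e2 : G (L.u₂ z) = H (L.u₂ z) ^ 2 := by simp only [hG]; rw [if_pos hin.2]
      rw [e1, e2]
      have hχ2 : (χ (L.u₁ z) - χ (L.u₂ z)) ^ 2 ≤ (8 * δ / r) ^ 2 := by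
        rw [← sq_abs]
        refine pow_le_pow_left₀ (abs_nonneg _) ((χL _ _).trans ?_) 2
        have := diag_le hz
        rw [norm_sub_rev] at this
        calc _ ≤ 4 / r * (2 * δ) := by gcongr
          _ = _ := by ring
      have hc := cond_le hL hz
      have hc0 := cond_pos hz
      have hab : H (L.u₁ z) * H (L.u₂ z) ≤ (H (L.u₁ z) ^ 2 + H (L.u₂ z) ^ 2) / 2 := by
        nlinarith [sq_nonneg (H (L.u₁ z) - H (L.u₂ z))]
      calc _ ≤ L.cond z * ((H (L.u₁ z) ^ 2 + H (L.u₂ z) ^ 2) / 2 *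
            (χ (L.u₁ z) - χ (L.u₂ z)) ^ 2) := by gcongr
        _ ≤ 2 / κ ^ 2 * ((H (L.u₁ z) ^ 2 + H (L.u₂ z) ^ 2) / 2 * (8 * δ / r) ^ 2) := by gcongr
        _ = _ := by ring
  have h4 : ∑ z ∈ L.rhombi x (r + δ), (G (L.u₁ z) + G (L.u₂ z)) ≤
      100 / κ ^ 2 * ∑ u ∈ L.blacks x r, H u ^ 2 := by
    rw [← sum_blacks_star hL x le_rfl (fun u _ => G u) (by
      intro u z _ hru
      simp only [hG]; rw [if_neg (not_lt.2 hru)]), Finset.mul_sum]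
    refine Finset.sum_le_sum fun u hu => ?_
    have hb := (mem_blacks hL).1 hu
    rw [Finset.sum_const, nsmul_eq_mul]
    have : G u = H u ^ 2 := by simp only [hG]; rw [if_pos hb.2]
    rw [this]
    exact mul_le_mul_of_nonneg_right (card_star_le hL hb.1) (sq_nonneg _)
  have h5 := Finset.sum_le_sum h3
  rw [← Finset.mul_sum] at h5
  rw [← Finset.mul_sum, h1] at h2
  have h6 := h2.trans (h5.trans (mul_le_mul_of_nonneg_left h4 (by positivity)))
  have h7 : 12800 / κ ^ 5 * (δ / r) ^ 2 * ∑ u ∈ L.blacks x r, H u ^ 2 =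
      (2 / κ) * (64 / κ ^ 2 * (δ / r) ^ 2 * (100 / κ ^ 2 * ∑ u ∈ L.blacks x r, H u ^ 2)) := by
    field_simp; ring
  rw [h7]
  calc _ = 2 / κ * (κ / 2 * ∑ z ∈ L.rhombi x (r / 2), (H (L.u₁ z) - H (L.u₂ z)) ^ 2) := by
        field_simp
    _ ≤ _ := by gcongr

/-! ### Connectivity of the black graph along segments. -/

/-- The black vertices of the rhombi that meet a connected set without white vertices are chained
together by these rhombi. -/
theorem chain_of_isPreconnected (hL : L.Fat κ) {S : Set ℂ} (hS : IsPreconnected S) {r : ℝ}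
    (hSr : ∀ p ∈ S, ‖p - x‖ < r) (hSw : ∀ p ∈ S, ∀ z, ¬ L.IsWhiteVertex p z) (P : ℂ → Prop)
    (hP : ∀ z ∈ L.diamond, (S ∩ L.rhombus z).Nonempty → (P (L.u₁ z) ↔ P (L.u₂ z)))
    (hz : z ∈ L.diamond) (hz' : z' ∈ L.diamond) (hm : (S ∩ L.rhombus z).Nonempty)
    (hm' : (S ∩ L.rhombus z').Nonempty) (h : P (L.u₁ z)) : P (L.u₁ z') := by
  classical
  by_contra hn
  set Z := (L.rhombi x (r + δ)).filter (fun z => (S ∩ L.rhombus z).Nonempty) with hZ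
  have hmemZ : ∀ z ∈ L.diamond, (S ∩ L.rhombus z).Nonempty → z ∈ Z := by
    rintro z hz ⟨p, hpS, hpz⟩
    rw [hZ, Finset.mem_filter, mem_rhombi hL]
    refine ⟨⟨hz, ?_⟩, ⟨p, hpS, hpz⟩⟩
    have h1 := dist_center_le hz hpz
    have := norm_sub_le (p - x) (p - z)
    rw [sub_sub_sub_cancel_left] at this
    linarith [hSr p hpS]
  have hclosed : ∀ (Q : ℂ → Prop) [DecidablePred Q], IsClosed (⋃ z ∈ Z.filter Q, L.rhombus z) :=
   fun Q _ =>
    Set.Finite.isClosed_biUnion (Finset.finite_toSet _) fun z _ => L.isClosed_rhombus z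
  -- The rhombi with `P` and those without it form two closed sets covering `S`, so they meet in
  -- `S`. The meeting point is not a white vertex, so the two rhombi share a black vertex, across
  -- which `P` is transported.
  have key := isPreconnected_closed_iff.1 hS _ _ (hclosed fun z => P (L.u₁ z))
    (hclosed fun z => ¬ P (L.u₁ z)) (by
      intro p hp
      obtain ⟨z, hz, hpz⟩ := L.cover p
      have hzZ := hmemZ z hz ⟨p, hp, hpz⟩
      by_cases hPz : P (L.u₁ z)
      · exact .inl (Set.mem_biUnion (Finset.mem_coe.2 (Finset.mem_filter.2 ⟨hzZ, hPz⟩)) hpz)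
      · exact .inr (Set.mem_biUnion (Finset.mem_coe.2 (Finset.mem_filter.2 ⟨hzZ, hPz⟩)) hpz))
    (by
      obtain ⟨p, hpS, hpz⟩ := hm
      exact ⟨p, hpS, Set.mem_biUnion (Finset.mem_coe.2 (Finset.mem_filter.2
        ⟨hmemZ z hz ⟨p, hpS, hpz⟩, h⟩)) hpz⟩)
    (by
      obtain ⟨p, hpS, hpz⟩ := hm'
      exact ⟨p, hpS, Set.mem_biUnion (Finset.mem_coe.2 (Finset.mem_filter.2
        ⟨hmemZ z' hz' ⟨p, hpS, hpz⟩, hn⟩)) hpz⟩)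
  obtain ⟨p, hpS, hpA, hpB⟩ := key
  simp only [Set.mem_iUnion, Finset.mem_filter, exists_prop] at hpA hpB
  obtain ⟨a, ⟨haZ, haP⟩, hpa⟩ := hpA
  obtain ⟨b, ⟨hbZ, hbP⟩, hpb⟩ := hpB
  have hne : a ≠ b := by rintro rfl; exact hbP haP
  have had := ((mem_rhombi hL).1 (Finset.mem_filter.1 haZ).1).1
  have hbd := ((mem_rhombi hL).1 (Finset.mem_filter.1 hbZ).1).1
  obtain ⟨u, w, t, hu, hw, ht0, ht1, hp, hub, -⟩ := exists_common_side had hbd hne hpa hpb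
  rcases ht1.lt_or_eq with ht | rfl
  · have hub := hub ht
    have pa : P u := by
      rcases hu.2 with h | h
      · rwa [h]
      · rw [h]; exact (hP a had (Finset.mem_filter.1 haZ).2).1 haP
    apply hbP
    rcases hub.2 with h | h
    · rwa [← h]
    · rw [hP b hbd (Finset.mem_filter.1 hbZ).2, ← h]; exact pa
  · refine hSw p hpS a ?_
    rw [hp]; simpa using hw

theorem countable_diamond (hL : L.Fat κ) : L.diamond.Countable := by
  have : L.diamond = ⋃ n : ℕ, {z ∈ L.diamond | ‖z - 0‖ < n} := by
    ext z
    simp only [Set.mem_iUnion, Set.mem_ofPred_eq]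
    constructor
    · intro hz
      obtain ⟨n, hn⟩ := exists_nat_gt ‖z - 0‖
      exact ⟨n, hz, hn⟩
    · rintro ⟨n, hz, -⟩; exact hz
  rw [this]
  exact Set.countable_iUnion fun n => (finite_rhombi hL 0 n).countable

theorem countable_white (hL : L.Fat κ) : {w | ∃ z, L.IsWhiteVertex w z}.Countable := by
  refine (((countable_diamond hL).image L.w₁).union ((countable_diamond hL).image L.w₂)).mono ?_
  rintro w ⟨z, hz, h | h⟩
  · exact .inl ⟨z, hz, h.symm⟩
  · exact .inr ⟨z, hz, h.symm⟩

/-- Two black vertices are joined by a curve that avoids the white vertices and stays close to the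
segment between them. -/
theorem exists_curve (hL : L.Fat κ) (hx : x ∈ L.black) (hy : y ∈ L.black) :
    ∃ S : Set ℂ, IsPreconnected S ∧ x ∈ S ∧ y ∈ S ∧ (∀ p ∈ S, ∀ z, ¬ L.IsWhiteVertex p z) ∧
      ∀ p ∈ S, ∃ s : ℝ, 0 ≤ s ∧ s ≤ 1 ∧ ‖p - (x + s * (y - x))‖ ≤ δ := by
  have hδ := hL.delta_pos
  have hnw : ∀ v ∈ L.black, ∀ z, ¬ L.IsWhiteVertex v z := by
    rintro v ⟨z', hz'⟩ z hz
    exact absurd rfl (IsBlackVertex.ne (L := L) hz' hz)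
  by_cases hxy : x = y
  · subst hxy
    refine ⟨{x}, isPreconnected_singleton, rfl, rfl, ?_, ?_⟩
    · rintro p rfl z; exact hnw p hx z
    · rintro p rfl; exact ⟨0, le_rfl, zero_le_one, by simpa using hδ.le⟩
  have hv : y - x ≠ 0 := sub_ne_zero.2 (Ne.symm hxy)
  have hvn : 0 < ‖y - x‖ := norm_pos_iff.2 hv
  set W := {w | ∃ z, L.IsWhiteVertex w z} with hW
  -- The curve is a broken line whose apex is the midpoint displaced by `ε i (y - x)`. A white
  -- vertex can lie on it for at most one nonzero slope on each leg, so the forbidden values of `ε`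
  -- form a countable set.
  set B : Set ℝ := (fun w => ((w - x) / (y - x)).im / (2 * ((w - x) / (y - x)).re)) '' W ∪
    (fun w => - ((w - y) / (y - x)).im / (2 * ((w - y) / (y - x)).re)) '' W with hB
  have hBc : B.Countable := ((countable_white hL).image _).union ((countable_white hL).image _)
  obtain ⟨ε, hε, hεB⟩ := (hBc.dense_compl ℝ).inter_open_nonempty (Set.Ioo 0 (δ / ‖y - x‖))
    isOpen_Ioo (Set.nonempty_Ioo.2 (by positivity))
  have hε1 : ε * ‖y - x‖ < δ := by
    have := hε.2; rwa [lt_div_iff₀ hvn] at this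
  set m : ℂ := (x + y) / 2 + ε * Complex.I * (y - x) with hm
  have hsx : ∀ p ∈ segment ℝ x m, ∃ t : ℝ, 0 ≤ t ∧ t ≤ 1 ∧
      p = x + t * (1 / 2 + ε * Complex.I) * (y - x) := by
    intro p hp
    rw [segment_eq_image] at hp
    obtain ⟨t, ⟨h0, h1⟩, rfl⟩ := hp
    refine ⟨t, h0, h1, ?_⟩
    simp only [Complex.real_smul, hm]; push_cast; ring
  have hsy : ∀ p ∈ segment ℝ y m, ∃ t : ℝ, 0 ≤ t ∧ t ≤ 1 ∧
      p = y + t * (- 1 / 2 + ε * Complex.I) * (y - x) := by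
    intro p hp
    rw [segment_eq_image] at hp
    obtain ⟨t, ⟨h0, h1⟩, rfl⟩ := hp
    refine ⟨t, h0, h1, ?_⟩
    simp only [Complex.real_smul, hm]; push_cast; ring
  have hclose : ∀ t : ℝ, 0 ≤ t → t ≤ 1 → ‖(t * ε : ℂ) * Complex.I * (y - x)‖ ≤ δ := by
    intro t h0 h1
    rw [norm_mul, norm_mul, norm_mul, Complex.norm_I, mul_one, Complex.norm_real, Complex.norm_real,
      Real.norm_of_nonneg h0, Real.norm_of_nonneg hε.1.le]
    nlinarith [mul_pos hε.1 hvn]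
  refine ⟨segment ℝ x m ∪ segment ℝ y m, ?_, .inl (left_mem_segment _ _ _),
    .inr (left_mem_segment _ _ _), ?_, ?_⟩
  · exact (convex_segment x m).isPreconnected.union m (right_mem_segment _ _ _)
      (right_mem_segment _ _ _) (convex_segment y m).isPreconnected
  · rintro p (hp | hp) z hz
    · obtain ⟨t, h0, h1, hpt⟩ := hsx p hp
      have ht : t ≠ 0 := by
        rintro rfl
        simp only [Complex.ofReal_zero, zero_mul, add_zero] at hpt
        rw [hpt] at hz
        exact hnw x hx z hz
      refine hεB (.inl ⟨p, ⟨z, hz⟩, ?_⟩)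
      have : (p - x) / (y - x) = t * (1 / 2 + ε * Complex.I) := by
        rw [hpt]; field_simp; ring
      simp only [this]
      simp
      field_simp
    · obtain ⟨t, h0, h1, hpt⟩ := hsy p hp
      have ht : t ≠ 0 := by
        rintro rfl
        simp only [Complex.ofReal_zero, zero_mul, add_zero] at hpt
        rw [hpt] at hz
        exact hnw y hy z hz
      refine hεB (.inr ⟨p, ⟨z, hz⟩, ?_⟩)
      have : (p - y) / (y - x) = t * (((-1 / 2 : ℝ) : ℂ) + ε * Complex.I) := by
        rw [hpt]; push_cast; field_simp; ring
      simp only [this, Complex.re_ofReal_mul, Complex.im_ofReal_mul, Complex.add_re, Complex.add_im,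
        Complex.ofReal_re, Complex.ofReal_im, Complex.I_re, Complex.I_im]
      field_simp
      ring
  · rintro p (hp | hp)
    · obtain ⟨t, h0, h1, hpt⟩ := hsx p hp
      refine ⟨t / 2, by linarith, by linarith, ?_⟩
      have : p - (x + (t / 2 : ℝ) * (y - x)) = (t * ε : ℂ) * Complex.I * (y - x) := by
        rw [hpt]; push_cast; ring
      rw [this]; exact hclose t h0 h1
    · obtain ⟨t, h0, h1, hpt⟩ := hsy p hp
      refine ⟨1 - t / 2, by linarith, by linarith, ?_⟩
      have : p - (x + (1 - t / 2 : ℝ) * (y - x)) = (t * ε : ℂ) * Complex.I * (y - x) := by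
        rw [hpt]; push_cast; ring
      rw [this]; exact hclose t h0 h1

open Classical in
variable (L) in
/-- The rhombi near the segment between `x` and `y`. -/
noncomputable def tube (x y : ℂ) : Finset ℂ :=
  (L.rhombi x (‖y - x‖ + 3 * δ)).filter
    (fun z => ∃ s : ℝ, 0 ≤ s ∧ s ≤ 1 ∧ ‖z - (x + s * (y - x))‖ ≤ 2 * δ)

theorem mem_tube (hL : L.Fat κ) : z ∈ L.tube x y ↔
    z ∈ L.diamond ∧ ∃ s : ℝ, 0 ≤ s ∧ s ≤ 1 ∧ ‖z - (x + s * (y - x))‖ ≤ 2 * δ := by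
  simp only [tube, Finset.mem_filter, mem_rhombi hL]
  constructor
  · rintro ⟨⟨h1, -⟩, h2⟩; exact ⟨h1, h2⟩
  · rintro ⟨h1, s, h0, h2, h3⟩
    refine ⟨⟨h1, ?_⟩, s, h0, h2, h3⟩
    have h4 := norm_add_le (z - (x + s * (y - x))) (s * (y - x))
    have h5 : z - (x + s * (y - x)) + s * (y - x) = z - x := by ring
    rw [h5, norm_mul, Complex.norm_real, Real.norm_of_nonneg h0] at h4
    nlinarith [norm_nonneg (y - x), hL.delta_pos]

/-- Connectivity of `Γ` near a segment, phrased as an induction principle: points of the curve are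
within `δ` of the segment, and centres of the rhombi met are within `δ` of the curve. -/
theorem chain_tube (hL : L.Fat κ) (hx : x ∈ L.black) (hy : y ∈ L.black) (P : ℂ → Prop)
    (hP : ∀ z ∈ L.tube x y, (P (L.u₁ z) ↔ P (L.u₂ z))) (h : P x) : P y := by
  have hδ := hL.delta_pos
  obtain ⟨S, hS, hxS, hyS, hSw, hSd⟩ := exists_curve hL hx hy
  have hP' : ∀ z ∈ L.diamond, (S ∩ L.rhombus z).Nonempty → (P (L.u₁ z) ↔ P (L.u₂ z)) := by
    rintro z hz ⟨p, hpS, hpz⟩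
    refine hP z ((mem_tube hL).2 ⟨hz, ?_⟩)
    obtain ⟨s, h0, h1, hs⟩ := hSd p hpS
    refine ⟨s, h0, h1, ?_⟩
    have h2 := dist_center_le hz hpz
    have := norm_sub_le (p - (x + s * (y - x))) (p - z)
    rw [sub_sub_sub_cancel_left] at this
    linarith
  obtain ⟨z, hz⟩ := mem_black_iff.1 hx
  obtain ⟨z', hz'⟩ := mem_black_iff.1 hy
  have hm : (S ∩ L.rhombus z).Nonempty := ⟨x, hxS, hz.mem⟩
  have hm' : (S ∩ L.rhombus z').Nonempty := ⟨y, hyS, hz'.mem⟩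
  have hSr : ∀ p ∈ S, ‖p - x‖ < ‖y - x‖ + 2 * δ := by
    intro p hp
    obtain ⟨s, h0, h1, hs⟩ := hSd p hp
    have h4 := norm_add_le (p - (x + s * (y - x))) (s * (y - x))
    have h5 : p - (x + s * (y - x)) + s * (y - x) = p - x := by ring
    rw [h5, norm_mul, Complex.norm_real, Real.norm_of_nonneg h0] at h4
    nlinarith [norm_nonneg (y - x)]
  have h1 : P (L.u₁ z) := by
    rcases hz.2 with e | e
    · rwa [← e]
    · rw [hP' z hz.1 hm, ← e]; exact h
  have h2 := chain_of_isPreconnected hL hS hSr hSw P hP' hz.1 hz'.1 hm hm' h1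
  rcases hz'.2 with e | e
  · rwa [e]
  · rw [e, ← hP' z' hz'.1 hm']; exact h2

/-- The tube is covered by discs of radius `4 δ` around equally spaced points of the segment, less
than `δ` apart, and each disc holds a number of rhombi bounded in terms of `κ`. -/
theorem card_tube_le (hL : L.Fat κ) (x y : ℂ) :
    ((L.tube x y).card : ℝ) ≤ 400 / κ ^ 2 * (‖y - x‖ / δ + 2) := by
  classical
  have hδ := hL.delta_pos
  have hκ := hL.kappa_pos
  set n := ⌊‖y - x‖ / δ⌋₊ + 1 with hn
  have hn0 : (0 : ℝ) < n := by rw [hn]; positivity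
  have hlt : ‖y - x‖ / δ < n := by rw [hn]; push_cast; exact Nat.lt_floor_add_one _
  have hle : (n : ℝ) ≤ ‖y - x‖ / δ + 1 := by
    rw [hn]; push_cast
    linarith [Nat.floor_le (by positivity : 0 ≤ ‖y - x‖ / δ)]
  have hsub : L.tube x y ⊆
      (Finset.range (n + 1)).biUnion fun k => L.rhombi (x + (k / n : ℝ) * (y - x)) (4 * δ) := by
    intro z hz
    obtain ⟨hzd, s, h0, h1, hs⟩ := (mem_tube hL).1 hz
    rw [Finset.mem_biUnion]
    refine ⟨⌊s * n⌋₊, ?_, ?_⟩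
    · rw [Finset.mem_range, Nat.lt_succ_iff]
      refine Nat.floor_le_of_le ?_
      nlinarith
    · rw [mem_rhombi hL]
      refine ⟨hzd, ?_⟩
      have f1 := Nat.floor_le (by positivity : 0 ≤ s * n)
      have f2 := Nat.lt_floor_add_one (s * n)
      set k : ℝ := (⌊s * n⌋₊ : ℝ) with hk
      have e : z - (x + (k / n : ℝ) * (y - x)) =
          (z - (x + s * (y - x))) + (s - k / n : ℝ) * (y - x) := by push_cast; ring
      have a0 : 0 ≤ s - k / n := by
        rw [sub_nonneg, div_le_iff₀ hn0]; exact f1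
      have a1 : (s - k / n) * ‖y - x‖ ≤ δ := by
        have : s - k / n ≤ 1 / n := by
          rw [sub_le_iff_le_add, ← add_div, le_div_iff₀ hn0]; linarith
        calc _ ≤ 1 / n * ‖y - x‖ := by gcongr
          _ = ‖y - x‖ / n := by ring
          _ ≤ δ := by
            rw [div_le_iff₀ hn0]; rw [div_lt_iff₀ hδ] at hlt; linarith
      have h4 := norm_add_le (z - (x + s * (y - x))) ((s - k / n : ℝ) * (y - x))
      rw [norm_mul, Complex.norm_real, Real.norm_of_nonneg a0] at h4
      rw [e]
      linarith
  have h1 : (L.tube x y).card ≤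
      ∑ k ∈ Finset.range (n + 1), (L.rhombi (x + (k / n : ℝ) * (y - x)) (4 * δ)).card :=
    (Finset.card_le_card hsub).trans Finset.card_biUnion_le
  have h2 : ((L.tube x y).card : ℝ) ≤ ∑ k ∈ Finset.range (n + 1), (400 / κ ^ 2 : ℝ) := by
    refine (Nat.cast_le.2 h1).trans ?_
    push_cast
    refine Finset.sum_le_sum fun k _ => ?_
    refine (card_rhombi_le hL _ (by linarith)).trans_eq ?_
    field_simp; norm_num
  rw [Finset.sum_const, Finset.card_range, nsmul_eq_mul] at h2
  refine h2.trans ?_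
  rw [mul_comm]
  push_cast
  have : (n : ℝ) + 1 ≤ ‖y - x‖ / δ + 2 := by linarith
  gcongr

/-- If a function on the black vertices changes by at most `ε` along the edges near the segment
between `x` and `y`, then it changes by at most `ε` times the number of these edges. -/
theorem norm_sub_le_card_tube (hL : L.Fat κ) (hx : x ∈ L.black) (hy : y ∈ L.black)
    {E : Type*} [SeminormedAddCommGroup E] (G : ℂ → E) {ε : ℝ}
    (hG : ∀ z ∈ L.tube x y, ‖G (L.u₁ z) - G (L.u₂ z)‖ ≤ ε) :
    ‖G x - G y‖ ≤ (L.tube x y).card * ε := by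
  classical
  -- Passing to a path in the graph of tube edges removes repetitions, so its length is at most the
  -- number of rhombi in the tube.
  let Γ : SimpleGraph ℂ := SimpleGraph.fromRel fun a b => ∃ z ∈ L.tube x y, a = L.u₁ z ∧ b = L.u₂ z
  have hΓ : ∀ z ∈ L.tube x y, Γ.Adj (L.u₁ z) (L.u₂ z) := fun z hz =>
    ⟨u₁_ne_u₂ ((mem_tube hL).1 hz).1, .inl ⟨z, hz, rfl, rfl⟩⟩
  have hreach : Γ.Reachable x y := by
    refine chain_tube hL hx hy (fun v => Γ.Reachable x v) ?_ (SimpleGraph.Reachable.refl x)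
    intro z hz
    exact ⟨fun h => h.trans (hΓ z hz).reachable, fun h => h.trans (hΓ z hz).symm.reachable⟩
  obtain ⟨p⟩ := hreach
  have hstep : ∀ a b : ℂ, Γ.Adj a b → ‖G a - G b‖ ≤ ε := by
    rintro a b ⟨-, ⟨z, hz, rfl, rfl⟩ | ⟨z, hz, rfl, rfl⟩⟩
    · exact hG z hz
    · rw [norm_sub_rev]; exact hG z hz
  have hwalk : ∀ (a b : ℂ) (q : Γ.Walk a b), ‖G a - G b‖ ≤ q.length * ε := by
    intro a b q
    induction q with
    | nil => simp
    | @cons a c b h q ih =>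
      have := norm_add_le (G a - G c) (G c - G b)
      rw [sub_add_sub_cancel] at this
      rw [SimpleGraph.Walk.length_cons]
      push_cast
      linarith [hstep a c h]
  have hp : p.toPath.1.IsPath := p.toPath.2
  have hlen : p.toPath.1.length ≤ (L.tube x y).card := by
    rw [← SimpleGraph.Walk.length_edges, ← List.toFinset_card_of_nodup hp.isTrail.edges_nodup]
    refine le_trans (Finset.card_le_card ?_)
      (Finset.card_image_le (s := L.tube x y) (f := fun z => s(L.u₁ z, L.u₂ z)))
    intro e he
    rw [List.mem_toFinset] at he
    have hadj := SimpleGraph.Walk.edges_subset_edgeSet _ he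
    induction e with
    | _ a b =>
      rw [SimpleGraph.mem_edgeSet] at hadj
      rw [Finset.mem_image]
      rcases hadj with ⟨-, ⟨z, hz, rfl, rfl⟩ | ⟨z, hz, rfl, rfl⟩⟩
      · exact ⟨z, hz, rfl⟩
      · exact ⟨z, hz, Sym2.eq_swap⟩
  -- With an empty tube the hypothesis says nothing about the sign of `ε`, but then the path has
  -- length zero.
  rcases Finset.eq_empty_or_nonempty (L.tube x y) with hemp | ⟨z, hz⟩
  · have h0 : p.toPath.1.length = 0 := by rw [hemp] at hlen; simpa using hlen
    have := hwalk _ _ p.toPath.1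
    rw [h0] at this
    rw [hemp]; simpa using this
  · have hε : 0 ≤ ε := (norm_nonneg _).trans (hG z hz)
    refine (hwalk _ _ p.toPath.1).trans ?_
    exact mul_le_mul_of_nonneg_right (Nat.cast_le.2 hlen) hε

theorem norm_segment_sub_lt {c : ℂ} {r : ℝ} (hx : ‖x - c‖ < r) (hy : ‖y - c‖ < r) {s : ℝ}
    (h0 : 0 ≤ s) (h1 : s ≤ 1) : ‖x + s * (y - x) - c‖ < r := by
  have e : x + s * (y - x) - c = ((1 - s : ℝ) : ℂ) * (x - c) + (s : ℂ) * (y - c) := by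
    push_cast; ring
  have h := norm_add_le (((1 - s : ℝ) : ℂ) * (x - c)) ((s : ℂ) * (y - c))
  rw [norm_mul, norm_mul, Complex.norm_real, Complex.norm_real, Real.norm_of_nonneg h0,
    Real.norm_of_nonneg (sub_nonneg.2 h1)] at h
  rw [e]
  refine h.trans_lt ?_
  rcases h1.lt_or_eq with h1 | rfl
  · nlinarith
  · linarith

theorem norm_center_sub_lt_of_mem_tube (hL : L.Fat κ) {c : ℂ} {r : ℝ} (hx : ‖x - c‖ < r)
    (hy : ‖y - c‖ < r) (hz : z ∈ L.tube x y) : ‖z - c‖ < r + 2 * δ := by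
  obtain ⟨-, s, h0, h1, hs⟩ := (mem_tube hL).1 hz
  have h2 := norm_segment_sub_lt hx hy h0 h1
  have := norm_add_le (z - (x + s * (y - x))) (x + s * (y - x) - c)
  rw [sub_add_sub_cancel] at this
  linarith

theorem norm_sub_lt_of_mem_tube (hL : L.Fat κ) {c : ℂ} {r : ℝ} (hx : ‖x - c‖ < r)
    (hy : ‖y - c‖ < r) (hz : z ∈ L.tube x y) (hu : L.IsBlackVertex u z) :
    ‖u - c‖ < r + 3 * δ := by
  have h2 := norm_center_sub_lt_of_mem_tube hL hx hy hz
  have h1 := norm_sub_center_le hu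
  have := norm_add_le (u - z) (z - c)
  rw [sub_add_sub_cancel] at this
  linarith

/-- All black vertices well inside of a disc are interior vertices of the discrete disc. -/
theorem mem_discInt (hL : L.Fat κ) {u₀ : ℂ} (hu₀ : u₀ ∈ L.black) {R : ℝ} (hu : u ∈ L.black)
    (h : ‖u - u₀‖ < R - 3 * δ) : u ∈ L.discInt u₀ R := by
  refine chain_tube hL hu₀ hu (· ∈ L.discInt u₀ R) ?_ Relation.ReflTransGen.refl
  intro z hz
  have hzd := ((mem_tube hL).1 hz).1
  have hR : 0 < R - 3 * δ := (norm_nonneg _).trans_lt h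
  have hb : ∀ v, L.IsBlackVertex v z → v ∈ Metric.ball u₀ R := by
    intro v hv
    have := norm_sub_lt_of_mem_tube hL (c := u₀) (by simpa using hR) h hz hv
    rw [Metric.mem_ball, dist_eq_norm]
    linarith
  have h1 := hb _ (isBlackVertex_u₁ hzd)
  have h2 := hb _ (isBlackVertex_u₂ hzd)
  constructor
  · intro hm
    exact Relation.ReflTransGen.tail hm ⟨⟨z, hzd, .inl ⟨rfl, rfl⟩⟩, h1, h2⟩
  · intro hm
    exact Relation.ReflTransGen.tail hm ⟨⟨z, hzd, .inr ⟨rfl, rfl⟩⟩, h2, h1⟩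

/-! ### Winding angles, and exactness of closed forms on a disc. -/

/-- If the quotient were real and at most zero, `w` would be a convex combination of `a` and `b`.
Thus the angle under which a segment is seen varies continuously off the segment. -/
theorem div_sub_mem_slitPlane {a b w : ℂ} (h : w ∉ segment ℝ a b) :
    (b - w) / (a - w) ∈ Complex.slitPlane := by
  by_contra hn
  rw [Complex.mem_slitPlane_iff] at hn
  push Not at hn
  obtain ⟨hre, him⟩ := hn
  have haw : a - w ≠ 0 := by
    intro h0
    exact h (by rw [sub_eq_zero.1 h0]; exact left_mem_segment _ _ _)
  set k := -((b - w) / (a - w)).re with hk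
  have hk0 : 0 ≤ k := by linarith
  have hq : (b - w) / (a - w) = ((-k : ℝ) : ℂ) := by
    apply Complex.ext
    · simp [hk]
    · simpa using him
  rw [div_eq_iff haw] at hq
  push_cast at hq
  apply h
  rw [segment_eq_image]
  have h1 : (1 + k) ≠ 0 := by positivity
  have h1' : (1 + k : ℂ) ≠ 0 := by exact_mod_cast h1
  refine ⟨1 / (1 + k), ⟨by positivity, by rw [div_le_one (by positivity)]; linarith⟩, ?_⟩
  simp only [Complex.real_smul]
  push_cast
  field_simp
  linear_combination hq

/-- A continuous function with values in `2 π ℤ` cannot take the value `π`, so it cannot move away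
from zero. -/
theorem eq_zero_of_continuousOn_of_angle {G : ℝ → ℝ} (hc : ContinuousOn G (Set.Icc 0 1))
    (h0 : G 0 = 0) (hG : ∀ t ∈ Set.Icc (0 : ℝ) 1, ((G t : ℝ) : Real.Angle) = 0) : G 1 = 0 := by
  by_contra hne
  obtain ⟨n, hn⟩ := Real.Angle.coe_eq_zero_iff.1 (hG 1 (by simp))
  rw [zsmul_eq_mul] at hn
  have hn0 : n ≠ 0 := by rintro rfl; simp at hn; exact hne hn.symm
  have hpi := Real.pi_pos
  have h1 : 2 * Real.pi ≤ |G 1| := by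
    rw [← hn, abs_mul, abs_of_pos (by positivity : 0 < 2 * Real.pi)]
    have : (1 : ℝ) ≤ |(n : ℝ)| := by exact_mod_cast Int.one_le_abs hn0
    nlinarith
  obtain ⟨t, ht, htpi⟩ := intermediate_value_Icc zero_le_one hc.abs
    (show Real.pi ∈ Set.Icc |G 0| |G 1| from ⟨by rw [h0, abs_zero]; exact hpi.le, by linarith⟩)
  obtain ⟨k, hk⟩ := Real.Angle.coe_eq_zero_iff.1 (hG t ht)
  rw [zsmul_eq_mul] at hk
  simp only at htpi
  rw [← hk, abs_mul, abs_of_pos (by positivity : 0 < 2 * Real.pi)] at htpi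
  have h2 : |(k : ℝ)| * 2 = 1 := by
    have : (|(k : ℝ)| * 2 - 1) * Real.pi = 0 := by linarith
    rcases mul_eq_zero.1 this with h | h
    · linarith
    · exact absurd h hpi.ne'
  have h3 : |k| * 2 = 1 := by exact_mod_cast h2
  omega

/-- Both sides agree modulo `2 π` and start equal at `y`. As the endpoint slides along the segment
to `y'`, every argument stays continuous: neither `w₁` nor `w₂` is crossed, and `[w₁, w₂]` is never
met. -/
theorem arg_jump_of_disjoint {w₁ w₂ y y' : ℂ} (h : Disjoint (segment ℝ y y') (segment ℝ w₁ w₂)) :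
    Complex.arg ((y' - w₁) / (y - w₁)) - Complex.arg ((y' - w₂) / (y - w₂)) =
      Complex.arg ((y' - w₁) / (y' - w₂)) - Complex.arg ((y - w₁) / (y - w₂)) := by
  have hy : ∀ t ∈ Set.Icc (0 : ℝ) 1, y + t * (y' - y) ∈ segment ℝ y y' := by
    intro t ht
    rw [segment_eq_image']
    exact ⟨t, ht, by simp⟩
  have hd : ∀ p ∈ segment ℝ y y', p ∉ segment ℝ w₁ w₂ := fun p hp hp' =>
    Set.disjoint_left.1 h hp hp'
  have hw₁ : w₁ ∉ segment ℝ y y' := fun hm => hd _ hm (left_mem_segment _ _ _)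
  have hw₂ : w₂ ∉ segment ℝ y y' := fun hm => hd _ hm (right_mem_segment _ _ _)
  have hne : ∀ w, w ∉ segment ℝ y y' → ∀ p ∈ segment ℝ y y', p - w ≠ 0 := by
    intro w hw p hp h0
    rw [sub_eq_zero.1 h0] at hp
    exact hw hp
  have hsub : ∀ p ∈ segment ℝ y y', segment ℝ y p ⊆ segment ℝ y y' := fun p hp =>
    (convex_segment y y').segment_subset (left_mem_segment _ _ _) hp
  have hyl : y ∈ segment ℝ y y' := left_mem_segment _ _ _
  set γ : ℝ → ℂ := fun t => y + t * (y' - y) with hγ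
  have hγc : Continuous γ := by fun_prop
  set G : ℝ → ℝ := fun t => Complex.arg ((γ t - w₁) / (y - w₁)) - Complex.arg ((γ t - w₂) / (y - w₂))
    - (Complex.arg ((γ t - w₁) / (γ t - w₂)) - Complex.arg ((y - w₁) / (y - w₂))) with hGdef
  have hargc : ∀ (f : ℝ → ℂ), ContinuousOn f (Set.Icc 0 1) →
      (∀ t ∈ Set.Icc (0 : ℝ) 1, f t ∈ Complex.slitPlane) →
      ContinuousOn (fun t => Complex.arg (f t)) (Set.Icc 0 1) := fun f hf hs t ht =>
    (Complex.continuousAt_arg (hs t ht)).comp_continuousWithinAt (hf t ht)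
  have key : G 1 = 0 := by
    refine eq_zero_of_continuousOn_of_angle ?_ ?_ ?_
    · refine ContinuousOn.sub (ContinuousOn.sub ?_ ?_) (ContinuousOn.sub ?_ continuousOn_const)
      · refine hargc _ ?_ fun t ht => div_sub_mem_slitPlane fun hm => hw₁ (hsub _ (hy t ht) hm)
        exact ((hγc.sub continuous_const).div_const _).continuousOn
      · refine hargc _ ?_ fun t ht => div_sub_mem_slitPlane fun hm => hw₂ (hsub _ (hy t ht) hm)
        exact ((hγc.sub continuous_const).div_const _).continuousOn
      · refine hargc _ ?_ fun t ht => ?_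
        · exact (hγc.sub continuous_const).continuousOn.div (hγc.sub continuous_const).continuousOn
            fun t ht => hne _ hw₂ _ (hy t ht)
        · have := div_sub_mem_slitPlane (a := w₂) (b := w₁) (w := γ t)
            (by rw [segment_symm]; exact hd _ (hy t ht))
          rwa [← neg_sub, ← neg_sub (γ t) w₂, neg_div_neg_eq] at this
    · simp only [hGdef, hγ, Complex.ofReal_zero, zero_mul, add_zero]
      rw [div_self (hne _ hw₁ _ hyl), div_self (hne _ hw₂ _ hyl)]
      ring
    · intro t ht
      have n1 := hne _ hw₁ _ (hy t ht)
      have n2 := hne _ hw₂ _ (hy t ht)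
      have n3 := hne _ hw₁ _ hyl
      have n4 := hne _ hw₂ _ hyl
      simp only [hGdef, Real.Angle.coe_sub]
      rw [Complex.arg_div_coe_angle n1 n3, Complex.arg_div_coe_angle n2 n4,
        Complex.arg_div_coe_angle n1 n2, Complex.arg_div_coe_angle n3 n4]
      abel
  simp only [hGdef, hγ, Complex.ofReal_one, one_mul, add_sub_cancel] at key
  linarith

theorem arg_div_of_re_pos {A B : ℂ} (hA : 0 < A.re) (hB : 0 < B.re) :
    Complex.arg (A / B) = Complex.arg A - Complex.arg B := by
  have hA0 : A ≠ 0 := by rintro rfl; simp at hA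
  have hB0 : B ≠ 0 := by rintro rfl; simp at hB
  have h1 := abs_lt.1 (Complex.abs_arg_lt_pi_div_two_iff.2 (.inl hA))
  have h2 := abs_lt.1 (Complex.abs_arg_lt_pi_div_two_iff.2 (.inl hB))
  have h3 := Complex.arg_div_coe_angle hA0 hB0
  rw [← Real.Angle.coe_sub] at h3
  have h4 := congrArg Real.Angle.toReal h3
  rwa [Complex.arg_coe_angle_toReal_eq_arg, Real.Angle.toReal_coe_eq_self_iff.2
    ⟨by linarith, by linarith⟩] at h4

/-- A common point lies on a common side. The white diagonal of `z` meets the sides of `z` only in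
white vertices, whereas the black diagonal of `z'` contains no white vertex of `z'`. -/
theorem disjoint_diagonals (hz : z ∈ L.diamond) (hz' : z' ∈ L.diamond) (hne : z ≠ z') :
    Disjoint (segment ℝ (L.u₁ z') (L.u₂ z')) (segment ℝ (L.w₁ z) (L.w₂ z)) := by
  rw [Set.disjoint_left]
  intro p hp' hp
  have hb := isBlackVertex_u₁ hz
  have hb' := isBlackVertex_u₁ hz'
  rw [segment_eq_image] at hp hp'
  obtain ⟨s, ⟨hs0, hs1⟩, hs⟩ := hp
  obtain ⟨s', ⟨hs0', hs1'⟩, hs'⟩ := hp'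
  simp only [Complex.real_smul] at hs hs'
  have e : p = L.u₁ z + (1 - s : ℝ) * (L.next (L.u₁ z) z - L.u₁ z) +
      s * (L.prev (L.u₁ z) z - L.u₁ z) := by
    rw [next_u₁, prev_u₁, ← hs]; push_cast; ring
  have e' : p = L.u₁ z' + s' * (L.next (L.u₁ z') z' - L.u₁ z') +
      s' * (L.prev (L.u₁ z') z' - L.u₁ z') := by
    rw [next_u₁, prev_u₁, ← hs', u₂_eq hz']; push_cast; ring
  have hm : p ∈ L.rhombus z :=
    hb.mem_rhombus.2 ⟨1 - s, s, ⟨by linarith, by linarith⟩, ⟨hs0, hs1⟩, e⟩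
  have hm' : p ∈ L.rhombus z' := hb'.mem_rhombus.2 ⟨s', s', ⟨hs0', hs1'⟩, ⟨hs0', hs1'⟩, e'⟩
  obtain ⟨u, w, t, hu, hw, ht0, ht1, hpt, -, hw'⟩ := exists_common_side hz hz' hne hm hm'
  have ht : t = 1 := by
    rcases hb.side_not_interior hu hw (hpt.symm.trans e) with h | h | h | h <;>
      linarith [h.1, h.2.1]
  subst ht
  have hw' := hw' one_pos
  have hpw : (1 - ((1 : ℝ) : ℂ)) * L.u₁ z' + ((1 : ℝ) : ℂ) * w = L.u₁ z' +
      s' * (L.next (L.u₁ z') z' - L.u₁ z') + s' * (L.prev (L.u₁ z') z' - L.u₁ z') := by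
    rw [← e', hpt]; push_cast; ring
  rcases hb'.side_not_interior hb' hw' hpw with h | h | h | h <;> linarith [h.1, h.2.1]

/-- Crossing the white diagonal of the same rhombus moves the quotient of the distances to `w₁` and
`w₂` across the cut of `arg`. The defect of one full turn, signed by the direction, is what detects
a traversal of the edge. -/
theorem arg_jump_self (hz : z ∈ L.diamond) :
    Complex.arg ((L.u₂ z - L.w₁ z) / (L.u₁ z - L.w₁ z)) -
        Complex.arg ((L.u₂ z - L.w₂ z) / (L.u₁ z - L.w₂ z)) =
      Complex.arg ((L.u₂ z - L.w₁ z) / (L.u₂ z - L.w₂ z)) -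
        Complex.arg ((L.u₁ z - L.w₁ z) / (L.u₁ z - L.w₂ z)) - 2 * Real.pi ∧
    Complex.arg ((L.u₁ z - L.w₁ z) / (L.u₂ z - L.w₁ z)) -
        Complex.arg ((L.u₁ z - L.w₂ z) / (L.u₂ z - L.w₂ z)) =
      Complex.arg ((L.u₁ z - L.w₁ z) / (L.u₁ z - L.w₂ z)) -
        Complex.arg ((L.u₂ z - L.w₁ z) / (L.u₂ z - L.w₂ z)) + 2 * Real.pi := by
  have hA := area_pos hz
  unfold area at hA
  have h1 : L.u₂ z - L.w₁ z = L.w₂ z - L.u₁ z := by linear_combination u₂_eq hz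
  have h2 : L.u₂ z - L.w₂ z = L.w₁ z - L.u₁ z := by linear_combination u₂_eq hz
  have h3 : L.u₁ z - L.w₁ z = -(L.w₁ z - L.u₁ z) := by ring
  have h4 : L.u₁ z - L.w₂ z = -(L.w₂ z - L.u₁ z) := by ring
  rw [h1, h2, h3, h4]
  generalize L.w₁ z - L.u₁ z = e at *
  generalize L.w₂ z - L.u₁ z = f at *
  have he : e ≠ 0 := by rintro rfl; simp [cross] at hA
  have hf : f ≠ 0 := by rintro rfl; simp [cross] at hA
  set q := f / e with hq
  have him : 0 < q.im := by
    have hn : 0 < Complex.normSq e := Complex.normSq_pos.2 he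
    rw [hq, Complex.div_im, ← sub_div]
    refine div_pos ?_ hn
    simp only [cross] at hA
    linarith
  have him' : q⁻¹.im < 0 := by
    rw [Complex.inv_im]
    have : 0 < Complex.normSq q := Complex.normSq_pos.2 (by rintro h; rw [h] at him; simp at him)
    exact div_neg_of_neg_of_pos (by linarith) this
  have hi : e / f = q⁻¹ := by rw [hq, inv_div]
  have hinv : Complex.arg q⁻¹ = - Complex.arg q := by
    rw [Complex.arg_inv, if_neg]
    intro h
    have := (Complex.arg_eq_pi_iff.1 h).2
    linarith
  have r1 : f / -e = -q := by rw [hq]; ring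
  have r2 : e / -f = -q⁻¹ := by rw [← hi]; ring
  have r3 : -e / -f = q⁻¹ := by rw [← hi, neg_div_neg_eq]
  have r4 : -e / f = -q⁻¹ := by rw [← hi]; ring
  have r5 : -f / e = -q := by rw [hq]; ring
  rw [r1, r2, r3, r4, r5, Complex.arg_neg_eq_arg_sub_pi_of_im_pos him,
    Complex.arg_neg_eq_arg_add_pi_of_im_neg him', hinv]
  constructor <;> ring

theorem mem_starFinset_white (hw : L.IsWhiteVertex w z) :
    z' ∈ L.starFinset w ↔ L.IsWhiteVertex w z' := by
  simp only [starFinset, Set.Finite.mem_toFinset, Set.mem_ofPred_eq, IsWhiteVertex]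
  constructor
  · rintro ⟨hz, h⟩
    refine ⟨hz, ?_⟩
    simp only [Set.mem_insert_iff, Set.mem_singleton_iff] at h
    rcases h with h | h | h | h
    · exact absurd h.symm ((isBlackVertex_u₁ hz).ne hw)
    · exact .inl h
    · exact absurd h.symm ((isBlackVertex_u₂ hz).ne hw)
    · exact .inr h
  · rintro ⟨hz, rfl | rfl⟩ <;> exact ⟨hz, by simp⟩

theorem exists_sum_whites_star (hL : L.Fat κ) (x : ℂ) (r : ℝ) : ∃ W : Finset ℂ,
    (∀ w ∈ W, ‖w - x‖ < r ∧ ∃ z, L.IsWhiteVertex w z) ∧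
    ∀ T : ℂ → ℂ → ℝ, (∀ w z, r ≤ ‖w - x‖ → T w z = 0) →
      ∑ w ∈ W, ∑ z ∈ L.starFinset w, T w z =
        ∑ z ∈ L.rhombi x (r + 2 * δ), (T (L.w₁ z) z + T (L.w₂ z) z) := by
  classical
  have hδ := hL.delta_pos
  refine ⟨((L.rhombi x (r + 2 * δ)).image L.w₁ ∪ (L.rhombi x (r + 2 * δ)).image L.w₂).filter
    (fun w => ‖w - x‖ < r), ?_, ?_⟩
  · intro w hw
    simp only [Finset.mem_filter, Finset.mem_union, Finset.mem_image, mem_rhombi hL] at hw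
    obtain ⟨⟨z, hz, rfl⟩ | ⟨z, hz, rfl⟩, h⟩ := hw
    · exact ⟨h, z, isWhiteVertex_w₁ hz.1⟩
    · exact ⟨h, z, isWhiteVertex_w₂ hz.1⟩
  intro T hT
  rw [Finset.sum_comm' (t' := L.rhombi x (r + 2 * δ))
    (s' := fun z => ({L.w₁ z, L.w₂ z} : Finset ℂ).filter (fun u => ‖u - x‖ < r))]
  · refine Finset.sum_congr rfl fun z hz => ?_
    have hz := ((mem_rhombi hL).1 hz).1
    rw [Finset.sum_filter, Finset.sum_pair (L.white_ne z hz)]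
    congr 1
    · split_ifs with h
      · rfl
      · exact (hT _ _ (not_lt.1 h)).symm
    · split_ifs with h
      · rfl
      · exact (hT _ _ (not_lt.1 h)).symm
  · intro w z
    have hin : ∀ z, L.IsWhiteVertex w z → ‖w - x‖ < r → z ∈ L.rhombi x (r + 2 * δ) := by
      intro z hz hr
      rw [mem_rhombi hL]
      refine ⟨hz.1, ?_⟩
      have h1 := dist_center_le hz.1 hz.mem
      have := norm_sub_le (w - x) (w - z)
      rw [sub_sub_sub_cancel_left] at this
      linarith
    constructor
    · rintro ⟨hw, hz⟩
      rw [Finset.mem_filter] at hw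
      obtain ⟨hw, hr⟩ := hw
      have hw' : ∃ z, L.IsWhiteVertex w z := by
        simp only [Finset.mem_union, Finset.mem_image, mem_rhombi hL] at hw
        obtain ⟨y, hy, rfl⟩ | ⟨y, hy, rfl⟩ := hw
        · exact ⟨y, isWhiteVertex_w₁ hy.1⟩
        · exact ⟨y, isWhiteVertex_w₂ hy.1⟩
      obtain ⟨z₀, hz₀⟩ := hw'
      have hwz := (mem_starFinset_white hz₀).1 hz
      refine ⟨?_, hin z hwz hr⟩
      simpa [hr] using hwz.2
    · rintro ⟨hw, hz⟩
      simp only [Finset.mem_filter, Finset.mem_insert, Finset.mem_singleton] at hw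
      have hzd := ((mem_rhombi hL).1 hz).1
      have hwz : L.IsWhiteVertex w z := ⟨hzd, hw.1⟩
      refine ⟨?_, (mem_starFinset_white hwz).2 hwz⟩
      simp only [Finset.mem_filter, Finset.mem_union, Finset.mem_image]
      refine ⟨?_, hw.2⟩
      rcases hw.1 with h | h
      · exact .inl ⟨z, hz, h.symm⟩
      · exact .inr ⟨z, hz, h.symm⟩

variable (L) in
/-- `s` is the sum of the edge increments `a` along some walk from `b` to `u` inside `B(x, r)`. -/
inductive WalkSum (x : ℂ) (r : ℝ) (a : ℂ → ℝ) (b : ℂ) : ℂ → ℝ → Prop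
  | base : WalkSum x r a b b 0
  | fwd (z : ℂ) (s : ℝ) : z ∈ L.diamond → ‖L.u₁ z - x‖ < r → ‖L.u₂ z - x‖ < r →
      WalkSum x r a b (L.u₁ z) s → WalkSum x r a b (L.u₂ z) (s + a z)
  | bwd (z : ℂ) (s : ℝ) : z ∈ L.diamond → ‖L.u₁ z - x‖ < r → ‖L.u₂ z - x‖ < r →
      WalkSum x r a b (L.u₂ z) s → WalkSum x r a b (L.u₁ z) (s - a z)

variable (L) in
/-- The angle under which the white diagonal of `z` is seen from `u`. -/
noncomputable def viewAngle (z u : ℂ) : ℝ := Complex.arg ((u - L.w₁ z) / (u - L.w₂ z))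

/-- The winding angles `ν` of a walk around the white vertices. -/
theorem WalkSum.exists_winding (hL : L.Fat κ) {r s : ℝ} {a : ℂ → ℝ} {b : ℂ}
    (h : L.WalkSum x r a b u s) : ∃ ν m : ℂ → ℝ,
      s = ∑ z ∈ L.rhombi x (r + 2 * δ), m z * a z ∧
      (∀ z ∈ L.diamond, ν (L.w₁ z) - ν (L.w₂ z) =
        L.viewAngle z u - L.viewAngle z b - 2 * Real.pi * m z) ∧
      (∀ w, r ≤ ‖w - x‖ → ν w = Complex.arg ((u - w) / (x - w)) - Complex.arg ((b - w) / (x - w))) := by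
  classical
  have hδ := hL.delta_pos
  have hZ : ∀ z ∈ L.diamond, ‖L.u₁ z - x‖ < r → z ∈ L.rhombi x (r + 2 * δ) := by
    intro z hz hr
    rw [mem_rhombi hL]
    refine ⟨hz, ?_⟩
    have h1 := norm_sub_center_le (isBlackVertex_u₁ hz)
    have := norm_sub_le (L.u₁ z - x) (L.u₁ z - z)
    rw [sub_sub_sub_cancel_left] at this
    linarith
  have hsum : ∀ (m : ℂ → ℝ) (c : ℝ), ∀ z ∈ L.rhombi x (r + 2 * δ),
      ∑ y ∈ L.rhombi x (r + 2 * δ), (m y + if y = z then c else 0) * a y =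
        ∑ y ∈ L.rhombi x (r + 2 * δ), m y * a y + c * a z := by
    intro m c z hz
    simp only [add_mul, Finset.sum_add_distrib, ite_mul, zero_mul]
    rw [Finset.sum_ite_eq' _ z, if_pos hz]
  -- From a point `w` outside the disc, the whole disc is seen inside a half-plane. Arguments are
  -- then additive, so the winding angle around `w` depends only on the ends of the walk.
  have hfar : ∀ w y y' : ℂ, r ≤ ‖w - x‖ → ‖y - x‖ < r → ‖y' - x‖ < r →
      Complex.arg ((y' - w) / (y - w)) =
        Complex.arg ((y' - w) / (x - w)) - Complex.arg ((y - w) / (x - w)) := by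
    intro w y y' hw hy hy'
    have hxw : x - w ≠ 0 := by
      intro h0
      rw [norm_sub_rev, h0, norm_zero] at hw
      linarith [norm_nonneg (y - x)]
    have hre : ∀ y : ℂ, ‖y - x‖ < r → 0 < ((y - w) / (x - w)).re := by
      intro y hy
      have e : (y - w) / (x - w) = 1 + (y - x) / (x - w) := by field_simp; ring
      have hlt : ‖(y - x) / (x - w)‖ < 1 := by
        rw [norm_div, div_lt_one (norm_pos_iff.2 hxw), norm_sub_rev x w]; linarith
      have := (abs_le.1 (Complex.abs_re_le_norm ((y - x) / (x - w)))).1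
      rw [e, Complex.add_re, Complex.one_re]
      linarith
    rw [← arg_div_of_re_pos (hre y' hy') (hre y hy), div_div_div_cancel_right₀ hxw]
  induction h with
  | base =>
    refine ⟨0, 0, by simp, by simp, ?_⟩
    intro w _; simp
  | fwd z s hz h1 h2 _ ih =>
    obtain ⟨ν, m, hs, hν, hw⟩ := ih
    -- `ν` accumulates the angle swept around each `w`, and `m` counts signed traversals of each
    -- edge. Only the traversed rhombus sees the `2 π` defect.
    refine ⟨fun w => ν w + Complex.arg ((L.u₂ z - w) / (L.u₁ z - w)),
      fun y => m y + if y = z then 1 else 0, ?_, ?_, ?_⟩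
    · rw [hsum m 1 z (hZ z hz h1), hs, one_mul]
    · intro y hy
      have hνy := hν y hy
      by_cases hyz : y = z
      · subst hyz
        have := (arg_jump_self hy).1
        simp only [if_true, viewAngle] at hνy ⊢
        linarith
      · have := arg_jump_of_disjoint (disjoint_diagonals hy hz hyz)
        simp only [if_neg hyz, viewAngle] at hνy ⊢
        linarith
    · intro w hrw
      simp only
      rw [hw w hrw, hfar w _ _ hrw h1 h2]; ring
  | bwd z s hz h1 h2 _ ih =>
    obtain ⟨ν, m, hs, hν, hw⟩ := ih
    refine ⟨fun w => ν w + Complex.arg ((L.u₁ z - w) / (L.u₂ z - w)),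
      fun y => m y + if y = z then -1 else 0, ?_, ?_, ?_⟩
    · rw [hsum m (-1) z (hZ z hz h1), hs]; ring
    · intro y hy
      have hνy := hν y hy
      by_cases hyz : y = z
      · subst hyz
        have := (arg_jump_self hy).2
        simp only [if_true, viewAngle] at hνy ⊢
        linarith
      · have hdis := disjoint_diagonals hy hz hyz
        rw [segment_symm] at hdis
        have := arg_jump_of_disjoint hdis
        simp only [if_neg hyz, viewAngle] at hνy ⊢
        linarith
    · intro w hrw
      simp only
      rw [hw w hrw, hfar w _ _ hrw h2 h1]; ring

open Classical in
-- Discrete Stokes: multiply the closedness relation at each white vertex by the difference of the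
-- two winding angles, which vanishes outside the disc, and sum by parts. Across a white diagonal
-- this difference changes by `-2 π` times the difference of the traversal counts, so the result is
-- `-2 π (s - s') = 0`. No planar topology beyond arguments is needed.
theorem WalkSum.unique (hL : L.Fat κ) {r s s' : ℝ} {a : ℂ → ℝ} {b : ℂ}
    (hclosed : ∀ w z, L.IsWhiteVertex w z → ‖w - x‖ < r →
      ∑ z ∈ L.starFinset w, (if w = L.w₁ z then a z else - a z) = 0)
    (h : L.WalkSum x r a b u s) (h' : L.WalkSum x r a b u s') : s = s' := by
  obtain ⟨ν, m, hs, hν, hw⟩ := h.exists_winding hL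
  obtain ⟨ν', m', hs', hν', hw'⟩ := h'.exists_winding hL
  obtain ⟨W, hW, hWsum⟩ := exists_sum_whites_star hL x r
  have h0 := hWsum (fun w z => (if w = L.w₁ z then a z else - a z) * (ν w - ν' w)) (by
    intro w z hr
    rw [hw w hr, hw' w hr, sub_self, mul_zero])
  have hz : ∑ w ∈ W, ∑ z ∈ L.starFinset w,
      (if w = L.w₁ z then a z else - a z) * (ν w - ν' w) = 0 := by
    refine Finset.sum_eq_zero fun w hwW => ?_
    obtain ⟨hr, z, hz⟩ := hW w hwW
    rw [← Finset.sum_mul, hclosed w z hz hr, zero_mul]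
  rw [hz] at h0
  have h1 : ∑ z ∈ L.rhombi x (r + 2 * δ), (m z * a z - m' z * a z) * (-(2 * Real.pi)) = 0 := by
    rw [h0]
    refine Finset.sum_congr rfl fun z hzZ => ?_
    have hzd := ((mem_rhombi hL).1 hzZ).1
    have e1 := hν z hzd
    have e2 := hν' z hzd
    rw [if_pos rfl, if_neg (L.white_ne z hzd).symm]
    linear_combination a z * (e2 - e1)
  rw [← Finset.sum_mul, Finset.sum_sub_distrib, ← hs, ← hs'] at h1
  have hpi := Real.pi_pos
  rcases mul_eq_zero.1 h1 with h | h
  · linarith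
  · linarith

open Classical in
/-- A closed form on a disc is exact. -/
theorem exists_potential (hL : L.Fat κ) (x : ℂ) (r : ℝ) (a : ℂ → ℝ) {b : ℂ} (hb : b ∈ L.black)
    (hbr : ‖b - x‖ < r - 3 * δ)
    (hclosed : ∀ w z, L.IsWhiteVertex w z → ‖w - x‖ < r →
      ∑ z ∈ L.starFinset w, (if w = L.w₁ z then a z else - a z) = 0) :
    ∃ H : ℂ → ℝ, ∀ z ∈ L.diamond, ‖L.u₁ z - x‖ < r - 3 * δ → ‖L.u₂ z - x‖ < r - 3 * δ →
      H (L.u₂ z) - H (L.u₁ z) = a z := by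
  have hδ := hL.delta_pos
  have hex : ∀ u ∈ L.black, ‖u - x‖ < r - 3 * δ → ∃ s, L.WalkSum x r a b u s := by
    intro u hu hur
    refine chain_tube hL hb hu (fun v => ∃ s, L.WalkSum x r a b v s) ?_ ⟨0, .base⟩
    intro z hz
    have hzd := ((mem_tube hL).1 hz).1
    have h1 := norm_sub_lt_of_mem_tube hL hbr hur hz (isBlackVertex_u₁ hzd)
    have h2 := norm_sub_lt_of_mem_tube hL hbr hur hz (isBlackVertex_u₂ hzd)
    rw [sub_add_cancel] at h1 h2
    exact ⟨fun ⟨s, hs⟩ => ⟨_, .fwd z s hzd h1 h2 hs⟩, fun ⟨s, hs⟩ => ⟨_, .bwd z s hzd h1 h2 hs⟩⟩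
  refine ⟨fun u => if h : ∃ s, L.WalkSum x r a b u s then h.choose else 0, ?_⟩
  intro z hz h1 h2
  have e1 := hex _ (isBlackVertex_u₁ hz).mem_black h1
  have e2 := hex _ (isBlackVertex_u₂ hz).mem_black h2
  simp only [dif_pos e1, dif_pos e2]
  have := WalkSum.unique hL hclosed e2.choose_spec
    (.fwd z _ hz (by linarith) (by linarith) e1.choose_spec)
  linarith

/-! ### The bump function, its Taylor expansion and its discrete Laplacian. -/

/-- The radial bump function `(1 - |x|² / s²)₊ ^ k`. -/
noncomputable def bump (k : ℕ) (s : ℝ) (x : ℂ) : ℝ := (max (1 - ‖x‖ ^ 2 / s ^ 2) 0) ^ k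

/-- The gradient term of the Taylor expansion of `bump`. -/
noncomputable def bumpG (k : ℕ) (s : ℝ) (x : ℂ) : ℂ :=
  ((-2 * k * (max (1 - ‖x‖ ^ 2 / s ^ 2) 0) ^ (k - 1) / s ^ 2 : ℝ) : ℂ) * conj x

/-- A quarter of the Laplacian of `bump`. -/
noncomputable def bumpB (k : ℕ) (s : ℝ) (x : ℂ) : ℝ :=
  k * (-(max (1 - ‖x‖ ^ 2 / s ^ 2) 0) ^ (k - 1) / s ^ 2 +
    (k - 1) * (max (1 - ‖x‖ ^ 2 / s ^ 2) 0) ^ (k - 2) * ‖x‖ ^ 2 / s ^ 4)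

/-- The trace-free second order term of the Taylor expansion of `bump`. -/
noncomputable def bumpA (k : ℕ) (s : ℝ) (x : ℂ) : ℂ :=
  ((k * (k - 1) * (max (1 - ‖x‖ ^ 2 / s ^ 2) 0) ^ (k - 2) / s ^ 4 : ℝ) : ℂ) * conj x ^ 2

/-- Cubing the positive part makes the second derivative Lipschitz, so the remainder is cubic even
across the kink at zero; this is why the exponents `3` and `4` are used. -/
theorem taylor_posPart_cube (t h : ℝ) :
    |max (t + h) 0 ^ 3 - max t 0 ^ 3 - 3 * max t 0 ^ 2 * h - 3 * max t 0 * h ^ 2| ≤ 2 * |h| ^ 3 := by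
  rcases le_total 0 t with ht | ht <;> rcases le_total 0 (t + h) with hth | hth
  · rw [max_eq_left ht, max_eq_left hth]
    have : (t + h) ^ 3 - t ^ 3 - 3 * t ^ 2 * h - 3 * t * h ^ 2 = h ^ 3 := by ring
    rw [this, abs_pow]
    linarith [pow_nonneg (abs_nonneg h) 3]
  · rw [max_eq_left ht, max_eq_right hth, abs_of_nonpos (by linarith : h ≤ 0)]
    have h1 : 0 ≤ t * (t ^ 2 + 3 * t * h + 3 * h ^ 2) :=
      mul_nonneg ht (by nlinarith [sq_nonneg (2 * t + 3 * h), sq_nonneg h])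
    have h2 : t ^ 3 ≤ (-h) ^ 3 := pow_le_pow_left₀ ht (by linarith) 3
    have h3 : t * (t * -h) ≥ 0 := by nlinarith [mul_nonneg ht ht]
    rw [abs_le]
    constructor
    · have : (t + h) ^ 3 ≤ 0 := by
        have : 0 ≤ (-(t + h)) ^ 3 := by have : 0 ≤ -(t + h) := by linarith
                                        positivity
        nlinarith
      nlinarith [pow_nonneg (by linarith : 0 ≤ -h) 3]
    · nlinarith [pow_nonneg (by linarith : 0 ≤ -h) 3]
  · rw [max_eq_right ht, max_eq_left hth, abs_of_nonneg (by linarith : 0 ≤ h)]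
    have h2 : (t + h) ^ 3 ≤ h ^ 3 := pow_le_pow_left₀ hth (by linarith) 3
    have h3 : 0 ≤ (t + h) ^ 3 := by positivity
    rw [abs_le]
    constructor <;> nlinarith
  · rw [max_eq_right ht, max_eq_right hth]
    simp

theorem taylor_posPart_four {t h : ℝ} (h1 : t ≤ 1) :
    |max (t + h) 0 ^ 4 - max t 0 ^ 4 - 4 * max t 0 ^ 3 * h - 6 * max t 0 ^ 2 * h ^ 2| ≤
      4 * |h| ^ 3 + 2 * h ^ 4 := by
  have hh : 0 ≤ h ^ 4 := by positivity
  rcases le_total 0 t with ht | ht <;> rcases le_total 0 (t + h) with hth | hth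
  · rw [max_eq_left ht, max_eq_left hth]
    have : (t + h) ^ 4 - t ^ 4 - 4 * t ^ 3 * h - 6 * t ^ 2 * h ^ 2 = 4 * t * h ^ 3 + h ^ 4 := by ring
    rw [this]
    refine (abs_add_le _ _).trans ?_
    rw [abs_mul, abs_pow, abs_of_nonneg (by positivity : 0 ≤ 4 * t), abs_of_nonneg hh]
    nlinarith [pow_nonneg (abs_nonneg h) 3]
  · rw [max_eq_left ht, max_eq_right hth, abs_of_nonpos (by linarith : h ≤ 0)]
    have e : (0 : ℝ) ^ 4 - t ^ 4 - 4 * t ^ 3 * h - 6 * t ^ 2 * h ^ 2 =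
      4 * t * h ^ 3 + h ^ 4 - (t + h) ^ 4 := by ring
    have h2 : (t + h) ^ 4 ≤ h ^ 4 := by
      have : (-(t + h)) ^ 4 ≤ (-h) ^ 4 := pow_le_pow_left₀ (by linarith) (by linarith) 4
      rwa [Even.neg_pow (by decide : Even 4), Even.neg_pow (by decide : Even 4)] at this
    have h3 : 0 ≤ (t + h) ^ 4 := by positivity
    have h4 : 0 ≤ (-h) ^ 3 := pow_nonneg (by linarith) 3
    have h5 : t * (-h) ^ 3 ≤ (-h) ^ 3 := by nlinarith
    have h6 : 0 ≤ t * (-h) ^ 3 := mul_nonneg ht h4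
    have h7 : t * h ^ 3 = -(t * (-h) ^ 3) := by ring
    rw [e, abs_le]
    constructor <;> nlinarith
  · rw [max_eq_right ht, max_eq_left hth]
    have h2 : (t + h) ^ 4 ≤ h ^ 4 := pow_le_pow_left₀ hth (by linarith) 4
    have h3 : 0 ≤ (t + h) ^ 4 := by positivity
    have h4 := pow_nonneg (abs_nonneg h) 3
    rw [abs_le]
    constructor <;> nlinarith
  · rw [max_eq_right ht, max_eq_right hth]
    have h4 := pow_nonneg (abs_nonneg h) 3
    simp
    positivity

theorem bump_eq_zero {k : ℕ} (hk : 1 ≤ k) {s : ℝ} (hs : 0 < s) {x : ℂ} (hx : s ≤ ‖x‖) :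
    bump k s x = 0 := by
  have : 1 - ‖x‖ ^ 2 / s ^ 2 ≤ 0 := by
    rw [sub_nonpos, le_div_iff₀ (by positivity), one_mul]
    exact pow_le_pow_left₀ hs.le hx 2
  rw [bump, max_eq_right this, zero_pow (by omega)]

theorem bumpG_eq_zero {k : ℕ} (hk : 2 ≤ k) {s : ℝ} (hs : 0 < s) {x : ℂ} (hx : s ≤ ‖x‖) :
    bumpG k s x = 0 := by
  have : 1 - ‖x‖ ^ 2 / s ^ 2 ≤ 0 := by
    rw [sub_nonpos, le_div_iff₀ (by positivity), one_mul]
    exact pow_le_pow_left₀ hs.le hx 2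
  rw [bumpG, max_eq_right this, zero_pow (by omega)]; simp

theorem bumpB_eq_zero {k : ℕ} (hk : 3 ≤ k) {s : ℝ} (hs : 0 < s) {x : ℂ} (hx : s ≤ ‖x‖) :
    bumpB k s x = 0 := by
  have : 1 - ‖x‖ ^ 2 / s ^ 2 ≤ 0 := by
    rw [sub_nonpos, le_div_iff₀ (by positivity), one_mul]
    exact pow_le_pow_left₀ hs.le hx 2
  rw [bumpB, max_eq_right this, zero_pow (by omega), zero_pow (by omega)]; simp

theorem bumpA_eq_zero {k : ℕ} (hk : 3 ≤ k) {s : ℝ} (hs : 0 < s) {x : ℂ} (hx : s ≤ ‖x‖) :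
    bumpA k s x = 0 := by
  have : 1 - ‖x‖ ^ 2 / s ^ 2 ≤ 0 := by
    rw [sub_nonpos, le_div_iff₀ (by positivity), one_mul]
    exact pow_le_pow_left₀ hs.le hx 2
  rw [bumpA, max_eq_right this, zero_pow (by omega)]; simp

theorem posPart_le_one (s : ℝ) (x : ℂ) : max (1 - ‖x‖ ^ 2 / s ^ 2) 0 ≤ 1 :=
  max_le (by linarith [(by positivity : 0 ≤ ‖x‖ ^ 2 / s ^ 2)]) zero_le_one

theorem bump_nonneg (k : ℕ) (s : ℝ) (x : ℂ) : 0 ≤ bump k s x := pow_nonneg (le_max_right _ _) k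

theorem bump_le_one (k : ℕ) (s : ℝ) (x : ℂ) : bump k s x ≤ 1 :=
  pow_le_one₀ (le_max_right _ _) (posPart_le_one s x)

/-- Second order Taylor expansion of `bump`. -/
theorem abs_bump_add_sub_le {k : ℕ} (hk : k = 3 ∨ k = 4) {s : ℝ} (hs : 0 < s) {x v : ℂ}
    (hv : ‖v‖ ≤ s) :
    |bump k s (x + v) - bump k s x -
      ((bumpG k s x * v).re + bumpB k s x * ‖v‖ ^ 2 + (bumpA k s x * v ^ 2).re)| ≤
      5000 * (‖v‖ / s) ^ 3 := by
  -- Far from the support everything vanishes. Otherwise `‖x‖ < 2 s` bounds the linear term `c` by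
  -- `2 ρ`.
  rcases le_or_gt (2 * s) ‖x‖ with hx | hx
  · have h1 : s ≤ ‖x‖ := by linarith
    have h2 : s ≤ ‖x + v‖ := by
      have := norm_sub_le (x + v) v
      rw [add_sub_cancel_right] at this
      linarith
    rw [bump_eq_zero (by omega) hs h1, bump_eq_zero (by omega) hs h2, bumpG_eq_zero (by omega) hs h1,
      bumpB_eq_zero (by omega) hs h1, bumpA_eq_zero (by omega) hs h1]
    simp
    positivity
  set c : ℝ := (x.re * v.re + x.im * v.im) / s ^ 2 with hc
  set ρ := ‖v‖ / s with hρ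
  have hρ0 : 0 ≤ ρ := by positivity
  have hρ1 : ρ ≤ 1 := by rw [hρ, div_le_one hs]; exact hv
  have hnx : ‖x‖ ^ 2 = x.re ^ 2 + x.im ^ 2 := by
    rw [← Complex.normSq_eq_norm_sq, Complex.normSq_apply]; ring
  have hnv : ‖v‖ ^ 2 = v.re ^ 2 + v.im ^ 2 := by
    rw [← Complex.normSq_eq_norm_sq, Complex.normSq_apply]; ring
  have hnxv : ‖x + v‖ ^ 2 = (x.re + v.re) ^ 2 + (x.im + v.im) ^ 2 := by
    rw [← Complex.normSq_eq_norm_sq, Complex.normSq_apply]; simp; ring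
  have hρ2 : ρ ^ 2 = ‖v‖ ^ 2 / s ^ 2 := by rw [hρ, div_pow]
  have hcb : |c| ≤ 2 * ρ := by
    have h1 : |x.re * v.re + x.im * v.im| ≤ ‖x‖ * ‖v‖ := by
      refine abs_le_of_sq_le_sq ?_ (by positivity)
      rw [mul_pow, hnx, hnv]
      nlinarith [sq_nonneg (x.re * v.im - x.im * v.re)]
    rw [hc, abs_div, abs_of_pos (by positivity : 0 < s ^ 2), div_le_iff₀ (by positivity)]
    have : 2 * ρ * s ^ 2 = 2 * s * ‖v‖ := by rw [hρ]; field_simp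
    rw [this]
    exact h1.trans (by gcongr)
  set t := 1 - ‖x‖ ^ 2 / s ^ 2 with ht
  set h := -(2 * c + ρ ^ 2) with hh
  have hxv : 1 - ‖x + v‖ ^ 2 / s ^ 2 = t + h := by
    rw [ht, hh, hρ2, hc, hnxv, hnx, hnv]; field_simp; ring
  have hhb : |h| ≤ 5 * ρ := by
    rw [hh, abs_neg]
    refine (abs_add_le _ _).trans ?_
    rw [abs_mul, abs_of_pos (by norm_num : (0 : ℝ) < 2), abs_of_nonneg (sq_nonneg ρ)]
    nlinarith
  have ht1 : t ≤ 1 := by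
    have : 0 ≤ ‖x‖ ^ 2 / s ^ 2 := by positivity
    linarith
  have hp0 : 0 ≤ max t 0 := le_max_right _ _
  have hp1 : max t 0 ≤ 1 := max_le ht1 zero_le_one
  have hG : (bumpG k s x * v).re = -2 * k * max t 0 ^ (k - 1) * c := by
    rw [bumpG, mul_assoc, Complex.re_ofReal_mul, hc]
    simp [ht]
    field_simp
  -- Splits the second order term by `2 (x · v)² = |x|² |v|² + Re (conj x * v)²` into its trace and
  -- its trace-free part.
  have hBA : bumpB k s x * ‖v‖ ^ 2 + (bumpA k s x * v ^ 2).re =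
      -k * max t 0 ^ (k - 1) * ρ ^ 2 + 2 * (k * (k - 1)) * max t 0 ^ (k - 2) * c ^ 2 := by
    rw [bumpB, bumpA, mul_assoc _ (conj x ^ 2) (v ^ 2), Complex.re_ofReal_mul, hρ2, hc, ← mul_pow, sq (conj x * v),
      Complex.mul_re, hnx, hnv]
    simp only [Complex.mul_re, Complex.mul_im, Complex.conj_re, Complex.conj_im]
    rw [← hnx, ← ht]
    field_simp
    rw [hnx]
    ring
  -- Replacing `h²` by its leading part `4 c²` costs only terms of order three in `ρ`.
  have hsecond : |h ^ 2 - 4 * c ^ 2| ≤ 9 * ρ ^ 3 := by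
    have e : h ^ 2 - 4 * c ^ 2 = 4 * c * ρ ^ 2 + ρ ^ 4 := by rw [hh]; ring
    rw [e]
    refine (abs_add_le _ _).trans ?_
    rw [abs_mul, abs_mul, abs_of_pos (by norm_num : (0 : ℝ) < 4), abs_of_nonneg (sq_nonneg ρ),
      abs_of_nonneg (by positivity : 0 ≤ ρ ^ 4)]
    have h1 : |c| * ρ ^ 2 ≤ 2 * ρ * ρ ^ 2 := by gcongr
    have h2 : ρ ^ 4 ≤ ρ ^ 3 := pow_le_pow_of_le_one hρ0 hρ1 (by norm_num)
    nlinarith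
  have hcube : |h| ^ 3 ≤ 125 * ρ ^ 3 := by
    calc |h| ^ 3 ≤ (5 * ρ) ^ 3 := pow_le_pow_left₀ (abs_nonneg _) hhb 3
      _ = _ := by ring
  have hρ3 : 0 ≤ ρ ^ 3 := by positivity
  rw [add_assoc, hBA, hG, bump, bump, hxv, ← ht]
  rcases hk with rfl | rfl
  · have h1 := taylor_posPart_cube t h
    have e : max (t + h) 0 ^ 3 - max t 0 ^ 3 - (-2 * ((3 : ℕ) : ℝ) * max t 0 ^ (3 - 1) * c +
        (-((3 : ℕ) : ℝ) * max t 0 ^ (3 - 1) * ρ ^ 2 +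
          2 * (((3 : ℕ) : ℝ) * (((3 : ℕ) : ℝ) - 1)) * max t 0 ^ (3 - 2) * c ^ 2)) =
        (max (t + h) 0 ^ 3 - max t 0 ^ 3 - 3 * max t 0 ^ 2 * h - 3 * max t 0 * h ^ 2) +
          3 * max t 0 * (h ^ 2 - 4 * c ^ 2) := by
      rw [hh]; push_cast; ring
    rw [e]
    refine (abs_add_le _ _).trans ?_
    rw [abs_mul, abs_of_nonneg (by positivity : 0 ≤ 3 * max t 0)]
    have h3 : 3 * max t 0 * |h ^ 2 - 4 * c ^ 2| ≤ 3 * 1 * (9 * ρ ^ 3) := by gcongr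
    linarith
  · have h1 := taylor_posPart_four (h := h) ht1
    have e : max (t + h) 0 ^ 4 - max t 0 ^ 4 - (-2 * ((4 : ℕ) : ℝ) * max t 0 ^ (4 - 1) * c +
        (-((4 : ℕ) : ℝ) * max t 0 ^ (4 - 1) * ρ ^ 2 +
          2 * (((4 : ℕ) : ℝ) * (((4 : ℕ) : ℝ) - 1)) * max t 0 ^ (4 - 2) * c ^ 2)) =
        (max (t + h) 0 ^ 4 - max t 0 ^ 4 - 4 * max t 0 ^ 3 * h - 6 * max t 0 ^ 2 * h ^ 2) +
          6 * max t 0 ^ 2 * (h ^ 2 - 4 * c ^ 2) := by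
      rw [hh]; push_cast; ring
    rw [e]
    refine (abs_add_le _ _).trans ?_
    rw [abs_mul, abs_of_nonneg (by positivity : 0 ≤ 6 * max t 0 ^ 2)]
    have h3 : 6 * max t 0 ^ 2 * |h ^ 2 - 4 * c ^ 2| ≤ 6 * 1 ^ 2 * (9 * ρ ^ 3) := by gcongr
    have h4 : h ^ 4 ≤ 625 * ρ ^ 3 := by
      have a : h ^ 4 = |h| * |h| ^ 3 := by
        rw [← pow_succ']; exact (Even.pow_abs (by decide) h).symm
      rw [a]
      calc |h| * |h| ^ 3 ≤ 5 * (125 * ρ ^ 3) :=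
            mul_le_mul (by linarith) hcube (by positivity) (by norm_num)
        _ = _ := by ring
    linarith

/-- The linear and trace-free terms cancel by the first two moment identities, so the discrete
Laplacian sees only the trace, weighted by the mass. -/
theorem sum_cond_mul_quadratic (hL : L.Fat κ) (hu : u ∈ L.black) (G A : ℂ) (B : ℝ) :
    ∑ z ∈ L.starFinset u, L.cond z * ((G * (opp u z - u)).re + B * ‖opp u z - u‖ ^ 2 +
      (A * (opp u z - u) ^ 2).re) = 2 * B * L.mass u := by
  have h1 := congrArg (fun c => (G * c).re) (sum_cond_mul hL hu)
  have h2 := congrArg (fun c => (A * c).re) (sum_cond_mul_sq hL hu)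
  have h3 := sum_cond_mul_norm_sq hu
  simp only [Finset.mul_sum, Complex.re_sum, mul_zero, Complex.zero_re] at h1 h2
  have e : ∀ z ∈ L.starFinset u, L.cond z * ((G * (opp u z - u)).re + B * ‖opp u z - u‖ ^ 2 +
      (A * (opp u z - u) ^ 2).re) = (G * (L.cond z * (opp u z - u))).re +
      B * (L.cond z * ‖opp u z - u‖ ^ 2) + (A * (L.cond z * (opp u z - u) ^ 2)).re := by
    intro z _
    rw [mul_left_comm G, mul_left_comm A, Complex.re_ofReal_mul, Complex.re_ofReal_mul]; ring
  rw [Finset.sum_congr rfl e, Finset.sum_add_distrib, Finset.sum_add_distrib, h1, h2,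
    ← Finset.mul_sum, h3]
  ring

/-- Holomorphic quadratic polynomials have discrete harmonic real parts. -/
theorem lap_quadratic (hL : L.Fat κ) (hu : u ∈ L.black) (x : ℂ) (q : ℝ) (b A : ℂ) :
    L.lap (fun v => q + (b * (v - x)).re + (A * (v - x) ^ 2).re) u = 0 := by
  have h := sum_cond_mul_quadratic hL hu (b + 2 * A * (u - x)) A 0
  rw [lap]
  have e : ∀ z ∈ L.starFinset u,
      L.cond z * (q + (b * (opp u z - x)).re + (A * (opp u z - x) ^ 2).re -
        (q + (b * (u - x)).re + (A * (u - x) ^ 2).re)) =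
      L.cond z * (((b + 2 * A * (u - x)) * (opp u z - u)).re + 0 * ‖opp u z - u‖ ^ 2 +
      (A * (opp u z - u) ^ 2).re) := by
    intro z _
    have : b * (opp u z - x) + A * (opp u z - x) ^ 2 - (b * (u - x) + A * (u - x) ^ 2) =
        (b + 2 * A * (u - x)) * (opp u z - u) + A * (opp u z - u) ^ 2 := by ring
    have h := congrArg Complex.re this
    simp only [Complex.add_re, Complex.sub_re] at h ⊢
    rw [zero_mul, add_zero, ← h]; ring
  rw [Finset.sum_congr rfl e, h]; ring

/-- The discrete Laplacian of `bump` is close to the continuous one. -/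
theorem abs_lap_bump_sub_le (hL : L.Fat κ) (hu : u ∈ L.black) {k : ℕ} (hk : k = 3 ∨ k = 4) {s : ℝ}
    (hs : 2 * δ ≤ s) (y : ℂ) :
    |L.lap (fun v => bump k s (v - y)) u - 2 * bumpB k s (u - y) * L.mass u| ≤
      8000000 / κ ^ 4 * (δ / s) ^ 3 := by
  have hδ := hL.delta_pos
  have hκ := hL.kappa_pos
  have hs0 : 0 < s := by linarith
  rw [← sum_cond_mul_quadratic hL hu (bumpG k s (u - y)) (bumpA k s (u - y)), lap,
    ← Finset.sum_sub_distrib]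
  refine (Finset.abs_sum_le_sum_abs _ _).trans ?_
  have hb : ∀ z ∈ L.starFinset u, |L.cond z * (bump k s (opp u z - y) - bump k s (u - y)) -
      L.cond z * ((bumpG k s (u - y) * (opp u z - u)).re +
        bumpB k s (u - y) * ‖opp u z - u‖ ^ 2 + (bumpA k s (u - y) * (opp u z - u) ^ 2).re)| ≤
      2 / κ ^ 2 * (5000 * (2 * δ / s) ^ 3) := by
    intro z hz
    have hz := (mem_starFinset hu).1 hz
    have hn := hz.norm_opp_sub_le
    have ht := abs_bump_add_sub_le hk hs0 (x := u - y) (v := opp u z - u) (hn.trans hs)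
    rw [sub_add_sub_comm, add_comm, add_sub_add_right_eq_sub] at ht
    rw [← mul_sub, abs_mul, abs_of_pos (cond_pos hz.1)]
    have := cond_le hL hz.1
    refine mul_le_mul this (ht.trans ?_) (abs_nonneg _) (by positivity)
    gcongr
  refine (Finset.sum_le_card_nsmul _ _ _ hb).trans ?_
  rw [nsmul_eq_mul]
  calc _ ≤ 100 / κ ^ 2 * (2 / κ ^ 2 * (5000 * (2 * δ / s) ^ 3)) := by
        gcongr; exact card_star_le hL hu
    _ = _ := by field_simp; norm_num

theorem lap_bump_eq_zero (hL : L.Fat κ) (hu : u ∈ L.black) {k : ℕ} (hk : k = 3 ∨ k = 4) {s : ℝ}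
    (hs : 2 * δ ≤ s) {y : ℂ} (huy : s + 2 * δ ≤ ‖u - y‖) :
    L.lap (fun v => bump k s (v - y)) u = 0 := by
  have hδ := hL.delta_pos
  have hs0 : 0 < s := by linarith
  refine Finset.sum_eq_zero fun z hz => ?_
  have hz := (mem_starFinset hu).1 hz
  simp only
  rw [bump_eq_zero (by omega) hs0 (by linarith : s ≤ ‖u - y‖), bump_eq_zero (by omega) hs0, sub_self,
    mul_zero]
  by_contra h
  linarith [hz.norm_sub_lt (not_le.1 h)]

/-- The pairing of a discrete harmonic function with the Laplacian of `bump`. -/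
theorem abs_sum_mul_bumpB_le (hL : L.Fat κ) {k : ℕ} (hk : k = 3 ∨ k = 4) {s : ℝ}
    (hs : 2 * δ ≤ s) (y : ℂ) (H : ℂ → ℝ)
    (hH : ∀ u ∈ L.black, ‖u - y‖ < s → L.lap H u = 0) {V : Finset ℂ}
    (hV : L.blacks y (2 * s) ⊆ V) (hVb : ∀ u ∈ V, u ∈ L.black) :
    |∑ u ∈ V, L.mass u * bumpB k s (u - y) * H u| ≤
      4000000 / κ ^ 4 * (δ / s) ^ 3 * ∑ u ∈ L.blacks y (2 * s), |H u| := by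
  have hδ := hL.delta_pos
  have hs0 : 0 < s := by linarith
  -- Green's formula makes the pairing of `H` with the discrete Laplacian of `bump` vanish, so the
  -- pairing with the continuous one is only the consistency error of the discretization.
  have h0 := sum_mul_lap_eq_zero hL y H (fun v => bump k s (v - y)) (r := s)
    (fun u _ hu => bump_eq_zero (by omega) hs0 hu) hH
  have h1 : ∑ u ∈ L.blacks y (2 * s), H u * L.lap (fun v => bump k s (v - y)) u = 0 := by
    rw [← h0]
    refine (Finset.sum_subset ?_ ?_).symm
    · intro u hu
      rw [mem_blacks hL] at hu ⊢
      exact ⟨hu.1, by linarith [hu.2]⟩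
    · intro u hu hu'
      rw [mem_blacks hL] at hu hu'
      rw [lap_bump_eq_zero hL hu.1 hk hs, mul_zero]
      by_contra h
      exact hu' ⟨hu.1, not_le.1 h⟩
  have h2 : ∑ u ∈ V, L.mass u * bumpB k s (u - y) * H u =
      ∑ u ∈ L.blacks y (2 * s), L.mass u * bumpB k s (u - y) * H u := by
    refine (Finset.sum_subset hV ?_).symm
    intro u hu hu'
    rw [mem_blacks hL] at hu'
    rw [bumpB_eq_zero (by omega) hs0, mul_zero, zero_mul]
    by_contra h
    exact hu' ⟨hVb u hu, by linarith [not_le.1 h]⟩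
  have h3 : ∑ u ∈ L.blacks y (2 * s), L.mass u * bumpB k s (u - y) * H u =
      ∑ u ∈ L.blacks y (2 * s), (-1 / 2 * H u) * (L.lap (fun v => bump k s (v - y)) u -
        2 * bumpB k s (u - y) * L.mass u) := by
    have : ∀ u ∈ L.blacks y (2 * s), (-1 / 2 * H u) * (L.lap (fun v => bump k s (v - y)) u -
        2 * bumpB k s (u - y) * L.mass u) = L.mass u * bumpB k s (u - y) * H u -
        1 / 2 * (H u * L.lap (fun v => bump k s (v - y)) u) := fun u _ => by ring
    rw [Finset.sum_congr rfl this, Finset.sum_sub_distrib, ← Finset.mul_sum, h1]; ring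
  rw [h2, h3, Finset.mul_sum]
  refine (Finset.abs_sum_le_sum_abs _ _).trans (Finset.sum_le_sum fun u hu => ?_)
  have hub := ((mem_blacks hL).1 hu).1
  rw [abs_mul, abs_mul]
  have := abs_lap_bump_sub_le hL hub hk hs y
  have e : |(-1 / 2 : ℝ)| = 1 / 2 := by rw [abs_of_neg (by norm_num)]; norm_num
  rw [e]
  calc _ ≤ 1 / 2 * |H u| * (8000000 / κ ^ 4 * (δ / s) ^ 3) := by gcongr
    _ = _ := by ring

/-! ### Mollification, its dependence on the scale, and the density of vertices. -/

theorem hasDerivAt_posPart_cube (t : ℝ) :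
    HasDerivAt (fun t : ℝ => max t 0 ^ 3) (3 * max t 0 ^ 2) t := by
  rw [hasDerivAt_iff_isLittleO_nhds_zero]
  have h2 : (fun h : ℝ => h ^ 2) =o[nhds 0] (fun h : ℝ => h) :=
    Asymptotics.isLittleO_pow_id one_lt_two
  refine Asymptotics.IsBigO.trans_isLittleO (Asymptotics.IsBigO.of_bound (3 * max t 0 + 2) ?_) h2
  have hev : ∀ᶠ h : ℝ in nhds 0, |h| < 1 := by
    have : Filter.Tendsto (fun h : ℝ => |h|) (nhds 0) (nhds 0) := by
      simpa using (continuous_abs.tendsto (0 : ℝ))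
    exact this.eventually (gt_mem_nhds one_pos)
  filter_upwards [hev] with h hh
  have h1 := taylor_posPart_cube t h
  have e : max (t + h) 0 ^ 3 - max t 0 ^ 3 - h • (3 * max t 0 ^ 2) =
      (max (t + h) 0 ^ 3 - max t 0 ^ 3 - 3 * max t 0 ^ 2 * h - 3 * max t 0 * h ^ 2) +
        3 * max t 0 * h ^ 2 := by rw [smul_eq_mul]; ring
  rw [e, Real.norm_eq_abs, Real.norm_eq_abs, abs_of_nonneg (sq_nonneg h)]
  have hp : 0 ≤ max t 0 := le_max_right _ _
  refine (abs_add_le _ _).trans ?_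
  rw [abs_of_nonneg (by positivity : 0 ≤ 3 * max t 0 * h ^ 2)]
  have h3 : |h| ^ 3 ≤ h ^ 2 := by
    rw [← sq_abs h]
    exact pow_le_pow_of_le_one (abs_nonneg _) hh.le (by norm_num)
  linarith

/-- The scale derivative of the normalized kernel with exponent `3` is a multiple of the Laplacian
of `bump 4`. This plays the role of the heat equation: averages of a harmonic function hardly depend
on the scale. -/
theorem hasDerivAt_bump {s : ℝ} (hs : 0 < s) (x : ℂ) :
    HasDerivAt (fun s => bump 3 s x / s ^ 2) (bumpB 4 s x / (2 * s)) s := by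
  have h1 : HasDerivAt (fun s : ℝ => 1 - ‖x‖ ^ 2 / s ^ 2) (2 * ‖x‖ ^ 2 / s ^ 3) s := by
    have h := ((hasDerivAt_pow 2 s).fun_inv (by positivity)).const_mul (‖x‖ ^ 2)
    refine (h.const_sub 1).congr_deriv ?_
    push_cast
    field_simp
  have h2 : HasDerivAt (fun s : ℝ => max (1 - ‖x‖ ^ 2 / s ^ 2) 0 ^ 3)
      (3 * max (1 - ‖x‖ ^ 2 / s ^ 2) 0 ^ 2 * (2 * ‖x‖ ^ 2 / s ^ 3)) s :=
    HasDerivAt.comp (h₂ := fun t : ℝ => max t 0 ^ 3) s (hasDerivAt_posPart_cube (1 - ‖x‖ ^ 2 / s ^ 2)) h1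
  refine (h2.fun_div (hasDerivAt_pow 2 s) (by positivity)).congr_deriv ?_
  rw [bumpB]
  norm_num
  field_simp
  ring

theorem sum_sum_le_card_mul {α β : Type*} [DecidableEq β] (A : Finset α) (B : α → Finset β)
    (Z : Finset β) (hB : ∀ x ∈ A, B x ⊆ Z) (f : β → ℝ) (hf : ∀ z ∈ Z, 0 ≤ f z) (M : ℝ)
    (hM : ∀ z ∈ Z, ((A.filter fun x => z ∈ B x).card : ℝ) ≤ M) :
    ∑ x ∈ A, ∑ z ∈ B x, f z ≤ M * ∑ z ∈ Z, f z := by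
  rw [Finset.sum_comm' (t' := Z) (s' := fun z => A.filter fun x => z ∈ B x), Finset.mul_sum]
  · refine Finset.sum_le_sum fun z hz => ?_
    rw [Finset.sum_const, nsmul_eq_mul]
    exact mul_le_mul_of_nonneg_right (hM z hz) (hf z hz)
  · intro x z
    rw [Finset.mem_filter]
    constructor
    · rintro ⟨h1, h2⟩; exact ⟨⟨h1, h2⟩, hB x h1 h2⟩
    · rintro ⟨⟨h1, h2⟩, -⟩; exact ⟨h1, h2⟩

theorem blacks_subset (hL : L.Fat κ) {r R : ℝ} (h : ‖y - x‖ + r ≤ R) :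
    L.blacks y r ⊆ L.blacks x R := by
  intro u hu
  rw [mem_blacks hL] at hu ⊢
  refine ⟨hu.1, ?_⟩
  have := norm_add_le (u - y) (y - x)
  rw [sub_add_sub_cancel] at this
  linarith [hu.2]

theorem blacks_mono (hL : L.Fat κ) {r R : ℝ} (h : r ≤ R) : L.blacks y r ⊆ L.blacks y R :=
  blacks_subset hL (by simpa using h)

variable (L) in
/-- The mollification of `H` at scale `s` (not normalized). -/
noncomputable def moll (H : ℂ → ℝ) (s : ℝ) (y : ℂ) : ℝ :=
  ∑ u ∈ L.blacks y s, L.mass u * (bump 3 s (u - y) / s ^ 2) * H u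

/-- A summation set independent of the scale and of the centre allows differentiation in `s` and
comparison of different `y`. -/
theorem moll_eq_sum (hL : L.Fat κ) (H : ℂ → ℝ) {s : ℝ} (hs : 0 < s) {V : Finset ℂ}
    (hV : L.blacks y s ⊆ V) (hVb : ∀ u ∈ V, u ∈ L.black) :
    L.moll H s y = ∑ u ∈ V, L.mass u * (bump 3 s (u - y) / s ^ 2) * H u := by
  refine Finset.sum_subset hV fun u hu hu' => ?_
  rw [mem_blacks hL] at hu'
  rw [bump_eq_zero (by norm_num) hs]
  · ring
  · by_contra h
    exact hu' ⟨hVb u hu, not_le.1 h⟩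

theorem black_of_mem_blacks (hL : L.Fat κ) {r : ℝ} : ∀ u ∈ L.blacks y r, u ∈ L.black :=
  fun _ hu => ((mem_blacks hL).1 hu).1

/-- The mean value inequality over `[t, 2 t]`: the derivative in the scale is a pairing of `H` with
`bumpB 4`, which harmonicity makes of order `(δ / t)³`. -/
theorem abs_moll_two_mul_sub_le (hL : L.Fat κ) {t : ℝ} (ht : 2 * δ ≤ t) (H : ℂ → ℝ)
    (hH : ∀ u ∈ L.black, ‖u - y‖ < 2 * t → L.lap H u = 0) :
    |L.moll H (2 * t) y - L.moll H t y| ≤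
      2000000 / κ ^ 4 * (δ / t) ^ 3 * ∑ u ∈ L.blacks y (4 * t), |H u| := by
  have hδ := hL.delta_pos
  have hκ := hL.kappa_pos
  have ht0 : 0 < t := by linarith
  have hVb := black_of_mem_blacks hL (y := y) (r := 4 * t)
  set S := ∑ u ∈ L.blacks y (4 * t), |H u| with hS
  have hS0 : 0 ≤ S := Finset.sum_nonneg fun _ _ => abs_nonneg _
  have hd : ∀ s ∈ Set.Icc t (2 * t), HasDerivWithinAt
      (fun s => ∑ u ∈ L.blacks y (4 * t), L.mass u * (bump 3 s (u - y) / s ^ 2) * H u)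
      (∑ u ∈ L.blacks y (4 * t), L.mass u * (bumpB 4 s (u - y) / (2 * s)) * H u)
      (Set.Icc t (2 * t)) s := by
    intro s hs
    have hs0 : 0 < s := ht0.trans_le hs.1
    refine HasDerivAt.hasDerivWithinAt (HasDerivAt.fun_sum fun u _ => ?_)
    exact ((hasDerivAt_bump hs0 (u - y)).const_mul _).mul_const _
  have hb : ∀ s ∈ Set.Ico t (2 * t),
      ‖∑ u ∈ L.blacks y (4 * t), L.mass u * (bumpB 4 s (u - y) / (2 * s)) * H u‖ ≤
        1 / (2 * t) * (4000000 / κ ^ 4 * (δ / t) ^ 3 * S) := by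
    intro s hs
    have hs0 : 0 < s := ht0.trans_le hs.1
    have h := abs_sum_mul_bumpB_le hL (.inr rfl) (ht.trans hs.1) y H
      (fun u hu hus => hH u hu (hus.trans hs.2)) (V := L.blacks y (4 * t))
      (blacks_mono hL (by linarith [hs.2])) hVb
    have e : ∑ u ∈ L.blacks y (4 * t), L.mass u * (bumpB 4 s (u - y) / (2 * s)) * H u =
        1 / (2 * s) * ∑ u ∈ L.blacks y (4 * t), L.mass u * bumpB 4 s (u - y) * H u := by
      rw [Finset.mul_sum]
      exact Finset.sum_congr rfl fun u _ => by ring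
    rw [e, norm_mul, Real.norm_eq_abs, Real.norm_eq_abs, abs_of_pos (by positivity)]
    have hsub : ∑ u ∈ L.blacks y (2 * s), |H u| ≤ S :=
      Finset.sum_le_sum_of_subset_of_nonneg (blacks_mono hL (by linarith [hs.2]))
        fun _ _ _ => abs_nonneg _
    have hts := hs.1
    calc _ ≤ 1 / (2 * s) * (4000000 / κ ^ 4 * (δ / s) ^ 3 * ∑ u ∈ L.blacks y (2 * s), |H u|) := by
          gcongr
      _ ≤ _ := by gcongr
  have := norm_image_sub_le_of_norm_deriv_le_segment' hd hb (2 * t) ⟨by linarith, le_rfl⟩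
  rw [moll_eq_sum hL H (by positivity : 0 < 2 * t) (blacks_mono hL (by linarith)) hVb,
    moll_eq_sum hL H ht0 (blacks_mono hL (by linarith)) hVb, ← Real.norm_eq_abs]
  refine this.trans_eq ?_
  field_simp
  ring

variable (L) in
/-- The mollification of the constant function `1`. -/
noncomputable def dens (s : ℝ) (y : ℂ) : ℝ := L.moll (fun _ => 1) s y

theorem lap_const (c : ℝ) (u : ℂ) : L.lap (fun _ => c) u = 0 := by simp [lap]

theorem abs_dens_two_mul_sub_le (hL : L.Fat κ) {t : ℝ} (ht : 2 * δ ≤ t) (y : ℂ) :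
    |L.dens (2 * t) y - L.dens t y| ≤ 14400000000 / κ ^ 6 * (δ / t) := by
  have hδ := hL.delta_pos
  have hκ := hL.kappa_pos
  have ht0 : 0 < t := by linarith
  refine (abs_moll_two_mul_sub_le hL ht (fun _ => 1) (fun u _ _ => lap_const 1 u)).trans ?_
  simp only [abs_one, Finset.sum_const, nsmul_eq_mul, mul_one]
  calc _ ≤ 2000000 / κ ^ 4 * (δ / t) ^ 3 * (450 / κ ^ 2 * (4 * t / δ) ^ 2) := by
        gcongr; exact card_blacks_le hL y (by linarith)
    _ = _ := by field_simp; norm_num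

theorem abs_dens_pow_mul_sub_le (hL : L.Fat κ) {t : ℝ} (ht : 2 * δ ≤ t) (y : ℂ) (J : ℕ) :
    |L.dens (2 ^ J * t) y - L.dens t y| ≤
      14400000000 / κ ^ 6 * (δ / t) * (2 * (1 - 1 / 2 ^ J)) := by
  have hδ := hL.delta_pos
  have hκ := hL.kappa_pos
  have ht0 : 0 < t := by linarith
  induction J with
  | zero => simp
  | succ J ih =>
    have h1 : (1 : ℝ) ≤ 2 ^ J := one_le_pow₀ (by norm_num)
    have h := abs_dens_two_mul_sub_le hL (t := 2 ^ J * t) (by nlinarith) y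
    have h2 := abs_sub_le (L.dens (2 * (2 ^ J * t)) y) (L.dens (2 ^ J * t) y) (L.dens t y)
    have e : (2 : ℝ) ^ (J + 1) * t = 2 * (2 ^ J * t) := by ring
    rw [e]
    refine h2.trans ((add_le_add h ih).trans_eq ?_)
    field_simp
    ring

/-- A crude Lipschitz bound from that of the kernel. It has no smallness in `δ`, and is useful only
at scales far larger than the distance of the centres. -/
theorem abs_dens_sub_le (hL : L.Fat κ) {s : ℝ} (hs : δ ≤ s) {y y' : ℂ} (hy : ‖y - y'‖ ≤ s) :
    |L.dens s y - L.dens s y'| ≤ 2700000 / κ ^ 4 * (‖y - y'‖ / s) := by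
  have hδ := hL.delta_pos
  have hκ := hL.kappa_pos
  have hs0 : 0 < s := by linarith
  have hVb := black_of_mem_blacks hL (y := y) (r := 2 * s)
  rw [dens, dens, moll_eq_sum hL _ hs0 (V := L.blacks y (2 * s)) (blacks_mono hL (by linarith)) hVb,
    moll_eq_sum hL _ hs0 (V := L.blacks y (2 * s))
      (blacks_subset hL (by rw [norm_sub_rev]; linarith)) hVb, ← Finset.sum_sub_distrib]
  refine (Finset.abs_sum_le_sum_abs _ _).trans ?_
  have hb : ∀ u ∈ L.blacks y (2 * s),
      |L.mass u * (bump 3 s (u - y) / s ^ 2) * 1 - L.mass u * (bump 3 s (u - y') / s ^ 2) * 1| ≤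
        100 / κ ^ 2 * δ ^ 2 * (15 * (‖y - y'‖ / s) / s ^ 2) := by
    intro u hu
    obtain ⟨hub, hur⟩ := (mem_blacks hL).1 hu
    have e : L.mass u * (bump 3 s (u - y) / s ^ 2) * 1 - L.mass u * (bump 3 s (u - y') / s ^ 2) * 1 =
        L.mass u * ((bump 3 s (u - y) - bump 3 s (u - y')) / s ^ 2) := by ring
    rw [e, abs_mul, abs_of_pos (mass_pos hub), abs_div, abs_of_pos (by positivity : 0 < s ^ 2)]
    have hbump : |bump 3 s (u - y) - bump 3 s (u - y')| ≤ 15 * (‖y - y'‖ / s) := by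
      rw [bump, bump]
      have p1 := posPart_le_one s (u - y)
      have p2 := posPart_le_one s (u - y')
      have p3 := le_max_right (1 - ‖u - y‖ ^ 2 / s ^ 2) 0
      have p4 := le_max_right (1 - ‖u - y'‖ ^ 2 / s ^ 2) 0
      have hl : |max (1 - ‖u - y‖ ^ 2 / s ^ 2) 0 - max (1 - ‖u - y'‖ ^ 2 / s ^ 2) 0| ≤
          5 * (‖y - y'‖ / s) := by
        refine (abs_max_sub_max_le_max _ _ _ _).trans ?_
        rw [sub_self, abs_zero, max_eq_left (abs_nonneg _)]
        have e2 : 1 - ‖u - y‖ ^ 2 / s ^ 2 - (1 - ‖u - y'‖ ^ 2 / s ^ 2) =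
            (‖u - y'‖ - ‖u - y‖) * (‖u - y'‖ + ‖u - y‖) / s ^ 2 := by ring
        have a1 := abs_norm_sub_norm_le (u - y') (u - y)
        rw [sub_sub_sub_cancel_left] at a1
        have a2 : ‖u - y'‖ + ‖u - y‖ ≤ 5 * s := by
          have := norm_add_le (u - y) (y - y')
          rw [sub_add_sub_cancel] at this
          linarith
        rw [e2, abs_div, abs_mul, abs_of_pos (by positivity : 0 < s ^ 2),
          abs_of_nonneg (by positivity : 0 ≤ ‖u - y'‖ + ‖u - y‖), div_le_iff₀ (by positivity)]
        calc _ ≤ ‖y - y'‖ * (5 * s) := by gcongr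
          _ = _ := by field_simp
      generalize max (1 - ‖u - y‖ ^ 2 / s ^ 2) 0 = a at *
      generalize max (1 - ‖u - y'‖ ^ 2 / s ^ 2) 0 = b at *
      have e3 : a ^ 3 - b ^ 3 = (a - b) * (a ^ 2 + a * b + b ^ 2) := by ring
      have h3 : a ^ 2 + a * b + b ^ 2 ≤ 3 := by nlinarith
      rw [e3, abs_mul, abs_of_nonneg (by positivity : 0 ≤ a ^ 2 + a * b + b ^ 2)]
      calc _ ≤ 5 * (‖y - y'‖ / s) * 3 := by gcongr
        _ = _ := by ring
    have := mass_le hL hub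
    gcongr
  refine (Finset.sum_le_card_nsmul _ _ _ hb).trans ?_
  rw [nsmul_eq_mul]
  calc _ ≤ 450 / κ ^ 2 * (2 * s / δ) ^ 2 * (100 / κ ^ 2 * δ ^ 2 * (15 * (‖y - y'‖ / s) / s ^ 2)) := by
        gcongr; exact card_blacks_le hL y (by linarith)
    _ = _ := by field_simp; norm_num; ring

/-- The density of the black vertices is almost constant. -/
theorem abs_dens_sub_dens_le (hL : L.Fat κ) {t : ℝ} (ht : 2 * δ ≤ t) (y y' : ℂ) :
    |L.dens t y - L.dens t y'| ≤ 57600000000 / κ ^ 6 * (δ / t) := by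
  have hδ := hL.delta_pos
  have hκ := hL.kappa_pos
  have ht0 : 0 < t := by linarith
  refine le_of_forall_pos_le_add fun ε hε => ?_
  -- Both densities are carried up to a huge scale, at a total cost of order `δ / t`. There the
  -- Lipschitz bound applies because `2 ^ J * t` exceeds the distance of the centres, and the second
  -- summand makes it at most `ε`.
  obtain ⟨J, hJ⟩ := pow_unbounded_of_one_lt
    ((‖y - y'‖ + 1) / t + 2700000 / κ ^ 4 * ‖y - y'‖ / (ε * t)) one_lt_two
  have hJ1 : (‖y - y'‖ + 1) / t < 2 ^ J := lt_of_le_of_lt (by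
    have : 0 ≤ 2700000 / κ ^ 4 * ‖y - y'‖ / (ε * t) := by positivity
    linarith) hJ
  have hJ2 : 2700000 / κ ^ 4 * ‖y - y'‖ / (ε * t) < 2 ^ J := lt_of_le_of_lt (by
    have : 0 ≤ (‖y - y'‖ + 1) / t := by positivity
    linarith) hJ
  rw [div_lt_iff₀ ht0] at hJ1
  rw [div_lt_iff₀ (by positivity)] at hJ2
  have h1J : (1 : ℝ) ≤ 2 ^ J := one_le_pow₀ (by norm_num)
  have h1 := abs_dens_pow_mul_sub_le hL ht y J
  have h2 := abs_dens_pow_mul_sub_le hL ht y' J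
  have h3 := abs_dens_sub_le hL (s := 2 ^ J * t) (by nlinarith) (y := y) (y' := y') (by linarith)
  have h4 : 2700000 / κ ^ 4 * (‖y - y'‖ / (2 ^ J * t)) ≤ ε := by
    rw [← mul_div_assoc, div_le_iff₀ (by positivity)]
    linarith
  have h5 : 14400000000 / κ ^ 6 * (δ / t) * (2 * (1 - 1 / 2 ^ J)) ≤
      14400000000 / κ ^ 6 * (δ / t) * 2 := by
    have : 0 ≤ (1 : ℝ) / 2 ^ J := by positivity
    gcongr
    linarith
  rw [abs_le] at h1 h2 h3 ⊢
  have e : 57600000000 / κ ^ 6 * (δ / t) = 4 * (14400000000 / κ ^ 6 * (δ / t)) := by ring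
  rw [e]
  constructor <;> linarith

theorem le_dens (hL : L.Fat κ) {s : ℝ} (hs : 12 * δ ≤ s) (y : ℂ) : κ / 400 ≤ L.dens s y := by
  have hδ := hL.delta_pos
  have hκ := hL.kappa_pos
  have hs0 : 0 < s := by linarith
  have h1 : ∑ u ∈ L.blacks y (s / 2), κ * δ ^ 2 * (27 / 64 / s ^ 2) ≤ L.dens s y := by
    refine (Finset.sum_le_sum (g := fun u => L.mass u * (bump 3 s (u - y) / s ^ 2) * 1) ?_).trans
      (Finset.sum_le_sum_of_subset_of_nonneg (blacks_mono hL (by linarith)) ?_)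
    · intro u hu
      obtain ⟨hub, hur⟩ := (mem_blacks hL).1 hu
      have hm := le_mass hL hub
      have hb : 27 / 64 ≤ bump 3 s (u - y) := by
        have : (3 / 4 : ℝ) ≤ max (1 - ‖u - y‖ ^ 2 / s ^ 2) 0 := by
          refine le_max_of_le_left ?_
          have : ‖u - y‖ ^ 2 / s ^ 2 ≤ 1 / 4 := by
            rw [div_le_iff₀ (by positivity)]
            calc _ ≤ (s / 2) ^ 2 := by gcongr
              _ = _ := by ring
          linarith
        rw [bump]
        calc (27 / 64 : ℝ) = (3 / 4) ^ 3 := by norm_num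
          _ ≤ _ := by gcongr
      rw [mul_one]
      have := mass_pos hub
      gcongr
    · intro u hu _
      have := mass_pos ((mem_blacks hL).1 hu).1
      have := bump_nonneg 3 s (u - y)
      positivity
  refine le_trans ?_ h1
  rw [Finset.sum_const, nsmul_eq_mul]
  have h2 := le_card_blacks hL y (r := s / 2) (by linarith)
  calc κ / 400 ≤ (s / 2 / δ) ^ 2 / 36 * (κ * δ ^ 2 * (27 / 64 / s ^ 2)) := by
        field_simp; norm_num
    _ ≤ _ := by gcongr

theorem dens_le (hL : L.Fat κ) {s : ℝ} (hs : δ ≤ s) (y : ℂ) : L.dens s y ≤ 45000 / κ ^ 4 := by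
  have hδ := hL.delta_pos
  have hκ := hL.kappa_pos
  have hs0 : 0 < s := by linarith
  have hb : ∀ u ∈ L.blacks y s, L.mass u * (bump 3 s (u - y) / s ^ 2) * 1 ≤
      100 / κ ^ 2 * δ ^ 2 * (1 / s ^ 2) := by
    intro u hu
    have hub := ((mem_blacks hL).1 hu).1
    have := mass_le hL hub
    have := mass_pos hub
    have := bump_le_one 3 s (u - y)
    have := bump_nonneg 3 s (u - y)
    rw [mul_one]
    gcongr
  refine (Finset.sum_le_card_nsmul _ _ _ hb).trans ?_
  rw [nsmul_eq_mul]
  calc _ ≤ 450 / κ ^ 2 * (s / δ) ^ 2 * (100 / κ ^ 2 * δ ^ 2 * (1 / s ^ 2)) := by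
        gcongr; exact card_blacks_le hL y hs
    _ = _ := by field_simp; norm_num

theorem sq_sum_abs_le (hL : L.Fat κ) (y : ℂ) {r : ℝ} (hr : δ ≤ r) (H : ℂ → ℝ) :
    (∑ u ∈ L.blacks y r, |H u|) ^ 2 ≤ 450 / κ ^ 2 * (r / δ) ^ 2 * ∑ u ∈ L.blacks y r, H u ^ 2 := by
  refine sq_sum_le_card_mul_sum_sq.trans ?_
  simp only [sq_abs]
  have := card_blacks_le hL y hr
  have : 0 ≤ ∑ u ∈ L.blacks y r, H u ^ 2 := Finset.sum_nonneg fun _ _ => sq_nonneg _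
  gcongr

theorem sum_sum_blacks_le (hL : L.Fat κ) {r R ρ : ℝ} (hr : δ ≤ r) (hρ : R + r ≤ ρ)
    (f : ℂ → ℝ) (hf : ∀ u, 0 ≤ f u) :
    ∑ y ∈ L.blacks x R, ∑ u ∈ L.blacks y r, f u ≤
      450 / κ ^ 2 * (r / δ) ^ 2 * ∑ u ∈ L.blacks x ρ, f u := by
  classical
  refine sum_sum_le_card_mul _ _ _ (fun y hy => blacks_subset hL ?_) f (fun u _ => hf u) _ ?_
  · linarith [((mem_blacks hL).1 hy).2]
  · intro u _
    refine le_trans ?_ (card_blacks_le hL u hr)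
    refine Nat.cast_le.2 (Finset.card_le_card fun y hy => ?_)
    rw [Finset.mem_filter, mem_blacks hL, mem_blacks hL] at hy
    rw [mem_blacks hL, norm_sub_rev]
    exact ⟨hy.1.1, hy.2.2⟩

theorem sum_sum_rhombi_le (hL : L.Fat κ) {r R ρ : ℝ} (hr : δ ≤ r) (hρ : R + r ≤ ρ)
    (f : ℂ → ℝ) (hf : ∀ u, 0 ≤ f u) :
    ∑ y ∈ L.blacks x R, ∑ z ∈ L.rhombi y r, f z ≤
      450 / κ ^ 2 * (r / δ) ^ 2 * ∑ z ∈ L.rhombi x ρ, f z := by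
  classical
  refine sum_sum_le_card_mul _ _ _ (fun y hy z hz => ?_) f (fun u _ => hf u) _ ?_
  · rw [mem_rhombi hL] at hz ⊢
    refine ⟨hz.1, ?_⟩
    have := norm_add_le (z - y) (y - x)
    rw [sub_add_sub_cancel] at this
    linarith [((mem_blacks hL).1 hy).2, hz.2]
  · intro u _
    refine le_trans ?_ (card_blacks_le hL u hr)
    refine Nat.cast_le.2 (Finset.card_le_card fun y hy => ?_)
    rw [Finset.mem_filter, mem_blacks hL, mem_rhombi hL] at hy
    rw [mem_blacks hL, norm_sub_rev]
    exact ⟨hy.1.1, hy.2.2⟩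

/-- The difference is a weighted sum of increments `H x - H u`, each bounded by the number of tube
edges times the largest increment, and that in turn by the square root of the local energy. The
power of `t / δ` lost here is paid for later by `δ / ρ`. -/
theorem sq_dens_mul_sub_moll_le (hL : L.Fat κ) {t : ℝ} (ht : 2 * δ ≤ t) (hx : x ∈ L.black)
    (H : ℂ → ℝ) :
    (L.dens t x * H x - L.moll H t x) ^ 2 ≤
      (36000000 / κ ^ 6 * (t / δ)) ^ 2 *
        ∑ z ∈ L.rhombi x (2 * t), (H (L.u₁ z) - H (L.u₂ z)) ^ 2 := by
  have hδ := hL.delta_pos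
  have hκ := hL.kappa_pos
  have ht0 : 0 < t := by linarith
  set E := ∑ z ∈ L.rhombi x (2 * t), (H (L.u₁ z) - H (L.u₂ z)) ^ 2 with hE
  have hE0 : 0 ≤ E := Finset.sum_nonneg fun _ _ => sq_nonneg _
  have hosc : ∀ u ∈ L.blacks x t, |H x - H u| ≤ 800 / κ ^ 2 * (t / δ) * √E := by
    intro u hu
    obtain ⟨hub, hut⟩ := (mem_blacks hL).1 hu
    have h := norm_sub_le_card_tube hL hx hub H (ε := √E) (fun z hz => ?_)
    · refine h.trans ?_
      have hc := card_tube_le hL x u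
      have h2 : ‖u - x‖ / δ + 2 ≤ 2 * (t / δ) := by
        have : ‖u - x‖ / δ ≤ t / δ := by gcongr
        have : 2 ≤ t / δ := by rwa [le_div_iff₀ hδ]
        linarith
      calc _ ≤ 400 / κ ^ 2 * (2 * (t / δ)) * √E := by
            gcongr
            refine hc.trans ?_
            gcongr
        _ = _ := by ring
    · rw [Real.norm_eq_abs, ← Real.sqrt_sq_eq_abs]
      refine Real.sqrt_le_sqrt (Finset.single_le_sum
        (f := fun z => (H (L.u₁ z) - H (L.u₂ z)) ^ 2) (fun _ _ => sq_nonneg _) ?_)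
      have := norm_center_sub_lt_of_mem_tube hL (c := x) (r := t) (by simpa using ht0) hut hz
      rw [mem_rhombi hL]
      exact ⟨((mem_tube hL).1 hz).1, by linarith⟩
  have e : L.dens t x * H x - L.moll H t x =
      ∑ u ∈ L.blacks x t, L.mass u * (bump 3 t (u - x) / t ^ 2) * (H x - H u) := by
    rw [dens, moll, moll, Finset.sum_mul, ← Finset.sum_sub_distrib]
    exact Finset.sum_congr rfl fun u _ => by ring
  have hb : |L.dens t x * H x - L.moll H t x| ≤
      L.dens t x * (800 / κ ^ 2 * (t / δ) * √E) := by
    rw [e, dens, moll, Finset.sum_mul]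
    refine (Finset.abs_sum_le_sum_abs _ _).trans (Finset.sum_le_sum fun u hu => ?_)
    have h1 := mass_pos ((mem_blacks hL).1 hu).1
    have h2 := bump_nonneg 3 t (u - x)
    rw [abs_mul, abs_of_nonneg (by positivity), mul_one]
    gcongr
    exact hosc u hu
  have hd := dens_le hL (s := t) (by linarith) x
  rw [← sq_abs]
  calc _ ≤ (45000 / κ ^ 4 * (800 / κ ^ 2 * (t / δ) * √E)) ^ 2 := by
        gcongr
        refine hb.trans ?_
        gcongr
    _ = (36000000 / κ ^ 6 * (t / δ)) ^ 2 * (√E) ^ 2 := by ring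
    _ = _ := by rw [Real.sq_sqrt hE0]

theorem sum_sq_dens_mul_sub_moll_le (hL : L.Fat κ) {t R ρ : ℝ} (ht : 2 * δ ≤ t)
    (hρ : R + 2 * t ≤ ρ / 2) (hρδ : 16 * δ ≤ ρ) (H : ℂ → ℝ)
    (hH : ∀ u ∈ L.black, ‖u - x‖ < ρ → L.lap H u = 0) :
    ∑ y ∈ L.blacks x R, (L.dens t y * H y - L.moll H t y) ^ 2 ≤
      10 ^ 23 / κ ^ 19 * (t / δ) ^ 4 * (δ / ρ) ^ 2 * ∑ u ∈ L.blacks x ρ, H u ^ 2 := by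
  have hδ := hL.delta_pos
  have hκ := hL.kappa_pos
  have ht0 : 0 < t := by linarith
  have hS : 0 ≤ ∑ u ∈ L.blacks x ρ, H u ^ 2 := Finset.sum_nonneg fun _ _ => sq_nonneg _
  refine (Finset.sum_le_sum fun y hy =>
    sq_dens_mul_sub_moll_le hL ht ((mem_blacks hL).1 hy).1 H).trans ?_
  rw [← Finset.mul_sum]
  have h1 := sum_sum_rhombi_le hL (x := x) (r := 2 * t) (R := R) (ρ := ρ / 2) (by linarith) hρ
    (fun z => (H (L.u₁ z) - H (L.u₂ z)) ^ 2) (fun _ => sq_nonneg _)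
  have h2 := sum_sq_grad_le hL x hρδ H hH
  calc _ ≤ (36000000 / κ ^ 6 * (t / δ)) ^ 2 * (450 / κ ^ 2 * (2 * t / δ) ^ 2 *
        (12800 / κ ^ 5 * (δ / ρ) ^ 2 * ∑ u ∈ L.blacks x ρ, H u ^ 2)) := by
        gcongr
        exact h1.trans (by gcongr)
    _ = (36000000 ^ 2 * 450 * 4 * 12800) / κ ^ 19 * (t / δ) ^ 4 * (δ / ρ) ^ 2 *
          ∑ u ∈ L.blacks x ρ, H u ^ 2 := by field_simp; ring
    _ ≤ _ := by gcongr; norm_num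

/-- Telescoping over dyadic scales, with Cauchy–Schwarz for the weights `2⁻ʲ`. The weights cost a
factor `2ʲ`, leaving `8⁻ʲ`; the number of vertices at scale `2ʲ t` grows like `4ʲ`, so the scales
remain summable after summation over the centres. -/
theorem sq_moll_pow_mul_sub_le (hL : L.Fat κ) {t : ℝ} (ht : 2 * δ ≤ t) (J : ℕ) (H : ℂ → ℝ)
    (hH : ∀ u ∈ L.black, ‖u - y‖ < 2 ^ J * t → L.lap H u = 0) :
    (L.moll H (2 ^ J * t) y - L.moll H t y) ^ 2 ≤
      ∑ j ∈ Finset.range J, 10 ^ 17 / κ ^ 10 * (δ / t) ^ 4 * (1 / 8 ^ j) *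
        ∑ u ∈ L.blacks y (4 * (2 ^ j * t)), H u ^ 2 := by
  have hδ := hL.delta_pos
  have hκ := hL.kappa_pos
  have ht0 : 0 < t := by linarith
  have htel : L.moll H (2 ^ J * t) y - L.moll H t y =
      ∑ j ∈ Finset.range J, (L.moll H (2 * (2 ^ j * t)) y - L.moll H (2 ^ j * t) y) := by
    have := Finset.sum_range_sub (fun j => L.moll H (2 ^ j * t) y) J
    simp only [pow_zero, one_mul] at this
    rw [← this]
    exact Finset.sum_congr rfl fun j _ => by rw [pow_succ']; ring_nf
  rw [htel]
  have hcs := Finset.sum_sq_le_sum_mul_sum_of_sq_le_mul (Finset.range J)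
    (f := fun j => (1 / 2 : ℝ) ^ j)
    (g := fun j => 2 ^ j * (L.moll H (2 * (2 ^ j * t)) y - L.moll H (2 ^ j * t) y) ^ 2)
    (r := fun j => (L.moll H (2 * (2 ^ j * t)) y - L.moll H (2 ^ j * t) y))
    (fun _ _ => by positivity) (fun _ _ => by positivity)
    (fun j _ => by rw [one_div, inv_pow, inv_mul_cancel_left₀ (by positivity)])
  refine hcs.trans ?_
  have hg : ∑ j ∈ Finset.range J, (1 / 2 : ℝ) ^ j ≤ 2 := sum_geometric_two_le J
  refine (mul_le_mul_of_nonneg_right hg (Finset.sum_nonneg fun _ _ => by positivity)).trans ?_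
  rw [Finset.mul_sum]
  refine Finset.sum_le_sum fun j hj => ?_
  have hjJ : (2 : ℝ) ^ (j + 1) ≤ 2 ^ J :=
    pow_le_pow_right₀ (by norm_num) (Finset.mem_range.1 hj)
  have h1j : (1 : ℝ) ≤ 2 ^ j := one_le_pow₀ (by norm_num)
  have hs : 2 * δ ≤ 2 ^ j * t := by nlinarith
  have h := abs_moll_two_mul_sub_le hL hs H (y := y) (fun u hu hut => hH u hu (hut.trans_le (by
    calc 2 * (2 ^ j * t) = 2 ^ (j + 1) * t := by ring
      _ ≤ _ := by gcongr)))
  have h2 := sq_sum_abs_le hL y (r := 4 * (2 ^ j * t)) (by linarith) H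
  have e8 : (8 : ℝ) ^ j = (2 ^ j) ^ 3 := by rw [← pow_mul, mul_comm, pow_mul]; norm_num
  rw [← sq_abs, e8]
  set Q := ∑ u ∈ L.blacks y (4 * (2 ^ j * t)), H u ^ 2
  have hQ : 0 ≤ Q := Finset.sum_nonneg fun _ _ => sq_nonneg _
  generalize (2 : ℝ) ^ j = c at *
  calc _ ≤ 2 * (c * (2000000 / κ ^ 4 * (δ / (c * t)) ^ 3 *
        ∑ u ∈ L.blacks y (4 * (c * t)), |H u|) ^ 2) := by gcongr
    _ = 2 * (c * ((2000000 / κ ^ 4 * (δ / (c * t)) ^ 3) ^ 2 *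
        (∑ u ∈ L.blacks y (4 * (c * t)), |H u|) ^ 2)) := by rw [mul_pow]
    _ ≤ 2 * (c * ((2000000 / κ ^ 4 * (δ / (c * t)) ^ 3) ^ 2 *
        (450 / κ ^ 2 * (4 * (c * t) / δ) ^ 2 * Q))) := by gcongr
    _ = (2 * 2000000 ^ 2 * 450 * 16) / κ ^ 10 * (δ / t) ^ 4 * (1 / c ^ 3) * Q := by
        field_simp; ring
    _ ≤ _ := by gcongr; norm_num

theorem sum_sq_moll_pow_mul_sub_le (hL : L.Fat κ) {t R ρ : ℝ} (ht : 2 * δ ≤ t) (J : ℕ)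
    (H : ℂ → ℝ) (hρ : R + 2 * (2 ^ J * t) ≤ ρ)
    (hH : ∀ u ∈ L.black, ‖u - x‖ < ρ → L.lap H u = 0) :
    ∑ y ∈ L.blacks x R, (L.moll H (2 ^ J * t) y - L.moll H t y) ^ 2 ≤
      10 ^ 22 / κ ^ 12 * (δ / t) ^ 2 * ∑ u ∈ L.blacks x ρ, H u ^ 2 := by
  have hδ := hL.delta_pos
  have hκ := hL.kappa_pos
  have ht0 : 0 < t := by linarith
  have hS : 0 ≤ ∑ u ∈ L.blacks x ρ, H u ^ 2 := Finset.sum_nonneg fun _ _ => sq_nonneg _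
  have hpt : ∀ y ∈ L.blacks x R, (L.moll H (2 ^ J * t) y - L.moll H t y) ^ 2 ≤
      ∑ j ∈ Finset.range J, 10 ^ 17 / κ ^ 10 * (δ / t) ^ 4 * (1 / 8 ^ j) *
        ∑ u ∈ L.blacks y (4 * (2 ^ j * t)), H u ^ 2 := by
    intro y hy
    refine sq_moll_pow_mul_sub_le hL ht J H fun u hu huy => hH u hu ?_
    have h1 := norm_add_le (u - y) (y - x)
    rw [sub_add_sub_cancel] at h1
    have : 0 < 2 ^ J * t := by positivity
    linarith [((mem_blacks hL).1 hy).2]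
  refine (Finset.sum_le_sum hpt).trans ?_
  rw [Finset.sum_comm]
  set S := ∑ u ∈ L.blacks x ρ, H u ^ 2
  have hj : ∀ j ∈ Finset.range J, ∑ y ∈ L.blacks x R, 10 ^ 17 / κ ^ 10 * (δ / t) ^ 4 *
      (1 / 8 ^ j) * ∑ u ∈ L.blacks y (4 * (2 ^ j * t)), H u ^ 2 ≤
        10 ^ 21 / κ ^ 12 * (δ / t) ^ 2 * S * (1 / 2) ^ j := by
    intro j hj
    rw [← Finset.mul_sum]
    have hjJ : (2 : ℝ) ^ (j + 1) ≤ 2 ^ J :=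
      pow_le_pow_right₀ (by norm_num) (Finset.mem_range.1 hj)
    have h1j : (1 : ℝ) ≤ 2 ^ j := one_le_pow₀ (by norm_num)
    have h := sum_sum_blacks_le hL (x := x) (r := 4 * (2 ^ j * t)) (R := R) (ρ := ρ)
      (by nlinarith) (by
        refine le_trans ?_ hρ
        have : 4 * (2 ^ j * t) = 2 * (2 ^ (j + 1) * t) := by ring
        rw [this]
        gcongr) (fun u => H u ^ 2) (fun _ => sq_nonneg _)
    have e8 : (8 : ℝ) ^ j = (2 ^ j) ^ 3 := by rw [← pow_mul, mul_comm, pow_mul]; norm_num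
    rw [e8, one_div_pow]
    generalize (2 : ℝ) ^ j = c at *
    calc _ ≤ 10 ^ 17 / κ ^ 10 * (δ / t) ^ 4 * (1 / c ^ 3) *
          (450 / κ ^ 2 * (4 * (c * t) / δ) ^ 2 * S) := by gcongr
      _ = (10 ^ 17 * 450 * 16) / κ ^ 12 * (δ / t) ^ 2 * S * (1 / c) := by
        field_simp; ring
      _ ≤ _ := by gcongr; norm_num
  refine (Finset.sum_le_sum hj).trans ?_
  rw [← Finset.mul_sum]
  have hg : ∑ j ∈ Finset.range J, (1 / 2 : ℝ) ^ j ≤ 2 := sum_geometric_two_le J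
  calc _ ≤ 10 ^ 21 / κ ^ 12 * (δ / t) ^ 2 * S * 2 := by gcongr
    _ = 2 * 10 ^ 21 / κ ^ 12 * (δ / t) ^ 2 * S := by ring
    _ ≤ _ := by gcongr; norm_num

/-! ### Approximation of harmonic functions by quadratic polynomials. -/

theorem norm_bumpG_le {s : ℝ} (hs : 0 < s) (x : ℂ) : ‖bumpG 3 s x‖ ≤ 6 / s := by
  rcases le_or_gt s ‖x‖ with h | h
  · rw [bumpG_eq_zero (by norm_num) hs h, norm_zero]; positivity
  · have h1 := posPart_le_one s x
    have h2 := le_max_right (1 - ‖x‖ ^ 2 / s ^ 2) 0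
    rw [bumpG, norm_mul, Complex.norm_real, Complex.norm_conj, Real.norm_eq_abs, abs_div, abs_mul,
      abs_of_pos (by positivity : 0 < s ^ 2), abs_of_nonneg (pow_nonneg h2 _)]
    calc _ ≤ |-2 * ((3 : ℕ) : ℝ)| * 1 ^ (3 - 1) / s ^ 2 * s := by gcongr
      _ = _ := by
        norm_num
        field_simp

theorem norm_bumpA_le {s : ℝ} (hs : 0 < s) (x : ℂ) : ‖bumpA 3 s x‖ ≤ 6 / s ^ 2 := by
  rcases le_or_gt s ‖x‖ with h | h
  · rw [bumpA_eq_zero (by norm_num) hs h, norm_zero]; positivity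
  · have h1 := posPart_le_one s x
    have h2 := le_max_right (1 - ‖x‖ ^ 2 / s ^ 2) 0
    rw [bumpA, norm_mul, Complex.norm_real, norm_pow, Complex.norm_conj, Real.norm_eq_abs, abs_div,
      abs_mul, abs_of_pos (by positivity : 0 < s ^ 4), abs_of_nonneg (pow_nonneg h2 _)]
    calc _ ≤ |((3 : ℕ) : ℝ) * (((3 : ℕ) : ℝ) - 1)| * 1 ^ (3 - 2) / s ^ 4 * s ^ 2 := by gcongr
      _ = _ := by
        norm_num
        field_simp

/-- A harmonic polynomial of degree at most two. -/
def quad (x : ℂ) (q : ℝ) (b A v : ℂ) : ℝ := q + (b * (v - x)).re + (A * (v - x) ^ 2).re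

theorem quad_add (x : ℂ) (q q' : ℝ) (b b' A A' v : ℂ) :
    quad x (q + q') (b + b') (A + A') v = quad x q b A v + quad x q' b' A' v := by
  simp only [quad, add_mul, Complex.add_re]
  ring

theorem lap_sub (H G : ℂ → ℝ) (u : ℂ) :
    L.lap (fun v => H v - G v) u = L.lap H u - L.lap G u := by
  rw [lap, lap, lap, ← Finset.sum_sub_distrib]
  exact Finset.sum_congr rfl fun z _ => by ring

/-- Taylor expansion of the kernel in its centre `y` around `x`. The value, gradient and trace-free
terms add up to a harmonic quadratic polynomial; the trace term is a pairing of `H` with `bumpB 3`,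
which is small because `H` is harmonic. The condition `δ / s ≤ ν` lets that error be absorbed into
the cubic Taylor error. -/
theorem exists_quad_moll (hL : L.Fat κ) {s ν : ℝ} (hs : 2 * δ ≤ s) (hν : δ / s ≤ ν) (hν1 : ν ≤ 1)
    (x : ℂ) (H : ℂ → ℝ) (hH : ∀ u ∈ L.black, ‖u - x‖ < s → L.lap H u = 0) :
    ∃ (q : ℝ) (b A : ℂ),
      |q| ≤ 100 / κ ^ 2 * (δ / s) ^ 2 * ∑ u ∈ L.blacks x (2 * s), |H u| ∧
      ‖b‖ * s ≤ 600 / κ ^ 2 * (δ / s) ^ 2 * ∑ u ∈ L.blacks x (2 * s), |H u| ∧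
      ‖A‖ * s ^ 2 ≤ 600 / κ ^ 2 * (δ / s) ^ 2 * ∑ u ∈ L.blacks x (2 * s), |H u| ∧
      ∀ y, ‖y - x‖ ≤ ν * s → |L.moll H s y - quad x q b A y| ≤
        4500000 / κ ^ 4 * (δ / s) ^ 2 * ν ^ 3 * ∑ u ∈ L.blacks x (2 * s), |H u| := by
  have hδ := hL.delta_pos
  have hκ := hL.kappa_pos
  have hκ1 := hL.kappa_le_one
  have hs0 : 0 < s := by linarith
  have hν0 : 0 < ν := lt_of_lt_of_le (by positivity) hν
  have hVb := black_of_mem_blacks hL (y := x) (r := 2 * s)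
  set V := L.blacks x (2 * s) with hV
  set T := ∑ u ∈ V, |H u| with hT
  have hT0 : 0 ≤ T := Finset.sum_nonneg fun _ _ => abs_nonneg _
  have hnorm : ∀ (f : ℂ → ℂ) (c : ℝ), (∀ u, ‖f u‖ ≤ c) →
      ‖∑ u ∈ V, ((L.mass u / s ^ 2 * H u : ℝ) : ℂ) * f u‖ ≤ 100 / κ ^ 2 * (δ / s) ^ 2 * c * T := by
    intro f c hf
    rw [Finset.mul_sum]
    refine (norm_sum_le _ _).trans (Finset.sum_le_sum fun u hu => ?_)
    have h1 := mass_pos (hVb u hu)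
    have h2 := mass_le hL (hVb u hu)
    have hc : 0 ≤ c := (norm_nonneg _).trans (hf u)
    rw [norm_mul, Complex.norm_real, Real.norm_eq_abs, abs_mul, abs_of_pos (by positivity)]
    calc _ ≤ 100 / κ ^ 2 * δ ^ 2 / s ^ 2 * |H u| * c := by gcongr; exact hf u
      _ = _ := by field_simp
  refine ⟨L.moll H s x, -∑ u ∈ V, ((L.mass u / s ^ 2 * H u : ℝ) : ℂ) * bumpG 3 s (u - x),
    ∑ u ∈ V, ((L.mass u / s ^ 2 * H u : ℝ) : ℂ) * bumpA 3 s (u - x), ?_, ?_, ?_, fun y hy => ?_⟩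
  · rw [moll_eq_sum hL H hs0 (blacks_mono hL (by linarith)) hVb, Finset.mul_sum]
    refine (Finset.abs_sum_le_sum_abs _ _).trans (Finset.sum_le_sum fun u hu => ?_)
    have h1 := mass_pos (hVb u hu)
    have h2 := mass_le hL (hVb u hu)
    have h3 := bump_nonneg 3 s (u - x)
    have h4 := bump_le_one 3 s (u - x)
    rw [abs_mul, abs_of_nonneg (by positivity)]
    calc _ ≤ 100 / κ ^ 2 * δ ^ 2 * (1 / s ^ 2) * |H u| := by gcongr
      _ = _ := by field_simp
  · rw [norm_neg]
    have := hnorm (fun u => bumpG 3 s (u - x)) _ fun u => norm_bumpG_le hs0 (u - x)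
    calc _ ≤ 100 / κ ^ 2 * (δ / s) ^ 2 * (6 / s) * T * s := by gcongr
      _ = _ := by field_simp; ring
  · have := hnorm (fun u => bumpA 3 s (u - x)) _ fun u => norm_bumpA_le hs0 (u - x)
    calc _ ≤ 100 / κ ^ 2 * (δ / s) ^ 2 * (6 / s ^ 2) * T * s ^ 2 := by gcongr
      _ = _ := by field_simp; ring
  · have hys : ‖y - x‖ ≤ s := hy.trans (by nlinarith)
    have hy' : ‖y - x‖ / s ≤ ν := by rwa [div_le_iff₀ hs0]
    have hBsum := abs_sum_mul_bumpB_le hL (.inl rfl) hs x H hH (V := V) subset_rfl hVb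
    have hBr : L.blacks y s ⊆ V := blacks_subset hL (by linarith)
    have e : L.moll H s y - quad x (L.moll H s x)
        (-∑ u ∈ V, ((L.mass u / s ^ 2 * H u : ℝ) : ℂ) * bumpG 3 s (u - x))
        (∑ u ∈ V, ((L.mass u / s ^ 2 * H u : ℝ) : ℂ) * bumpA 3 s (u - x)) y =
        ∑ u ∈ V, L.mass u / s ^ 2 * H u * (bump 3 s (u - x + -(y - x)) - bump 3 s (u - x) -
          ((bumpG 3 s (u - x) * -(y - x)).re + bumpB 3 s (u - x) * ‖-(y - x)‖ ^ 2 +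
            (bumpA 3 s (u - x) * (-(y - x)) ^ 2).re)) +
        ‖y - x‖ ^ 2 / s ^ 2 * ∑ u ∈ V, L.mass u * bumpB 3 s (u - x) * H u := by
      rw [quad, moll_eq_sum hL H hs0 hBr hVb, moll_eq_sum hL H hs0 (blacks_mono hL (by linarith)) hVb,
        neg_mul, Finset.sum_mul, Finset.sum_mul, Complex.neg_re, Complex.re_sum, Complex.re_sum,
        Finset.mul_sum, ← sub_sub, ← sub_sub, sub_neg_eq_add, ← Finset.sum_sub_distrib,
        ← Finset.sum_add_distrib, ← Finset.sum_sub_distrib, ← Finset.sum_add_distrib]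
      refine Finset.sum_congr rfl fun u _ => ?_
      rw [mul_assoc _ _ (y - x), mul_assoc _ _ ((y - x) ^ 2), Complex.re_ofReal_mul,
        Complex.re_ofReal_mul, norm_neg, neg_sq, mul_neg, Complex.neg_re,
        show u - x + -(y - x) = u - y by ring]
      ring
    rw [e]
    refine (abs_add_le _ _).trans ?_
    have h1 : |∑ u ∈ V, L.mass u / s ^ 2 * H u * (bump 3 s (u - x + -(y - x)) - bump 3 s (u - x) -
          ((bumpG 3 s (u - x) * -(y - x)).re + bumpB 3 s (u - x) * ‖-(y - x)‖ ^ 2 +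
            (bumpA 3 s (u - x) * (-(y - x)) ^ 2).re))| ≤
        100 / κ ^ 2 * (δ / s) ^ 2 * (5000 * ν ^ 3) * T := by
      rw [Finset.mul_sum]
      refine (Finset.abs_sum_le_sum_abs _ _).trans (Finset.sum_le_sum fun u hu => ?_)
      have h1 := mass_pos (hVb u hu)
      have h2 := mass_le hL (hVb u hu)
      have h3 := abs_bump_add_sub_le (k := 3) (.inl rfl) hs0 (x := u - x) (v := -(y - x))
        (by rwa [norm_neg])
      rw [abs_mul, abs_mul, abs_of_pos (by positivity : 0 < L.mass u / s ^ 2)]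
      rw [norm_neg] at h3 ⊢
      calc _ ≤ 100 / κ ^ 2 * δ ^ 2 / s ^ 2 * |H u| * (5000 * (‖y - x‖ / s) ^ 3) := by gcongr
        _ ≤ 100 / κ ^ 2 * δ ^ 2 / s ^ 2 * |H u| * (5000 * ν ^ 3) := by gcongr
        _ = _ := by field_simp
    have h2 : |‖y - x‖ ^ 2 / s ^ 2 * ∑ u ∈ V, L.mass u * bumpB 3 s (u - x) * H u| ≤
        4000000 / κ ^ 4 * (δ / s) ^ 2 * ν ^ 3 * T := by
      rw [abs_mul, abs_of_nonneg (by positivity), ← div_pow]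
      calc _ ≤ ν ^ 2 * (4000000 / κ ^ 4 * (δ / s) ^ 3 * T) := by gcongr
        _ = 4000000 / κ ^ 4 * (δ / s) ^ 2 * (ν ^ 2 * (δ / s)) * T := by ring
        _ ≤ 4000000 / κ ^ 4 * (δ / s) ^ 2 * (ν ^ 2 * ν) * T := by gcongr
        _ = _ := by ring
    refine (add_le_add h1 h2).trans ?_
    have hk : 1 / κ ^ 2 ≤ 1 / κ ^ 4 :=
      one_div_le_one_div_of_le (by positivity) (pow_le_pow_of_le_one hκ.le hκ1 (by norm_num))
    calc _ = (500000 * (1 / κ ^ 2) + 4000000 * (1 / κ ^ 4)) * ((δ / s) ^ 2 * ν ^ 3 * T) := by ring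
      _ ≤ (500000 * (1 / κ ^ 4) + 4000000 * (1 / κ ^ 4)) * ((δ / s) ^ 2 * ν ^ 3 * T) := by gcongr
      _ = _ := by ring

theorem add_four_sq_le (a b c d : ℝ) :
    (a + b + c + d) ^ 2 ≤ 4 * (a ^ 2 + b ^ 2 + c ^ 2 + d ^ 2) := by
  nlinarith [sq_nonneg (a - b), sq_nonneg (a - c), sq_nonneg (a - d), sq_nonneg (b - c),
    sq_nonneg (b - d), sq_nonneg (c - d)]

set_option maxHeartbeats 1600000 in
/-- On a disc whose radius is a small multiple of `ρ`, a discrete harmonic function in the disc of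
radius `ρ` is approximated by a quadratic harmonic polynomial. -/
theorem exists_quad_approx {κ : ℝ} (hκ : 0 < κ) : ∃ C : ℝ, 0 < C ∧ ∀ ν : ℝ, 0 < ν → ν ≤ 1 / 4 →
    ∀ (δ : ℝ) (L : RhombicLattice δ), L.Fat κ → ∀ (x : ℂ) (ρ : ℝ), δ ≤ ν ^ 12 * ρ →
    ∀ H : ℂ → ℝ, (∀ u ∈ L.black, ‖u - x‖ < ρ → L.lap H u = 0) →
    ∃ (q : ℝ) (b A : ℂ), ‖b‖ ^ 2 * ρ ^ 2 ≤ C * (δ / ρ) ^ 2 * ∑ u ∈ L.blacks x ρ, H u ^ 2 ∧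
      ‖A‖ ^ 2 * ρ ^ 4 ≤ C * (δ / ρ) ^ 2 * ∑ u ∈ L.blacks x ρ, H u ^ 2 ∧
      ∑ u ∈ L.blacks x (ν * ρ / 4), (H u - quad x q b A u) ^ 2 ≤
        C * ν ^ 8 * ∑ u ∈ L.blacks x ρ, H u ^ 2 := by
  -- The constants `c1` to `c4` belong to the four errors: variation of the density, mollification
  -- at the small scale, change of scale, and Taylor expansion. The constant `c5` is for the
  -- coefficients.
  obtain ⟨c1, hc1⟩ : ∃ c : ℝ, c = (57600000000 / κ ^ 6) ^ 2 := ⟨_, rfl⟩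
  obtain ⟨c2, hc2⟩ : ∃ c : ℝ, c = 16 * (10 ^ 23 / κ ^ 19) := ⟨_, rfl⟩
  obtain ⟨c3, hc3⟩ : ∃ c : ℝ, c = 10 ^ 22 / κ ^ 12 := ⟨_, rfl⟩
  obtain ⟨c4, hc4⟩ : ∃ c : ℝ, c = (4500000 / κ ^ 4) ^ 2 * (1800 / κ ^ 2) * (450 / κ ^ 2) := ⟨_, rfl⟩
  obtain ⟨c5, hc5⟩ : ∃ c : ℝ, c = 256 * 16 * ((600 / κ ^ 2) ^ 2 * (1800 / κ ^ 2)) := ⟨_, rfl⟩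
  have p1 : 0 < c1 := by rw [hc1]; positivity
  have p2 : 0 < c2 := by rw [hc2]; positivity
  have p3 : 0 < c3 := by rw [hc3]; positivity
  have p4 : 0 < c4 := by rw [hc4]; positivity
  have p5 : 0 < c5 := by rw [hc5]; positivity
  refine ⟨160000 / κ ^ 2 * (4 * (c1 + c2 + c3 + c4) + c5), by positivity, ?_⟩
  intro ν hν hν4 δ L hL x ρ hρ H hH
  have hδ := hL.delta_pos
  have hν12 : 0 < ν ^ 12 := by positivity
  have hρ0 : 0 < ρ := pos_of_mul_pos_right (hδ.trans_le hρ) hν12.le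
  have hS0 : 0 ≤ ∑ u ∈ L.blacks x ρ, H u ^ 2 := Finset.sum_nonneg fun _ _ => sq_nonneg _
  have hv4 : ν ^ 4 ≤ 1 / 256 := by
    calc ν ^ 4 ≤ (1 / 4) ^ 4 := by gcongr
      _ = _ := by norm_num
  have hv8 : ν ^ 8 ≤ 1 / 65536 := by
    calc ν ^ 8 ≤ (1 / 4) ^ 8 := by gcongr
      _ = _ := by norm_num
  have hv48 : ν ^ 12 = ν ^ 4 * ν ^ 8 := by ring
  -- The small scale `t` is the dyadic fraction of `s = ρ / 4` with `ν⁴ t` between `δ` and `2 δ`.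
  -- Then `(δ / t)²` is at most `ν⁸`, while `δ ≤ ν¹² ρ` leaves `(t / δ)⁴ (δ / ρ)²` of order `ν⁸`
  -- too.
  obtain ⟨J, hJ1, hJ2⟩ := exists_nat_pow_near (x := ρ / 4 * ν ^ 4 / δ) (y := 2) (by
    rw [le_div_iff₀ hδ, one_mul]
    refine hρ.trans ?_
    rw [hv48]
    have : 0 < ν ^ 4 * ρ := by positivity
    nlinarith) one_lt_two
  set t := ρ / 4 / 2 ^ J with ht
  set s := ρ / 4 with hs
  have h2J : (0 : ℝ) < 2 ^ J := by positivity
  have hst : 2 ^ J * t = s := by rw [ht]; field_simp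
  rw [le_div_iff₀ hδ] at hJ1
  rw [div_lt_iff₀ hδ, pow_succ] at hJ2
  have ht1 : δ ≤ ν ^ 4 * t := by
    have : 2 ^ J * δ ≤ 2 ^ J * (ν ^ 4 * t) := by
      calc _ ≤ s * ν ^ 4 := hJ1
        _ = _ := by rw [← hst]; ring
    exact le_of_mul_le_mul_left this h2J
  have ht2 : ν ^ 4 * t ≤ 2 * δ := by
    have : 2 ^ J * (ν ^ 4 * t) ≤ 2 ^ J * (2 * δ) := by
      calc _ = s * ν ^ 4 := by rw [← hst]; ring
        _ ≤ _ := hJ2.le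
        _ = _ := by ring
    exact le_of_mul_le_mul_left this h2J
  have ht0 : 0 < t := by positivity
  have hs0 : 0 < s := by positivity
  have ht12 : 12 * δ ≤ t := by nlinarith
  have htρ : t ≤ ρ / 32 := by
    have h1 : ν ^ 4 * t ≤ ν ^ 4 * (2 * ν ^ 8 * ρ) := by
      calc _ ≤ 2 * (ν ^ 12 * ρ) := ht2.trans (by linarith)
        _ = _ := by ring
    have h2 := le_of_mul_le_mul_left h1 (by positivity : 0 < ν ^ 4)
    nlinarith
  have hts : t ≤ s := by linarith
  have hδs : δ ≤ ν ^ 4 * s := ht1.trans (by gcongr)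
  have hν41 : ν ^ 4 ≤ ν := by
    calc ν ^ 4 ≤ ν ^ 1 := pow_le_pow_of_le_one hν.le (by linarith) (by norm_num)
      _ = ν := pow_one _
  have hδs' : δ ≤ ν * s := hδs.trans (by gcongr)
  have hνs : ν * s ≤ ρ / 16 := by nlinarith
  obtain ⟨q, b, A, -, hb, hA, happ⟩ := exists_quad_moll hL (s := s) (ν := ν) (by linarith)
    (by rwa [div_le_iff₀ hs0]) (by linarith) x H
    (fun u hu hus => hH u hu (by linarith))
  have hT2 := sq_sum_abs_le hL x (r := 2 * s) (by linarith) H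
  have hT0 : 0 ≤ ∑ u ∈ L.blacks x (2 * s), |H u| := Finset.sum_nonneg fun _ _ => abs_nonneg _
  set T := ∑ u ∈ L.blacks x (2 * s), |H u| with hT
  have hsubS : ∑ u ∈ L.blacks x (2 * s), H u ^ 2 ≤ ∑ u ∈ L.blacks x ρ, H u ^ 2 :=
    Finset.sum_le_sum_of_subset_of_nonneg (blacks_mono hL (by linarith)) fun _ _ _ => sq_nonneg _
  have hsubN : ∑ u ∈ L.blacks x (ν * s), H u ^ 2 ≤ ∑ u ∈ L.blacks x ρ, H u ^ 2 :=
    Finset.sum_le_sum_of_subset_of_nonneg (blacks_mono hL (by linarith)) fun _ _ _ => sq_nonneg _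
  have hA' := sum_sq_dens_mul_sub_moll_le hL (t := t) (R := ν * s) (ρ := ρ) (x := x) (by linarith)
    (by linarith) (by nlinarith) H hH
  have hB' := sum_sq_moll_pow_mul_sub_le hL (t := t) (R := ν * s) (ρ := ρ) (x := x) (by linarith)
    J H (by rw [hst]; linarith) hH
  rw [hst] at hB'
  set S := ∑ u ∈ L.blacks x ρ, H u ^ 2 with hS
  have hT2' : T ^ 2 ≤ 1800 / κ ^ 2 * (s / δ) ^ 2 * S := by
    calc _ ≤ 450 / κ ^ 2 * (2 * s / δ) ^ 2 * S := hT2.trans (by gcongr)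
      _ = _ := by ring
  set N := L.dens t x with hN
  have hNκ : κ / 400 ≤ N := le_dens hL ht12 x
  have hN0 : 0 < N := lt_of_lt_of_le (by positivity) hNκ
  have hN2 : (1 / N) ^ 2 ≤ 160000 / κ ^ 2 := by
    calc (1 / N) ^ 2 ≤ (1 / (κ / 400)) ^ 2 := by gcongr
      _ = _ := by field_simp; norm_num
  have hcoef : ∀ a : ℝ, 0 ≤ a → a ≤ 600 / κ ^ 2 * (δ / s) ^ 2 * T → 256 * a ^ 2 ≤ c5 * (δ / ρ) ^ 2 * S := by
    intro a ha h
    calc _ ≤ 256 * (600 / κ ^ 2 * (δ / s) ^ 2 * T) ^ 2 := by gcongr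
      _ = 256 * ((600 / κ ^ 2 * (δ / s) ^ 2) ^ 2 * T ^ 2) := by rw [mul_pow]
      _ ≤ 256 * ((600 / κ ^ 2 * (δ / s) ^ 2) ^ 2 * (1800 / κ ^ 2 * (s / δ) ^ 2 * S)) := by gcongr
      _ = _ := by rw [hc5, hs]; field_simp; ring
  have hn1 : ‖(1 / N : ℂ)‖ = 1 / N := by
    rw [norm_div, norm_one, Complex.norm_real, Real.norm_of_nonneg hN0.le]
  have hweak : 160000 / κ ^ 2 * (c5 * (δ / ρ) ^ 2 * S) ≤
      160000 / κ ^ 2 * (4 * (c1 + c2 + c3 + c4) + c5) * (δ / ρ) ^ 2 * S := by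
    have : c5 ≤ 4 * (c1 + c2 + c3 + c4) + c5 := by linarith
    calc _ = 160000 / κ ^ 2 * c5 * (δ / ρ) ^ 2 * S := by ring
      _ ≤ _ := by gcongr
  refine ⟨q / N, (1 / N : ℂ) * b, (1 / N : ℂ) * A, ?_, ?_, ?_⟩
  · have h := hcoef _ (by positivity) hb
    rw [norm_mul, hn1]
    refine le_trans ?_ hweak
    calc _ = (1 / N) ^ 2 * (16 * (‖b‖ * s) ^ 2) := by rw [hs]; ring
      _ ≤ 160000 / κ ^ 2 * (256 * (‖b‖ * s) ^ 2) := by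
          gcongr
          norm_num
      _ ≤ _ := by gcongr
  · have h := hcoef _ (by positivity) hA
    rw [norm_mul, hn1]
    refine le_trans ?_ hweak
    calc _ = (1 / N) ^ 2 * (256 * (‖A‖ * s ^ 2) ^ 2) := by rw [hs]; ring
      _ ≤ 160000 / κ ^ 2 * (256 * (‖A‖ * s ^ 2) ^ 2) := by gcongr
      _ ≤ _ := by gcongr
  · have eνs : ν * ρ / 4 = ν * s := by rw [hs]; ring
    rw [eνs]
    have hpt : ∀ u ∈ L.blacks x (ν * s),
        (H u - quad x (q / N) ((1 / N : ℂ) * b) ((1 / N : ℂ) * A) u) ^ 2 ≤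
        160000 / κ ^ 2 * (4 * (c1 * ν ^ 8 * H u ^ 2 + (L.dens t u * H u - L.moll H t u) ^ 2 +
          (L.moll H s u - L.moll H t u) ^ 2 +
          (4500000 / κ ^ 4 * (δ / s) ^ 2 * ν ^ 3 * T) ^ 2)) := by
      intro u hu
      have hus := ((mem_blacks hL).1 hu).2
      -- The mollification is not normalized, so it is divided by the density `N` at the centre; the
      -- first of the four terms corrects for the density at `u`.
      have e : H u - quad x (q / N) ((1 / N : ℂ) * b) ((1 / N : ℂ) * A) u =
          1 / N * ((N - L.dens t u) * H u + (L.dens t u * H u - L.moll H t u) +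
            -(L.moll H s u - L.moll H t u) + (L.moll H s u - quad x q b A u)) := by
        have e1 : quad x (q / N) ((1 / N : ℂ) * b) ((1 / N : ℂ) * A) u = 1 / N * quad x q b A u := by
          have e2 : (1 / N : ℂ) = ((1 / N : ℝ) : ℂ) := by push_cast; rfl
          rw [quad, quad, e2, mul_assoc, mul_assoc, Complex.re_ofReal_mul, Complex.re_ofReal_mul]
          ring
        rw [e1]
        field_simp
        ring
      rw [e, mul_pow]
      refine mul_le_mul hN2 ((add_four_sq_le _ _ _ _).trans ?_) (sq_nonneg _) (by positivity)
      have i1 : ((N - L.dens t u) * H u) ^ 2 ≤ c1 * ν ^ 8 * H u ^ 2 := by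
        have h1 := abs_dens_sub_dens_le hL (t := t) (by linarith) x u
        have h2 : δ / t ≤ ν ^ 4 := by rwa [div_le_iff₀ ht0]
        rw [mul_pow, ← sq_abs (N - _)]
        calc _ ≤ (57600000000 / κ ^ 6 * ν ^ 4) ^ 2 * H u ^ 2 := by
              gcongr
              exact h1.trans (by gcongr)
          _ = _ := by rw [hc1]; ring
      have i4 : (L.moll H s u - quad x q b A u) ^ 2 ≤
          (4500000 / κ ^ 4 * (δ / s) ^ 2 * ν ^ 3 * T) ^ 2 := by
        rw [← sq_abs]
        have := happ u hus.le
        gcongr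
      rw [neg_sq]
      gcongr
    refine (Finset.sum_le_sum hpt).trans ?_
    rw [← Finset.mul_sum, ← Finset.mul_sum, Finset.sum_add_distrib, Finset.sum_add_distrib,
      Finset.sum_add_distrib, ← Finset.mul_sum, Finset.sum_const, nsmul_eq_mul]
    have k1 : c1 * ν ^ 8 * ∑ u ∈ L.blacks x (ν * s), H u ^ 2 ≤ c1 * ν ^ 8 * S := by gcongr
    have k2 : ∑ u ∈ L.blacks x (ν * s), (L.dens t u * H u - L.moll H t u) ^ 2 ≤ c2 * ν ^ 8 * S := by
      have h1 : t / δ ≤ 2 / ν ^ 4 := by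
        rw [div_le_div_iff₀ hδ (by positivity)]
        linarith
      have h2 : δ / ρ ≤ ν ^ 12 := by rwa [div_le_iff₀ hρ0]
      calc _ ≤ 10 ^ 23 / κ ^ 19 * (2 / ν ^ 4) ^ 4 * (ν ^ 12) ^ 2 * S := hA'.trans (by gcongr)
        _ = _ := by rw [hc2]; field_simp; ring
    have k3 : ∑ u ∈ L.blacks x (ν * s), (L.moll H s u - L.moll H t u) ^ 2 ≤ c3 * ν ^ 8 * S := by
      have h2 : δ / t ≤ ν ^ 4 := by rwa [div_le_iff₀ ht0]
      calc _ ≤ 10 ^ 22 / κ ^ 12 * (ν ^ 4) ^ 2 * S := hB'.trans (by gcongr)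
        _ = _ := by rw [hc3]; ring
    -- The squared Taylor error contributes `ν⁶`, and the area of the small disc the remaining `ν²`.
    have k4 : ((L.blacks x (ν * s)).card : ℝ) * (4500000 / κ ^ 4 * (δ / s) ^ 2 * ν ^ 3 * T) ^ 2 ≤
        c4 * ν ^ 8 * S := by
      have hc := card_blacks_le hL x hδs'
      calc _ ≤ 450 / κ ^ 2 * (ν * s / δ) ^ 2 * (4500000 / κ ^ 4 * (δ / s) ^ 2 * ν ^ 3 * T) ^ 2 := by
            gcongr
        _ = 450 / κ ^ 2 * (ν * s / δ) ^ 2 * ((4500000 / κ ^ 4 * (δ / s) ^ 2 * ν ^ 3) ^ 2 * T ^ 2) := by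
            rw [mul_pow _ T]
        _ ≤ 450 / κ ^ 2 * (ν * s / δ) ^ 2 * ((4500000 / κ ^ 4 * (δ / s) ^ 2 * ν ^ 3) ^ 2 *
              (1800 / κ ^ 2 * (s / δ) ^ 2 * S)) := by gcongr
        _ = _ := by rw [hc4]; field_simp
    calc _ ≤ 160000 / κ ^ 2 * (4 * (c1 * ν ^ 8 * S + c2 * ν ^ 8 * S + c3 * ν ^ 8 * S +
          c4 * ν ^ 8 * S)) := by gcongr
      _ = 160000 / κ ^ 2 * (4 * (c1 + c2 + c3 + c4)) * ν ^ 8 * S := by ring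
      _ ≤ _ := by gcongr; linarith

/-- A discrete harmonic function in the disc of radius `R` is approximated by a quadratic harmonic
polynomial near the centre of the disc. -/
theorem exists_quad_approx_center {κ : ℝ} (hκ : 0 < κ) : ∃ C K : ℝ, 0 < C ∧ 1 ≤ K ∧
    ∀ (δ : ℝ) (L : RhombicLattice δ), L.Fat κ → ∀ (x : ℂ) (R : ℝ), K * δ ≤ R →
    ∀ (H : ℂ → ℝ) (B : ℝ), (∀ u ∈ L.black, ‖u - x‖ < R → L.lap H u = 0) → 0 ≤ B →
    ∑ u ∈ L.blacks x R, H u ^ 2 ≤ B ^ 2 →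
    ∃ (q : ℝ) (b A : ℂ), ‖A‖ ≤ C * (δ / R ^ 3 * B) ∧
      ∀ u ∈ L.black, ‖u - x‖ < 20 * δ → (H u - quad x q b A u) ^ 2 ≤ C * (δ / R) ^ 7 * B ^ 2 := by
  obtain ⟨C₀, hC₀, happ⟩ := exists_quad_approx hκ
  -- With `ν = 4 σ²` each step shrinks the radius by `σ²` and the squared error by `C₀ ν⁸`,
  -- nominally `σ¹⁶`. Two powers of `σ` are given up to absorb the constant, leaving `σ¹⁴`.
  obtain ⟨σ, hσ⟩ : ∃ σ, σ = 1 / (4 ^ 4 * (C₀ + 1)) := ⟨_, rfl⟩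
  have hσ0 : 0 < σ := by rw [hσ]; positivity
  have hσ1 : σ ≤ 1 / 256 := by
    rw [hσ]
    apply one_div_le_one_div_of_le (by norm_num)
    linarith
  have hσC : C₀ * (4 * σ ^ 2) ^ 8 ≤ σ ^ 14 := by
    have : C₀ * 4 ^ 8 * σ ^ 2 ≤ 1 := by
      rw [hσ, div_pow, one_pow, mul_one_div, div_le_one (by positivity)]
      nlinarith [sq_nonneg C₀]
    calc _ = (C₀ * 4 ^ 8 * σ ^ 2) * σ ^ 14 := by ring
      _ ≤ 1 * σ ^ 14 := by gcongr
      _ = _ := one_mul _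
  have hσsq : 4 * σ ^ 2 ≤ 1 / 4 := by nlinarith
  obtain ⟨K, hK⟩ : ∃ K, K = 20 / σ ^ 2 + 1 / (4 * σ ^ 2) ^ 12 := ⟨_, rfl⟩
  have hK1 : 20 / σ ^ 2 ≤ K := by
    have : 0 < 1 / (4 * σ ^ 2) ^ 12 := by positivity
    linarith
  have hK2 : 1 / (4 * σ ^ 2) ^ 12 ≤ K := by
    have : 0 < 20 / σ ^ 2 := by positivity
    linarith
  have hK3 : 1 ≤ K := by
    refine le_trans ?_ hK1
    rw [le_div_iff₀ (by positivity)]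
    nlinarith
  have hK0 : 0 < K := by linarith
  refine ⟨2 * (C₀ + 1) + K ^ 7, K, by positivity, hK3, ?_⟩
  intro δ L hL x R hR H B hH hB hHB
  have hδ := hL.delta_pos
  have hR0 : 0 < R := lt_of_lt_of_le (by positivity) hR
  obtain ⟨D, hD⟩ : ∃ D, D = (C₀ + 1) * (δ / R ^ 3 * B) := ⟨_, rfl⟩
  have hD0 : 0 ≤ D := by rw [hD]; positivity
  -- The iteration stops just below radius `K δ`; as `K ≥ 20 / σ²`, the last disc still contains the
  -- disc of radius `20 δ`.
  obtain ⟨n, hn1, hn2⟩ := exists_nat_pow_near_of_lt_one (x := K * δ / R) (y := σ ^ 2)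
    (by positivity) (by rwa [div_le_one hR0]) (by positivity) (by nlinarith)
  rw [lt_div_iff₀ hR0] at hn1
  have key : ∀ k ≤ n + 1, ∃ (q : ℝ) (b A : ℂ), ‖A‖ ≤ D * ∑ j ∈ Finset.range k, σ ^ j ∧
      ∑ u ∈ L.blacks x ((σ ^ 2) ^ k * R), (H u - quad x q b A u) ^ 2 ≤ σ ^ (14 * k) * B ^ 2 := by
    intro k
    induction k with
    | zero =>
      intro _
      refine ⟨0, 0, 0, by simp, ?_⟩
      simpa [quad] using hHB
    | succ k ih =>
      intro hk
      obtain ⟨q, b, A, hA, hS⟩ := ih (by omega)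
      have hρ0 : 0 < (σ ^ 2) ^ k * R := by positivity
      have hρ : K * δ ≤ (σ ^ 2) ^ k * R := by
        rw [← div_le_iff₀ hR0]
        exact hn2.trans (pow_le_pow_of_le_one (by positivity) (by nlinarith) (by omega))
      have hharm : ∀ u ∈ L.black, ‖u - x‖ < (σ ^ 2) ^ k * R →
          L.lap (fun v => H v - quad x q b A v) u = 0 := by
        intro u hu hux
        have h1 : (σ ^ 2) ^ k ≤ 1 := pow_le_one₀ (by positivity) (by nlinarith)
        have h2 : L.lap (fun v => quad x q b A v) u = 0 := lap_quadratic hL hu x q b A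
        rw [lap_sub, hH u hu (hux.trans_le (by nlinarith)), h2, sub_zero]
      obtain ⟨q', b', A', -, hA', hS'⟩ := happ (4 * σ ^ 2) (by positivity) hσsq δ L hL x
        ((σ ^ 2) ^ k * R) (by
          rw [div_le_iff₀ (by positivity)] at hK2
          have : K * δ * (4 * σ ^ 2) ^ 12 ≤ (σ ^ 2) ^ k * R * (4 * σ ^ 2) ^ 12 := by gcongr
          nlinarith) (fun v => H v - quad x q b A v) hharm
      refine ⟨q + q', b + b', A + A', ?_, ?_⟩
      · rw [Finset.sum_range_succ, mul_add]
        refine (norm_add_le _ _).trans (add_le_add hA ?_)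
        -- The `k`-th correction is of order `δ B σ^(7 k) / ρ³` with `ρ = σ^(2 k) R`, that is `δ B /
        -- R³` times `σ^k`. Because `7 > 6`, the corrections of the second order coefficient are
        -- summable.
        rw [← pow_le_pow_iff_left₀ (norm_nonneg _) (by positivity) two_ne_zero]
        have h1 : ‖A'‖ ^ 2 * ((σ ^ 2) ^ k * R) ^ 4 ≤
            (C₀ + 1) ^ 2 * (δ / ((σ ^ 2) ^ k * R)) ^ 2 * (σ ^ (14 * k) * B ^ 2) := by
          refine hA'.trans ?_
          have : C₀ ≤ (C₀ + 1) ^ 2 := by nlinarith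
          gcongr
        have e14 : σ ^ (14 * k) = (σ ^ k) ^ 14 := by rw [← pow_mul, mul_comm]
        have e2 : (σ ^ 2) ^ k = (σ ^ k) ^ 2 := by rw [← pow_mul, ← pow_mul, mul_comm]
        rw [e14, e2] at h1
        have hk0 : 0 < σ ^ k := by positivity
        rw [← le_div_iff₀ (by positivity)] at h1
        refine h1.trans_eq ?_
        rw [hD]
        field_simp
      · have e1 : 4 * σ ^ 2 * ((σ ^ 2) ^ k * R) / 4 = (σ ^ 2) ^ (k + 1) * R := by ring
        rw [e1] at hS'
        have e2 : ∀ u, H u - quad x (q + q') (b + b') (A + A') u =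
            H u - quad x q b A u - quad x q' b' A' u := fun u => by rw [quad_add]; ring
        simp only [e2]
        refine hS'.trans ?_
        calc _ ≤ σ ^ 14 * (σ ^ (14 * k) * B ^ 2) := by gcongr
          _ = _ := by ring
  obtain ⟨q, b, A, hA, hS⟩ := key (n + 1) le_rfl
  refine ⟨q, b, A, ?_, fun u hu hux => ?_⟩
  · have hg : ∑ j ∈ Finset.range (n + 1), σ ^ j ≤ 2 := by
      refine le_trans ?_ (sum_geometric_two_le (n + 1))
      gcongr
      linarith
    calc ‖A‖ ≤ D * 2 := hA.trans (by gcongr)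
      _ = 2 * (C₀ + 1) * (δ / R ^ 3 * B) := by rw [hD]; ring
      _ ≤ _ := by
        have : 0 ≤ K ^ 7 := by positivity
        gcongr
        linarith
  · have hmem : u ∈ L.blacks x ((σ ^ 2) ^ (n + 1) * R) := by
      rw [mem_blacks hL]
      refine ⟨hu, hux.trans_le ?_⟩
      rw [div_le_iff₀ (by positivity)] at hK1
      have h1 : K * δ ≤ (σ ^ 2) ^ n * R := by rwa [← div_le_iff₀ hR0]
      calc 20 * δ ≤ K * σ ^ 2 * δ := by gcongr
        _ = K * δ * σ ^ 2 := by ring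
        _ ≤ (σ ^ 2) ^ n * R * σ ^ 2 := by gcongr
        _ = _ := by ring
    -- At the lattice scale the pointwise error is bounded by the whole sum of squares, with no
    -- loss.
    refine (Finset.single_le_sum (f := fun u => (H u - quad x q b A u) ^ 2)
      (fun _ _ => sq_nonneg _) hmem).trans (hS.trans ?_)
    have e : σ ^ (14 * (n + 1)) = ((σ ^ 2) ^ (n + 1)) ^ 7 := by
      rw [← pow_mul, ← pow_mul]
      congr 1
      ring
    have h1 : (σ ^ 2) ^ (n + 1) ≤ K * (δ / R) := by
      rw [← mul_div_assoc, le_div_iff₀ hR0]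
      exact hn1.le
    rw [e]
    calc _ ≤ (K * (δ / R)) ^ 7 * B ^ 2 := by gcongr
      _ = K ^ 7 * (δ / R) ^ 7 * B ^ 2 := by ring
      _ ≤ _ := by
        gcongr
        linarith

/-- A discrete harmonic function with bounded gradient is affine near the centre of a large disc, up
to a small error. -/
theorem exists_affine_approx {κ : ℝ} (hκ : 0 < κ) : ∃ C K : ℝ, 0 < C ∧ 1 ≤ K ∧
    ∀ (δ : ℝ) (L : RhombicLattice δ), L.Fat κ → ∀ x ∈ L.black, ∀ R : ℝ, K * δ ≤ R →
    ∀ (H : ℂ → ℝ) (M : ℝ), (∀ u ∈ L.black, ‖u - x‖ < R → L.lap H u = 0) → 0 ≤ M →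
    (∀ z ∈ L.diamond, ‖z - x‖ < R + 2 * δ → |H (L.u₂ z) - H (L.u₁ z)| ≤ 2 * δ * M) →
    ∃ b : ℂ, ∀ z ∈ L.diamond, ‖z - x‖ ≤ 10 * δ →
      |H (L.u₂ z) - H (L.u₁ z) - (b * (L.u₂ z - L.u₁ z)).re| ≤ C * (M * δ ^ 2 / R) := by
  obtain ⟨C, K, hC, hK, happ⟩ := exists_quad_approx_center hκ
  obtain ⟨E, hE⟩ : ∃ E, E = 450 / κ ^ 2 * (1600 / κ ^ 2) := ⟨_, rfl⟩
  have hE0 : 0 < E := by rw [hE]; positivity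
  refine ⟨2 * ((C + 1) * E) + 40 * C * E, K + 2, by positivity, by linarith, ?_⟩
  intro δ L hL x hx R hR H M hH hM hgrad
  have hδ := hL.delta_pos
  have hκ1 := hL.kappa_le_one
  have hR2 : 2 * δ ≤ R := by nlinarith
  have hR0 : 0 < R := by linarith
  -- Integrating the gradient bound along tubes makes the oscillation of `H` of order `R M`. Over
  -- about `(R / δ)²` vertices this gives an `ℓ²` norm of order `R² M / δ`.
  have hosc : ∀ u ∈ L.blacks x R, |H u - H x| ≤ 1600 / κ ^ 2 * (R * M) := by
    intro u hu
    obtain ⟨hub, hur⟩ := (mem_blacks hL).1 hu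
    have h := norm_sub_le_card_tube hL hx hub H (ε := 2 * δ * M) (fun z hz => by
      rw [norm_sub_rev]
      exact hgrad z ((mem_tube hL).1 hz).1
        (norm_center_sub_lt_of_mem_tube hL (c := x) (by simpa using hR0) hur hz))
    rw [abs_sub_comm]
    have hc := card_tube_le hL x u
    have h2 : ‖u - x‖ / δ + 2 ≤ 2 * (R / δ) := by
      have : ‖u - x‖ / δ ≤ R / δ := by gcongr
      have : 2 ≤ R / δ := by rwa [le_div_iff₀ hδ]
      linarith
    calc _ ≤ 400 / κ ^ 2 * (2 * (R / δ)) * (2 * δ * M) := h.trans (by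
          gcongr
          exact hc.trans (by gcongr))
      _ = _ := by field_simp; ring
  have hsum : ∑ u ∈ L.blacks x R, (H u - H x) ^ 2 ≤ (E * (R ^ 2 / δ * M)) ^ 2 := by
    have hb : ∀ u ∈ L.blacks x R, (H u - H x) ^ 2 ≤ (1600 / κ ^ 2 * (R * M)) ^ 2 := by
      intro u hu
      rw [← sq_abs]
      have := hosc u hu
      gcongr
    refine (Finset.sum_le_card_nsmul _ _ _ hb).trans ?_
    rw [nsmul_eq_mul]
    have hk : 1 ≤ 450 / κ ^ 2 := by
      rw [le_div_iff₀ (by positivity)]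
      nlinarith
    calc _ ≤ 450 / κ ^ 2 * (R / δ) ^ 2 * (1600 / κ ^ 2 * (R * M)) ^ 2 := by
          gcongr
          exact card_blacks_le hL x (by linarith)
      _ ≤ 450 / κ ^ 2 * (450 / κ ^ 2) * (R / δ) ^ 2 * (1600 / κ ^ 2 * (R * M)) ^ 2 := by
          gcongr
          exact le_mul_of_one_le_right (by positivity) hk
      _ = _ := by rw [hE]; ring
  obtain ⟨q, b, A, hA, hq⟩ := happ δ L hL x R (by nlinarith) (fun u => H u - H x)
    (E * (R ^ 2 / δ * M)) (fun u hu hux => by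
      rw [lap_sub, hH u hu hux, lap_const, sub_zero]) (by positivity) hsum
  refine ⟨b, fun z hz hzx => ?_⟩
  have hclose : ∀ u ∈ L.black, ‖u - x‖ < 20 * δ →
      |H u - H x - quad x q b A u| ≤ (C + 1) * E * (M * δ ^ 2 / R) := by
    intro u hu hux
    rw [← abs_of_nonneg (by positivity : 0 ≤ (C + 1) * E * (M * δ ^ 2 / R)), ← sq_le_sq]
    refine (hq u hu hux).trans ?_
    have h1 : δ / R ≤ 1 := by rw [div_le_one hR0]; linarith
    have h2 : C ≤ (C + 1) ^ 2 := by nlinarith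
    -- The exponent `7` leaves one more power of `δ / R` than required, which is simply discarded.
    calc _ = C * ((δ / R) ^ 3 * E ^ 2 * (M ^ 2 * δ ^ 2)) := by field_simp
      _ ≤ (C + 1) ^ 2 * ((δ / R) ^ 2 * E ^ 2 * (M ^ 2 * δ ^ 2)) := by
        have h3 : (δ / R) ^ 3 ≤ (δ / R) ^ 2 :=
          pow_le_pow_of_le_one (by positivity) h1 (by norm_num)
        gcongr
      _ = _ := by ring
  have hn1 : ‖L.u₁ z - x‖ < 20 * δ := by
    have h1 := norm_sub_center_le (isBlackVertex_u₁ hz)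
    have h2 := norm_add_le (L.u₁ z - z) (z - x)
    rw [sub_add_sub_cancel] at h2
    linarith
  have hn2 : ‖L.u₂ z - x‖ < 20 * δ := by
    have h1 := norm_sub_center_le (isBlackVertex_u₂ hz)
    have h2 := norm_add_le (L.u₂ z - z) (z - x)
    rw [sub_add_sub_cancel] at h2
    linarith
  have k1 := hclose _ (isBlackVertex_u₁ hz).mem_black hn1
  have k2 := hclose _ (isBlackVertex_u₂ hz).mem_black hn2
  -- On an edge with midpoint `z`, the quadratic term changes by `A (u₂ - u₁) 2 (z - x)`. As `A` is
  -- of order `M / R`, this fits into the affine error.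
  have hAz : |(A * ((L.u₂ z - L.u₁ z) * (2 * (z - x)))).re| ≤ 40 * C * E * (M * δ ^ 2 / R) := by
    refine (Complex.abs_re_le_norm _).trans ?_
    rw [norm_mul, norm_mul, norm_mul]
    have h1 := diag_le hz
    calc _ ≤ C * (δ / R ^ 3 * (E * (R ^ 2 / δ * M))) * (2 * δ * (2 * (10 * δ))) := by
          gcongr
          simp
      _ = _ := by field_simp; ring
  have e : H (L.u₂ z) - H (L.u₁ z) - (b * (L.u₂ z - L.u₁ z)).re =
      (H (L.u₂ z) - H x - quad x q b A (L.u₂ z)) - (H (L.u₁ z) - H x - quad x q b A (L.u₁ z)) +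
        (A * ((L.u₂ z - L.u₁ z) * (2 * (z - x)))).re := by
    have e1 : A * ((L.u₂ z - L.u₁ z) * (2 * (z - x))) =
        A * (L.u₂ z - x) ^ 2 - A * (L.u₁ z - x) ^ 2 := by
      have := black_add_black hz
      linear_combination (-A * (L.u₂ z - L.u₁ z)) * this
    have e2 : (b * (L.u₂ z - L.u₁ z)).re = (b * (L.u₂ z - x)).re - (b * (L.u₁ z - x)).re := by
      rw [← Complex.sub_re]
      congr 1
      ring
    rw [e1, e2, Complex.sub_re, quad, quad]
    ring
  rw [e]
  refine (abs_add_le _ _).trans ((add_le_add (abs_sub _ _) hAz).trans ?_)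
  calc _ ≤ (C + 1) * E * (M * δ ^ 2 / R) + (C + 1) * E * (M * δ ^ 2 / R) +
        40 * C * E * (M * δ ^ 2 / R) := by gcongr
    _ = _ := by ring

/-! ### From discrete holomorphic functions to harmonic potentials. -/

theorem proj_conj (x ξ : ℂ) : proj x (conj ξ) = (((x * ξ).re / ‖ξ‖ ^ 2 : ℝ) : ℂ) * conj ξ := by
  rw [proj, Submodule.starProjection_singleton, Complex.real_smul, Complex.norm_conj, Complex.inner,
    Complex.conj_conj]
  rfl

theorem proj_conj_neg (x ξ : ℂ) : proj x (conj (-ξ)) = proj x (conj ξ) := by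
  rw [proj_conj, proj_conj, map_neg, norm_neg, mul_neg, mul_neg, Complex.neg_re,
    neg_div, Complex.ofReal_neg, neg_mul, neg_neg]

theorem proj_sub (x y ξ : ℂ) : proj (x - y) ξ = proj x ξ - proj y ξ := map_sub _ x y

theorem norm_proj_le (x ξ : ℂ) : ‖proj x ξ‖ ≤ ‖x‖ := Submodule.norm_starProjection_apply_le _ x

theorem weightDiamond_eq_area (hz : z ∈ L.diamond) : L.weightDiamond z = L.area z := by
  have h1 := L.side₁ z hz
  have h2 := L.side₄ z hz
  rw [norm_sub_rev] at h2
  have h := InnerProductGeometry.sin_angle_mul_norm_mul_norm (L.w₁ z - L.u₁ z) (L.w₂ z - L.u₁ z)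
  have e : inner ℝ (L.w₁ z - L.u₁ z) (L.w₁ z - L.u₁ z) * inner ℝ (L.w₂ z - L.u₁ z) (L.w₂ z - L.u₁ z) -
      inner ℝ (L.w₁ z - L.u₁ z) (L.w₂ z - L.u₁ z) * inner ℝ (L.w₁ z - L.u₁ z) (L.w₂ z - L.u₁ z) =
      L.area z ^ 2 := by
    simp only [Complex.inner, area, cross, Complex.mul_re, Complex.conj_re, Complex.conj_im]
    ring
  rw [e, Real.sqrt_sq (area_pos hz).le, h1, h2] at h
  rw [weightDiamond, θ, mul_div_cancel₀ _ two_ne_zero, ← h]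
  ring

theorem nonempty_diamond (L : RhombicLattice δ) : L.diamond.Nonempty :=
  let ⟨z, hz, _⟩ := L.cover 0
  ⟨z, hz⟩

/-- The angle bound enters the proof only through this area bound: on `[η, π - η]` the sine is
smallest at the ends. Positivity of `sin η` comes from the existence of a rhombus, which forces `η ≤
π - η`. -/
theorem AnglesBounded.fat {η : ℝ} (h : L.AnglesBounded η) (hη : 0 < η) (hδ : 0 < δ) :
    L.Fat (Real.sin η) := by
  have hle : ∀ z ∈ L.diamond, Real.sin η ≤ Real.sin (2 * L.θ z) := by
    intro z hz
    obtain ⟨h1, h2⟩ := h z hz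
    rcases le_total (2 * L.θ z) (Real.pi / 2) with h3 | h3
    · exact Real.sin_le_sin_of_le_of_le_pi_div_two (by linarith [Real.pi_pos]) h3 h1
    · rw [← Real.sin_pi_sub (2 * L.θ z)]
      exact Real.sin_le_sin_of_le_of_le_pi_div_two (by linarith [Real.pi_pos]) (by linarith)
        (by linarith)
  obtain ⟨z₀, hz₀⟩ := nonempty_diamond L
  obtain ⟨h1, h2⟩ := h z₀ hz₀
  refine ⟨hδ, Real.sin_pos_of_pos_of_lt_pi hη (by linarith), fun z hz => ?_⟩
  rw [← weightDiamond_eq_area hz, weightDiamond, mul_comm]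
  exact mul_le_mul_of_nonneg_left (hle z hz) (sq_nonneg δ)

theorem coe_starFinset (v : ℂ) : (L.starFinset v : Set ℂ) = L.star v := Set.Finite.coe_toFinset _

theorem starFinset_subset : z ∈ L.starFinset w → z ∈ L.diamond := by
  rw [← Finset.mem_coe, coe_starFinset]
  exact fun h => h.1

theorem finsum_star {E : Type*} [AddCommMonoid E] (f : ℂ → E) (v : ℂ) :
    ∑ᶠ z ∈ L.star v, f z = ∑ z ∈ L.starFinset v, f z := by
  rw [← coe_starFinset, finsum_mem_coe_finset]

theorem four_mul_weightVertex (v : ℂ) : 4 * L.weightVertex v = L.mass v := by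
  rw [weightVertex, finsum_star, mass,
    Finset.sum_congr rfl fun z hz => weightDiamond_eq_area (starFinset_subset hz)]
  ring

theorem average_eq (F : ℂ → ℂ) (v : ℂ) :
    L.average F v = (1 / (L.mass v : ℂ)) * ∑ z ∈ L.starFinset v, (L.area z : ℂ) * F z := by
  rw [average, finsum_star, ← four_mul_weightVertex]
  push_cast
  congr 1
  exact Finset.sum_congr rfl fun z hz => by rw [weightDiamond_eq_area (starFinset_subset hz)]

theorem average_sub (F G : ℂ → ℂ) (v : ℂ) :
    L.average (fun z => F z - G z) v = L.average F v - L.average G v := by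
  rw [average_eq, average_eq, average_eq, ← mul_sub, ← Finset.sum_sub_distrib]
  simp only [mul_sub]

theorem norm_average_le (hu : u ∈ L.black) {F : ℂ → ℂ} {M : ℝ}
    (hF : ∀ z, L.IsBlackVertex u z → ‖F z‖ ≤ M) : ‖L.average F u‖ ≤ M := by
  have hm := mass_pos hu
  have h : ‖∑ z ∈ L.starFinset u, (L.area z : ℂ) * F z‖ ≤ L.mass u * M := by
    rw [mass, Finset.sum_mul]
    refine (norm_sum_le _ _).trans (Finset.sum_le_sum fun z hz => ?_)
    have hz := (mem_starFinset hu).1 hz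
    have ha := area_pos hz.1
    rw [norm_mul, Complex.norm_real, Real.norm_of_nonneg ha.le]
    gcongr
    exact hF z hz
  rw [average_eq, norm_mul, norm_div, norm_one, Complex.norm_real, Real.norm_of_nonneg hm.le,
    one_div, inv_mul_le_iff₀ hm]
  exact h

/-- For an edge vector `ξ`, `Pr[b; conj ξ] = b / 2 + conj b conj ξ / (2 ξ)`. Multiplied by the area
`cond |ξ|² / 2`, the second summand becomes a constant times the conjugate of `cond ξ²`, and these
sum to zero. -/
theorem two_mul_average_proj (hL : L.Fat κ) (hu : u ∈ L.black) (b : ℂ) :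
    2 * L.average (fun z => proj b (conj (L.u₂ z - L.u₁ z))) u = b := by
  have hm : (L.mass u : ℂ) ≠ 0 := Complex.ofReal_ne_zero.2 (mass_pos hu).ne'
  have hterm : ∀ z ∈ L.starFinset u, (L.area z : ℂ) * proj b (conj (L.u₂ z - L.u₁ z)) =
      (L.area z : ℂ) * (b / 2) + conj b / 4 * conj ((L.cond z : ℂ) * (opp u z - u) ^ 2) := by
    intro z hz
    have hz := (mem_starFinset hu).1 hz
    have e : proj b (conj (L.u₂ z - L.u₁ z)) = proj b (conj (opp u z - u)) := by
      obtain ⟨hzd, rfl | rfl⟩ := hz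
      · rw [opp_u₁ hzd]
      · rw [opp_u₂ hzd, ← proj_conj_neg, neg_sub]
    have hd : ‖opp u z - u‖ ≠ 0 := by rw [← hz.norm_diag]; exact (diag_pos hz.1).ne'
    have hc := hz.cond_mul_sq
    rw [e, proj_conj]
    generalize opp u z - u = ξ at *
    have h1 : (L.area z : ℂ) = L.cond z * (ξ * conj ξ) / 2 := by
      rw [Complex.mul_conj, Complex.normSq_eq_norm_sq, ← Complex.ofReal_mul, hc]
      push_cast
      ring
    have h2 : (((b * ξ).re / ‖ξ‖ ^ 2 : ℝ) : ℂ) = (b * ξ + conj b * conj ξ) / 2 / (ξ * conj ξ) := by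
      rw [Complex.mul_conj, Complex.normSq_eq_norm_sq, Complex.ofReal_div, Complex.re_eq_add_conj,
        map_mul]
    have hξ : ξ ≠ 0 := norm_ne_zero_iff.1 hd
    have hξ' : conj ξ ≠ 0 := (map_ne_zero _).2 hξ
    rw [h1, h2, map_mul, map_pow, Complex.conj_ofReal]
    field_simp
    ring
  rw [average_eq, Finset.sum_congr rfl hterm, Finset.sum_add_distrib, ← Finset.mul_sum,
    ← Finset.sum_mul, ← map_sum, sum_cond_mul_sq hL hu, map_zero, mul_zero, add_zero,
    ← Complex.ofReal_sum, ← mass]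
  field_simp

theorem IsBlackVertex.weightEdge (hu : L.IsBlackVertex u z) :
    L.weightEdge u z = (L.cond z : ℂ) * (RhombicLattice.opp u z - u) := by
  rw [hu.cond_mul]
  obtain ⟨hz, rfl | rfl⟩ := hu
  · rw [next_u₁, prev_u₁, RhombicLattice.weightEdge, if_pos rfl]
  · have h1 : L.u₂ z ≠ L.w₁ z := (isBlackVertex_u₂ hz).ne (isWhiteVertex_w₁ hz)
    rw [next_u₂ hz, prev_u₂ hz, RhombicLattice.weightEdge, if_neg (u₁_ne_u₂ hz).symm, if_neg h1,
      if_pos rfl]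

open Classical in
theorem IsWhiteVertex.weightEdge (hw : L.IsWhiteVertex w z) :
    L.weightEdge w z = Complex.I * (if w = L.w₁ z then L.u₂ z - L.u₁ z else -(L.u₂ z - L.u₁ z)) := by
  have hz := hw.1
  have h1 : w ≠ L.u₁ z := ((isBlackVertex_u₁ hz).ne hw).symm
  have h2 : w ≠ L.u₂ z := ((isBlackVertex_u₂ hz).ne hw).symm
  rw [RhombicLattice.weightEdge, if_neg h1]
  by_cases h : w = L.w₁ z
  · rw [if_pos h, if_pos h]
  · rw [if_neg h, if_neg h2, if_pos (hw.2.resolve_left h), if_neg h, neg_sub]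

theorem sum_weightEdge_eq_zero {F : ℂ → ℂ} {v : ℂ} (hv : (L.starFinset v).Nonempty)
    (h : L.dbar F v = 0) : ∑ z ∈ L.starFinset v, L.weightEdge v z * F z = 0 := by
  rw [dbar, finsum_star] at h
  have hm : 0 < L.mass v := Finset.sum_pos (fun z hz => area_pos (starFinset_subset hz)) hv
  have h4 : (4 * (L.weightVertex v : ℂ)) ≠ 0 := by
    have := four_mul_weightVertex (L := L) v
    rw [← Complex.ofReal_ofNat, ← Complex.ofReal_mul, this]
    exact Complex.ofReal_ne_zero.2 hm.ne'
  exact (mul_eq_zero.1 h).resolve_left (one_div_ne_zero h4)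

open Classical in
-- The vertices following and preceding a white vertex are the ends of a black diagonal, so `dbar`
-- is, up to a factor, the circulation of the edge form `F du` around the face. Its real part is the
-- closedness relation.
theorem sum_white_eq_zero {F : ℂ → ℂ} (hw : L.IsWhiteVertex w z) (h : L.dbar F w = 0) :
    ∑ z ∈ L.starFinset w, (if w = L.w₁ z then (F z * (L.u₂ z - L.u₁ z)).re
      else -(F z * (L.u₂ z - L.u₁ z)).re) = 0 := by
  have h1 := sum_weightEdge_eq_zero ⟨z, (mem_starFinset_white hw).2 hw⟩ h
  have h2 : ∑ z ∈ L.starFinset w, L.weightEdge w z * F z = Complex.I * ∑ z ∈ L.starFinset w,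
      (if w = L.w₁ z then F z * (L.u₂ z - L.u₁ z) else -(F z * (L.u₂ z - L.u₁ z))) := by
    rw [Finset.mul_sum]
    refine Finset.sum_congr rfl fun z' hz' => ?_
    rw [((mem_starFinset_white hw).1 hz').weightEdge]
    split_ifs <;> ring
  rw [h2] at h1
  have h3 := congrArg Complex.re ((mul_eq_zero.1 h1).resolve_left Complex.I_ne_zero)
  rw [Complex.re_sum, Complex.zero_re] at h3
  rw [← h3]
  refine Finset.sum_congr rfl fun z' _ => ?_
  split_ifs <;> simp

theorem eq_of_eq_blackPart {F : ℂ → ℂ} (hz : z ∈ L.diamond) (h : F z = L.blackPart F z) :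
    F z * (L.u₂ z - L.u₁ z) = ((F z * (L.u₂ z - L.u₁ z)).re : ℂ) := by
  have hd : (L.u₂ z - L.u₁ z) ≠ 0 := norm_ne_zero_iff.1 (diag_pos hz).ne'
  rw [blackPart, ← neg_sub, proj_conj_neg, proj_conj] at h
  have hd' : conj (L.u₂ z - L.u₁ z) ≠ 0 := (map_ne_zero _).2 hd
  nth_rw 1 [h]
  rw [Complex.ofReal_div, Complex.ofReal_pow, mul_assoc, mul_comm (conj _), Complex.mul_conj,
    Complex.normSq_eq_norm_sq, Complex.ofReal_pow, div_mul_cancel₀]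
  exact pow_ne_zero 2 (Complex.ofReal_ne_zero.2 (diag_pos hz).ne')

/-- At a black vertex the weight of `dbar` equals `cond` times the edge vector, and that vector
times `F` is the real increment of `H`; the two sums coincide term by term. -/
theorem lap_eq_zero_of_dbar_eq_zero {F : ℂ → ℂ} {H : ℂ → ℝ} (hu : u ∈ L.black)
    (hF : ∀ z, L.IsBlackVertex u z → F z = L.blackPart F z)
    (hH : ∀ z, L.IsBlackVertex u z → H (L.u₂ z) - H (L.u₁ z) = (F z * (L.u₂ z - L.u₁ z)).re)
    (h : L.dbar F u = 0) : L.lap H u = 0 := by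
  obtain ⟨z₀, hz₀⟩ := mem_black_iff.1 hu
  have h1 := sum_weightEdge_eq_zero ⟨z₀, (mem_starFinset hu).2 hz₀⟩ h
  have h2 : ((L.lap H u : ℝ) : ℂ) = ∑ z ∈ L.starFinset u, L.weightEdge u z * F z := by
    rw [lap, Complex.ofReal_sum]
    refine Finset.sum_congr rfl fun z hz => ?_
    have hz := (mem_starFinset hu).1 hz
    rw [hz.weightEdge, Complex.ofReal_mul, mul_assoc]
    congr 1
    have k1 := hH z hz
    have k2 := eq_of_eq_blackPart hz.1 (hF z hz)
    rw [← k1] at k2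
    obtain ⟨hzd, rfl | rfl⟩ := hz
    · rw [opp_u₁ hzd, ← k2, mul_comm]
    · rw [opp_u₂ hzd, ← neg_sub (H _), ← neg_sub (L.u₂ z), Complex.ofReal_neg, ← k2]
      ring
  rw [h1] at h2
  exact_mod_cast h2

/-- `F` is discrete holomorphic, bounded by `M` and equal to its black part, in the disc `B(x, ρ)`. -/
structure HolomorphicOn (L : RhombicLattice δ) (F : ℂ → ℂ) (x : ℂ) (ρ M : ℝ) : Prop where
  eq_blackPart : ∀ z ∈ L.diamond, ‖z - x‖ < ρ → F z = L.blackPart F z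
  norm_le : ∀ z ∈ L.diamond, ‖z - x‖ < ρ → ‖F z‖ ≤ M
  black : ∀ u ∈ L.black, ‖u - x‖ < ρ → L.dbar F u = 0
  white : ∀ w z, L.IsWhiteVertex w z → ‖w - x‖ < ρ → L.dbar F w = 0

/-- Near the centre of a large disc, a discrete holomorphic function is the black part of a constant,
up to a small error. -/
theorem exists_norm_sub_proj_le {κ : ℝ} (hκ : 0 < κ) : ∃ C K : ℝ, 0 < C ∧ 1 ≤ K ∧
    ∀ (δ : ℝ) (L : RhombicLattice δ), L.Fat κ → ∀ x ∈ L.black, ∀ ρ : ℝ, K * δ ≤ ρ →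
    ∀ (F : ℂ → ℂ) (M : ℝ), 0 ≤ M → L.HolomorphicOn F x ρ M →
    ∃ b : ℂ, ∀ z ∈ L.diamond, ‖z - x‖ ≤ 10 * δ →
      ‖F z - proj b (conj (L.u₂ z - L.u₁ z))‖ ≤ C * (M * δ / ρ) := by
  obtain ⟨C, K, hC, hK, happ⟩ := exists_affine_approx hκ
  refine ⟨2 * C / κ, K + 24, by positivity, by linarith, ?_⟩
  intro δ L hL x hx ρ hρ F M hM hF
  have hδ := hL.delta_pos
  have hρ24 : 24 * δ ≤ ρ := by nlinarith
  have hρ0 : 0 < ρ := by linarith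
  obtain ⟨H, hH⟩ := exists_potential hL x ρ (fun z => (F z * (L.u₂ z - L.u₁ z)).re) hx
    (by rw [sub_self, norm_zero]; linarith)
    (fun w z hw hwx => sum_white_eq_zero hw (hF.white w z hw hwx))
  have hH' : ∀ z ∈ L.diamond, ‖z - x‖ < ρ - 4 * δ →
      H (L.u₂ z) - H (L.u₁ z) = (F z * (L.u₂ z - L.u₁ z)).re := by
    intro z hz hzx
    have h1 := norm_sub_center_le (isBlackVertex_u₁ hz)
    have h2 := norm_sub_center_le (isBlackVertex_u₂ hz)
    have h3 := norm_add_le (L.u₁ z - z) (z - x)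
    have h4 := norm_add_le (L.u₂ z - z) (z - x)
    rw [sub_add_sub_cancel] at h3 h4
    exact hH z hz (by linarith) (by linarith)
  have hstar : ∀ u z, ‖u - x‖ < ρ - 6 * δ → L.IsBlackVertex u z → ‖z - x‖ < ρ - 4 * δ := by
    intro u z hu hz
    have h1 := norm_sub_center_le hz
    have h2 := norm_add_le (z - u) (u - x)
    rw [sub_add_sub_cancel, norm_sub_rev z u] at h2
    linarith
  obtain ⟨b, hb⟩ := happ δ L hL x hx (ρ - 6 * δ) (by nlinarith) H M
    (fun u hu hux => lap_eq_zero_of_dbar_eq_zero hu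
      (fun z hz => hF.eq_blackPart z hz.1 (by linarith [hstar u z hux hz]))
      (fun z hz => hH' z hz.1 (hstar u z hux hz)) (hF.black u hu (by linarith))) hM
    (fun z hz hzx => by
      rw [hH' z hz (by linarith)]
      refine (Complex.abs_re_le_norm _).trans ?_
      have h1 := hF.norm_le z hz (by linarith)
      have h2 := diag_le hz
      rw [norm_mul, mul_comm]
      gcongr)
  refine ⟨b, fun z hz hzx => ?_⟩
  have hd := diag_pos hz
  have hξ : L.u₂ z - L.u₁ z ≠ 0 := norm_ne_zero_iff.1 hd.ne'
  have h1 := hb z hz hzx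
  rw [hH' z hz (by linarith)] at h1
  have h2 : F z = proj (F z) (conj (L.u₂ z - L.u₁ z)) := by
    conv_lhs => rw [hF.eq_blackPart z hz (by linarith), blackPart, ← neg_sub, proj_conj_neg]
  -- Both vectors lie on the line of the conjugate edge, where the norm is the real part of the
  -- product with the edge divided by the edge length. Hence one power of `δ` is lost from the bound
  -- on increments.
  have h3 : ‖F z - proj b (conj (L.u₂ z - L.u₁ z))‖ * ‖L.u₂ z - L.u₁ z‖ =
      |(F z * (L.u₂ z - L.u₁ z)).re - (b * (L.u₂ z - L.u₁ z)).re| := by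
    conv_lhs => rw [h2, proj_conj, proj_conj]
    rw [← sub_mul, ← Complex.ofReal_sub, ← sub_div, norm_mul, Complex.norm_conj, Complex.norm_real,
      norm_div, norm_pow, norm_norm, Real.norm_eq_abs]
    field_simp
  have h4 := le_diag hL hz
  have hκ' := hL.kappa_pos
  have h5 : ‖F z - proj b (conj (L.u₂ z - L.u₁ z))‖ * (κ * δ) ≤ C * (M * δ ^ 2 / (ρ / 2)) := by
    refine (mul_le_mul_of_nonneg_left h4 (norm_nonneg _)).trans (h3.trans_le (h1.trans ?_))
    gcongr
    linarith
  rw [← le_div_iff₀ (by positivity)] at h5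
  refine h5.trans_eq ?_
  field_simp

theorem norm_two_mul_average_sub_le (hL : L.Fat κ) (hu : u ∈ L.black) {F : ℂ → ℂ} {b : ℂ} {ε : ℝ}
    (h : ∀ z, L.IsBlackVertex u z → ‖F z - proj b (conj (L.u₂ z - L.u₁ z))‖ ≤ ε) :
    ‖2 * L.average F u - b‖ ≤ 2 * ε := by
  have h1 := norm_average_le hu (F := fun z => F z - proj b (conj (L.u₂ z - L.u₁ z))) h
  rw [average_sub] at h1
  nth_rw 1 [← two_mul_average_proj hL hu b]
  rw [← mul_sub, norm_mul, Complex.norm_ofNat]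
  linarith

/-! ### Discrete discs, and the proof of the proposition. -/

theorem IsBlackVertex.mem_discDiamond {u₀ : ℂ} {R : ℝ} (hz : L.IsBlackVertex u z)
    (hu : u ∈ L.discInt u₀ R) : z ∈ L.discDiamond u₀ R := by
  refine ⟨hz.1, .inl ⟨z, hz.1, .inl rfl, ?_⟩⟩
  obtain ⟨-, rfl | rfl⟩ := hz
  exacts [.inl hu, .inr hu]

theorem discInt_subset {u₀ : ℂ} (hu₀ : u₀ ∈ L.black) {R : ℝ} (hR : 0 < R) :
    ∀ v ∈ L.discInt u₀ R, v ∈ L.black ∧ ‖v - u₀‖ < R := by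
  intro v hv
  rcases Relation.ReflTransGen.cases_tail hv with rfl | ⟨a, -, ⟨z, hz, h⟩, -, hb⟩
  · exact ⟨hu₀, by simpa using hR⟩
  · refine ⟨⟨z, hz, ?_⟩, by rwa [← dist_eq_norm]⟩
    rcases h with h | h
    exacts [.inr h.2, .inl h.2]

theorem exists_isBlackVertex_of_adj (h : L.Adj u u') :
    ∃ z, L.IsBlackVertex u z ∧ L.IsBlackVertex u' z ∧ u' = opp u z := by
  obtain ⟨z, hz, ⟨rfl, rfl⟩ | ⟨rfl, rfl⟩⟩ := h
  · exact ⟨z, isBlackVertex_u₁ hz, isBlackVertex_u₂ hz, (opp_u₁ hz).symm⟩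
  · exact ⟨z, isBlackVertex_u₂ hz, isBlackVertex_u₁ hz, (opp_u₂ hz).symm⟩

theorem disc_subset {u₀ : ℂ} (hu₀ : u₀ ∈ L.black) (hδ : 0 < δ) {R : ℝ} (hR : 0 < R) :
    ∀ v ∈ L.disc u₀ R, v ∈ L.black ∧ ‖v - u₀‖ < R + 2 * δ := by
  rintro v (hv | ⟨-, a, ha, hav⟩)
  · have := discInt_subset hu₀ hR v hv
    exact ⟨this.1, by linarith [this.2]⟩
  · obtain ⟨z, hz, hz', rfl⟩ := exists_isBlackVertex_of_adj hav
    have h1 := (discInt_subset hu₀ hR a ha).2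
    have h2 := hz.norm_opp_sub_le
    have h3 := norm_add_le (opp a z - a) (a - u₀)
    rw [sub_add_sub_cancel] at h3
    exact ⟨hz'.mem_black, by linarith⟩

/-- Replaces the combinatorial disc by round ones. All black vertices within `R - 3 δ` of `u₀` are
interior, and the margin `5 δ` also accommodates the rhombi around the white vertices. -/
theorem HolomorphicInDisc.holomorphicOn (hL : L.Fat κ) {F : ℂ → ℂ} {u₀ : ℂ} (hu₀ : u₀ ∈ L.black)
    {R M : ℝ} (hF : L.HolomorphicInDisc F u₀ R) (hB : ∀ z ∈ L.discDiamond u₀ R, F z = L.blackPart F z)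
    (hM : ∀ z ∈ L.discDiamond u₀ R, ‖F z‖ ≤ M) {ρ : ℝ} (h : ‖x - u₀‖ + ρ ≤ R - 5 * δ) :
    L.HolomorphicOn F x ρ M := by
  have hδ := hL.delta_pos
  have hin : ∀ y, ‖y - x‖ < ρ → ‖y - u₀‖ < R - 5 * δ := fun y hy => by
    have := norm_add_le (y - x) (x - u₀)
    rw [sub_add_sub_cancel] at this
    linarith
  have hint : ∀ z ∈ L.diamond, ‖z - u₀‖ < R - 4 * δ → L.u₁ z ∈ L.discInt u₀ R := by
    intro z hz hzu
    have h1 := norm_sub_center_le (isBlackVertex_u₁ hz)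
    have h2 := norm_add_le (L.u₁ z - z) (z - u₀)
    rw [sub_add_sub_cancel] at h2
    exact mem_discInt hL hu₀ (isBlackVertex_u₁ hz).mem_black (by linarith)
  have hdia : ∀ z ∈ L.diamond, ‖z - x‖ < ρ → z ∈ L.discDiamond u₀ R := fun z hz hzx =>
    (isBlackVertex_u₁ hz).mem_discDiamond (hint z hz (by linarith [hin z hzx]))
  refine ⟨fun z hz hzx => hB z (hdia z hz hzx), fun z hz hzx => hM z (hdia z hz hzx),
    fun u hu hux => hF u (.inl (mem_discInt hL hu₀ hu (by linarith [hin u hux]))),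
    fun w z hw hwx => hF w (.inr ⟨z, hw.1, hw.2, .inl (hint z hw.1 ?_)⟩)⟩
  have h1 := dist_center_le hw.1 hw.mem
  have h2 := norm_add_le (z - w) (w - u₀)
  rw [sub_add_sub_cancel, norm_sub_rev z w] at h2
  linarith [hin w hwx]

end RhombicLattice

open RhombicLattice in
theorem proposition2p17 (η : ℝ) (hη : 0 < η) :
    ∃ C : ℝ, 0 < C ∧
      ∀ (δ : ℝ), 0 < δ → ∀ (L : RhombicLattice δ), L.AnglesBounded η →
      ∀ (u₀ : ℂ), u₀ ∈ L.black → ∀ (R : ℝ), 0 < R →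
      ∀ (F : ℂ → ℂ), L.HolomorphicInDisc F u₀ R →
        (∀ z ∈ L.discDiamond u₀ R, F z = L.blackPart F z) →
      ∀ (M : ℝ), (∀ z ∈ L.discDiamond u₀ R, ‖F z‖ ≤ M) →
        (∀ u : ℂ, L.Adj u₀ u →
          ‖F ((u + u₀) / 2) -
              RhombicLattice.proj (2 * L.average F u₀) ((starRingEnd ℂ) (u - u₀))‖
            ≤ C * (M * δ / R)) ∧
        (∀ r : ℝ, 0 < r → r < R → L.disc u₀ r ⊆ L.discInt u₀ R →
          ∀ u₁ ∈ L.disc u₀ r, ∀ u₂ ∈ L.disc u₀ r,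
            ‖L.average F u₂ - L.average F u₁‖ ≤ C * (M * ‖u₂ - u₁‖ / (R - r))) := by
  -- If `sin η ≤ 0`, no lattice satisfies the angle condition and any constant will do.
  by_cases hη' : 0 < Real.sin η
  swap
  · exact ⟨1, one_pos, fun δ hδ L hL => absurd (hL.fat hη hδ).kappa_pos hη'⟩
  obtain ⟨κ, hκe⟩ : ∃ κ, κ = Real.sin η := ⟨_, rfl⟩
  rw [← hκe] at hη'
  obtain ⟨C, K, hC, hK, happ⟩ := exists_norm_sub_proj_le hη'
  have hK0 : 0 < K := by linarith
  -- One summand for each case: large and small `R` in the first claim, large and small `R - r` in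
  -- the second.
  refine ⟨6 * C + 6 * (K + 10) + 400 / κ ^ 2 * (1 + 2 / κ) * (4 * C) + 4 * (K + 20) / κ,
    by positivity, ?_⟩
  intro δ hδ L hLη u₀ hu₀ R hR F hF hFB M hFM
  have hL : L.Fat κ := hκe ▸ hLη.fat hη hδ
  have hu₀int : u₀ ∈ L.discInt u₀ R := Relation.ReflTransGen.refl
  have hM : 0 ≤ M := by
    obtain ⟨z, hz⟩ := mem_black_iff.1 hu₀
    exact (norm_nonneg _).trans (hFM z (hz.mem_discDiamond hu₀int))
  have hav : ∀ u ∈ L.discInt u₀ R, ‖L.average F u‖ ≤ M := fun u hu =>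
    norm_average_le (discInt_subset hu₀ hR u hu).1 fun z hz => hFM z (hz.mem_discDiamond hu)
  have p1 : 0 < 400 / κ ^ 2 * (1 + 2 / κ) * (4 * C) := by positivity
  have p2 : 0 < 4 * (K + 20) / κ := by positivity
  have near : ∀ v z, L.IsBlackVertex v z → ‖z - v‖ ≤ 10 * δ := fun v z hz => by
    rw [norm_sub_rev]
    linarith [norm_sub_center_le hz]
  refine ⟨fun u hu => ?_, fun r hr hrR hsub y₁ hy₁ y₂ hy₂ => ?_⟩
  · obtain ⟨z, hz, -, rfl⟩ := exists_isBlackVertex_of_adj hu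
    have ez : (opp u₀ z + u₀) / 2 = z := by rw [opp]; ring
    rw [ez]
    rcases le_or_gt (2 * (K + 10) * δ) R with hbig | hsmall
    · have hρ : R / 2 ≤ R - 5 * δ := by nlinarith
      have hρ0 : 0 < R - 5 * δ := by linarith
      obtain ⟨b, hb⟩ := happ δ L hL u₀ hu₀ (R - 5 * δ) (by nlinarith) F M hM
        (hF.holomorphicOn hL hu₀ hFB hFM (by simp))
      have h1 := hb z hz.1 (near u₀ z hz)
      have h2 := norm_two_mul_average_sub_le hL hu₀ (F := F) fun z hz => hb z hz.1 (near u₀ z hz)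
      have e : proj b (conj (L.u₂ z - L.u₁ z)) = proj b (conj (opp u₀ z - u₀)) := by
        obtain ⟨hzd, h | h⟩ := hz
        · rw [h, opp_u₁ hzd]
        · rw [h, opp_u₂ hzd, ← proj_conj_neg, neg_sub]
      rw [e] at h1
      have h3 := norm_proj_le (2 * L.average F u₀ - b) (conj (opp u₀ z - u₀))
      rw [proj_sub] at h3
      have h4 := norm_sub_le (F z - proj b (conj (opp u₀ z - u₀)))
        (proj (2 * L.average F u₀) (conj (opp u₀ z - u₀)) - proj b (conj (opp u₀ z - u₀)))
      rw [sub_sub_sub_cancel_right] at h4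
      have h5 : C * (M * δ / (R - 5 * δ)) ≤ C * (M * δ / (R / 2)) := by gcongr
      calc _ ≤ 3 * (C * (M * δ / (R / 2))) := by linarith
        _ = 6 * C * (M * δ / R) := by ring
        _ ≤ _ := by gcongr; linarith
    · have h1 := hFM z (hz.mem_discDiamond hu₀int)
      have h2 := norm_proj_le (2 * L.average F u₀) (conj (opp u₀ z - u₀))
      rw [norm_mul, Complex.norm_ofNat] at h2
      have h3 := hav u₀ hu₀int
      have h4 := norm_sub_le (F z) (proj (2 * L.average F u₀) (conj (opp u₀ z - u₀)))
      have h5 : 1 ≤ 2 * (K + 10) * δ / R := by rw [le_div_iff₀ hR]; linarith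
      calc _ ≤ 3 * M * 1 := by linarith
        _ ≤ 3 * M * (2 * (K + 10) * δ / R) := by gcongr
        _ = 6 * (K + 10) * (M * δ / R) := by ring
        _ ≤ _ := by gcongr; linarith
  · obtain ⟨hb₁, hr₁⟩ := disc_subset hu₀ hδ hr y₁ hy₁
    obtain ⟨hb₂, hr₂⟩ := disc_subset hu₀ hδ hr y₂ hy₂
    rcases eq_or_ne y₂ y₁ with rfl | hne
    · simp
    have hsep := black_separated hL hb₁ hb₂ hne
    have hRr : 0 < R - r := by linarith
    -- Distinct black vertices are at least `κ δ` apart, so additive constants in the edge count,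
    -- and the trivial bound, can be charged to `‖y₂ - y₁‖`.
    have hq : 1 ≤ ‖y₂ - y₁‖ / (κ * δ) := by rwa [le_div_iff₀ (by positivity), one_mul]
    rcases le_or_gt (2 * (K + 20) * δ) (R - r) with hbig | hsmall
    · have hρ : (R - r) / 2 ≤ R - r - 11 * δ := by nlinarith
      have hstep : ∀ z ∈ L.tube y₂ y₁, ‖L.average F (L.u₁ z) - L.average F (L.u₂ z)‖ ≤
          4 * C * (M * δ / (R - r)) := by
        intro z hz
        have hzd := ((mem_tube hL).1 hz).1
        have h1 := isBlackVertex_u₁ hzd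
        have h2 := isBlackVertex_u₂ hzd
        have h3 := norm_sub_lt_of_mem_tube hL hr₂ hr₁ hz h1
        obtain ⟨b, hb⟩ := happ δ L hL (L.u₁ z) h1.mem_black (R - r - 11 * δ) (by nlinarith) F M hM
          (hF.holomorphicOn hL hu₀ hFB hFM (by linarith))
        have k1 := norm_two_mul_average_sub_le hL h1.mem_black (F := F)
          fun z hz => hb z hz.1 (near _ z hz)
        -- The approximation around `u₁ z` reaches to distance `10 δ`, which includes all rhombi at
        -- the neighbour `u₂ z`; both averages are thus compared with the same `b`.
        have k2 := norm_two_mul_average_sub_le hL h2.mem_black (F := F) fun z' hz' => hb z' hz'.1 (by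
          have i1 := norm_sub_center_le hz'
          have i2 := diag_le hzd
          have i3 := norm_add_le (z' - L.u₂ z) (L.u₂ z - L.u₁ z)
          rw [sub_add_sub_cancel, norm_sub_rev z' (L.u₂ z)] at i3
          linarith)
        have k3 := norm_sub_le (2 * L.average F (L.u₁ z) - b) (2 * L.average F (L.u₂ z) - b)
        rw [sub_sub_sub_cancel_right, ← mul_sub, norm_mul, Complex.norm_ofNat] at k3
        have k4 : C * (M * δ / (R - r - 11 * δ)) ≤ C * (M * δ / ((R - r) / 2)) := by gcongr
        calc _ ≤ 2 * (C * (M * δ / ((R - r) / 2))) := by linarith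
          _ = _ := by rw [div_div_eq_mul_div]; ring
      have h := norm_sub_le_card_tube hL hb₂ hb₁ (L.average F) hstep
      have hc := card_tube_le hL y₂ y₁
      have hc' : ‖y₁ - y₂‖ / δ + 2 ≤ (1 + 2 / κ) * (‖y₂ - y₁‖ / δ) := by
        rw [norm_sub_rev]
        calc _ ≤ ‖y₂ - y₁‖ / δ + 2 * (‖y₂ - y₁‖ / (κ * δ)) := by linarith
          _ = _ := by ring
      calc _ ≤ 400 / κ ^ 2 * ((1 + 2 / κ) * (‖y₂ - y₁‖ / δ)) * (4 * C * (M * δ / (R - r))) := by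
            refine h.trans ?_
            gcongr
            exact hc.trans (by gcongr)
        _ = 400 / κ ^ 2 * (1 + 2 / κ) * (4 * C) * (M * ‖y₂ - y₁‖ / (R - r)) := by field_simp
        _ ≤ _ := by gcongr; linarith
    · have h1 := hav y₁ (hsub hy₁)
      have h2 := hav y₂ (hsub hy₂)
      have h3 : 1 ≤ 2 * (K + 20) * δ / (R - r) := by rw [le_div_iff₀ hRr]; linarith
      calc _ ≤ 2 * M * 1 * 1 := by linarith [norm_sub_le (L.average F y₂) (L.average F y₁)]
        _ ≤ 2 * M * (2 * (K + 20) * δ / (R - r)) * (‖y₂ - y₁‖ / (κ * δ)) := by gcongr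
        _ = 4 * (K + 20) / κ * (M * ‖y₂ - y₁‖ / (R - r)) := by field_simp; ring
        _ ≤ _ := by gcongr; linarith
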